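/- **Setup.** For each $n\ge 1$ consider the linear model $\mathbf y=\mathbf f+\boldsymbol\epsilon$ in $\mathbb R^n$, where $\mathbf f=\mathbf X\boldsymbol\beta$, $\mathbf X\in\mathbb R^{n\times p_n}$ is nonrandom with full column rank, $1\le p_n\le n$, and $\epsilon_1,\dots,\epsilon_n$ are i.i.d. with $\mathbb E\epsilon_i=0$, $\mathbb E\epsilon_i^2=\sigma^2>0$ and $\mathbb E e^{t\epsilon_i}\le e^{\eta^2t^2/2}$ for all $t\in\mathbb R$; $\sigma^2$ and $\eta$ do not depend on $n$. Let $\mathbf P_m$ be the orthogonal projection onto the span of the first $m$ columns of $\mathbf X$ ($\mathbf P_0=0$). Write $\mathbf P_j-\mathbf P_{j-1}=\boldsymbol\phi_j\boldsymbol\phi_j^\top$ with $\|\boldsymbol\phi_j\|=1$, and let $\theta_j=\boldsymbol\phi_j^\top\mathbf f/\sqrt n$, $1\le j\le p_n$. A nested candidate set $\mathcal M$ is given by its sizes $1\le k_1<\dots<k_M\le p_n$. For $\mathbf w$ in the unit simplex $\mathcal W_M\subset\mathbb R^M$ put $\mathbf P_{\mathbf w|\mathcal M}=\sum_m w_m\mathbf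 P_{k_m}$, $L_n(\mathbf w|\mathcal M,\mathbf f)=n^{-1}\|\mathbf P_{\mathbf w|\mathcal M}\mathbf y-\mathbf f\|^2$ and, for nonrandom $\mathbf w$, $$R_n(\mathbf w|\mathcal M,\mathbf f)=\mathbb E L_n(\mathbf w|\mathcal M,\mathbf f)=\tfrac1n\|\mathbf f-\mathbf P_{\mathbf w|\mathcal M}\mathbf f\|^2+\tfrac{\sigma^2}{n}\operatorname{tr}(\mathbf P_{\mathbf w|\mathcal M}^\top\mathbf P_{\mathbf w|\mathcal M}),$$ and $R_n(\mathbf w^*|\mathcal M,\mathbf f)=\min_{\mathbf w\in\mathcal W_M}R_n(\mathbf w|\mathcal M,\mathbf f)$. Given an estimator $\hat\sigma^2$ of $\sigma^2$, the MMA weights $\hat{\mathbf w}|\mathcal M$ minimize $\frac1n\|\mathbf y-\mathbf P_{\mathbf w|\mathcal M}\mathbf y\|^2+\frac{2\hat\sigma^2}{n}\sum_m k_mw_m$ over $\mathcal W_M$. For a fixed set $\mathcal M$ let $Q_n(\hat{\mathbf w}|\mathcal M,\mathbf f)$ be either $\mathbb E L_n(\hat{\mathbf w}|\mathcal M,\mathbf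 f)$ or $\mathbb E R_n(\hat{\mathbf w}|\mathcal M,\mathbf f)$, the latter with $\hat{\mathbf w}$ plugged into the right-hand side of the displayed formula. Let $\mathcal M_A$ be the set of all nested models (sizes $1,\dots,p_n$), and let $m_n^*\in\{1,\dots,p_n\}$ minimize $n^{-1}\mathbb E\|\mathbf P_m\mathbf y-\mathbf f\|^2$. With $k_0=0$, $S_j=\sum_{k_j<l\le k_M}\theta_l^2$ and $M'=\min\{1\le j\le M:S_j=0\}$, put $$\psi(\mathcal M)=\Big[M\wedge\Big(1+\sum_{j=1}^{M-1}\frac{k_{j+1}-k_j}{4k_j}+\sum_{j=1}^{M'-1}\frac{S_{j-1}-S_j}{4S_j}\Big)\Big](1+\log M)^2 .$$ For a random size $\hat m_n\in\{1,\dots,p_n\}$ and nonrandom $\kappa_l=\kappa_l(n)>1$, $\kappa_u=\kappa_u(n)>1$ with $\kappa_l\to\infty$, $\kappa_u\to\infty$, let $\hat{\mathcal M}_{MS1}$ be the set of nested models of sizes $1\vee\lfloor\kappa_l^{-1}\hat m_n\rfloor\le m\le p_n\wedge\lfloor\kappa_u\hat m_n\rfloor$. **Theorem.** Assume that 1. $\limsup_n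 n^{-1}\|\mathbf f\|^2<\infty$; 2. for each $n$, $|\theta_1|\ge|\theta_2|\ge\dots\ge|\theta_{p_n}|>0$; 3. $|\theta_{\lfloor\kappa l\rfloor}/\theta_l|\to0$ as $\kappa\to\infty$, uniformly over $n$ and over $l\ge 1$ with $\lfloor\kappa l\rfloor\le p_n$; 4. $p_n\,\mathbb E(\hat\sigma^2-\sigma^2)^2=o\big(nR_n(\mathbf w^*|\mathcal M_A,\mathbf f)\big)$; 5. $\mathbb E\psi(\hat{\mathcal M}_{MS1})=o(m_n^*)$; 6. for some constants $0<c_1<1<c_2$, $1-\mathbb P\big(\lfloor c_1m_n^*\rfloor\le\hat m_n\le\lfloor c_2m_n^*\rfloor\big)=o(m_n^*/n)$. Then, for both choices of $Q_n$, $Q_n(\hat{\mathbf w}|\mathcal M,\mathbf f)$ is finite for every nested $\mathcal M$, and $$\mathbb E\,Q_n(\hat{\mathbf w}|\hat{\mathcal M}_{MS1},\mathbf f)\le[1+o(1)]\,R_n(\mathbf w^*|\mathcal M_A,\mathbf f)\qquad(n\to\infty),$$ where $Q_n(\hat{\mathbf w}|\hat{\mathcal M}_{MS1},\mathbf f)$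 is the deterministic function $\mathcal M\mapsto Q_n(\hat{\mathbf w}|\mathcal M,\mathbf f)$ evaluated at the random set $\hat{\mathcal M}_{MS1}$. -/

import Mathlib

open MeasureTheory ProbabilityTheory Filter Topology
open scoped Matrix NNReal

noncomputable section

namespace MMA

/-- Squared Euclidean norm of a vector of `ℝⁿ`. -/
def sqNorm {n : ℕ} (v : Fin n → ℝ) : ℝ := ∑ i, v i ^ 2

/-- Normalized squared loss `‖g - f‖² / n`. -/
def loss {n : ℕ} (g f : Fin n → ℝ) : ℝ := sqNorm (g - f) / n

/-- Least squares projection `X_I (X_Iᵀ X_I)⁻¹ X_Iᵀ` for the regressors in `I`. -/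
def lsProj {n p : ℕ} (X : Matrix (Fin n) (Fin p) ℝ) (I : Finset (Fin p)) :
    Matrix (Fin n) (Fin n) ℝ :=
  let XI : Matrix (Fin n) I ℝ := X.submatrix id (fun j : I => (j : Fin p))
  XI * (XIᵀ * XI)⁻¹ * XIᵀ

/-- The nested candidate model of size `m`: the first `m` regressors. -/
def nestedIdx (p m : ℕ) : Finset (Fin p) := Finset.univ.filter (fun j => (j : ℕ) < m)

/-- Projection of the nested candidate model of size `m`. -/
def nestedProj {n p : ℕ} (X : Matrix (Fin n) (Fin p) ℝ) (m : ℕ) : Matrix (Fin n) (Fin n) ℝ :=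
  lsProj X (nestedIdx p m)

/-- A set of nested candidate models is recorded by the set `K ⊆ {1, …, p}` of its sizes
`k_1 < ⋯ < k_M`; weight vectors are functions on `K`. This is `∑ w_m P_m`. -/
def avgProj {n p : ℕ} (X : Matrix (Fin n) (Fin p) ℝ) (K : Finset ℕ) (w : K → ℝ) :
    Matrix (Fin n) (Fin n) ℝ :=
  ∑ m : K, w m • nestedProj X (m : ℕ)

/-- The response vector `y = f + ε`. -/
def response {n : ℕ} {Ω : Type*} (f : Fin n → ℝ) (ε : Fin n → Ω → ℝ) (ω : Ω) : Fin n → ℝ :=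
  fun i => f i + ε i ω

/-- The Mallows model averaging criterion, with estimate `s` of the noise variance. -/
def criterion {n p : ℕ} (X : Matrix (Fin n) (Fin p) ℝ) (K : Finset ℕ) (y : Fin n → ℝ) (s : ℝ)
    (w : K → ℝ) : ℝ :=
  sqNorm (y - avgProj X K w *ᵥ y) / n + 2 * s / n * ∑ m : K, ((m : ℕ) : ℝ) * w m

/-- Risk of the least squares estimator in the nested model of size `m`. -/
def msRisk {n p : ℕ} {Ω : Type*} [MeasurableSpace Ω] (μ : Measure Ω)
    (X : Matrix (Fin n) (Fin p) ℝ) (f : Fin n → ℝ) (ε : Fin n → Ω → ℝ) (m : ℕ) : ℝ :=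
  ∫ ω, loss (nestedProj X m *ᵥ response f ε ω) f ∂μ

/-- Risk of the model averaging estimator with nonrandom weights `w`. -/
def maRisk {n p : ℕ} {Ω : Type*} [MeasurableSpace Ω] (μ : Measure Ω)
    (X : Matrix (Fin n) (Fin p) ℝ) (f : Fin n → ℝ) (ε : Fin n → Ω → ℝ)
    (K : Finset ℕ) (w : K → ℝ) : ℝ :=
  ∫ ω, loss (avgProj X K w *ᵥ response f ε ω) f ∂μ

/-- Optimal model averaging risk over the unit simplex of weights. -/
def optRisk {n p : ℕ} {Ω : Type*} [MeasurableSpace Ω] (μ : Measure Ω)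
    (X : Matrix (Fin n) (Fin p) ℝ) (f : Fin n → ℝ) (ε : Fin n → Ω → ℝ) (K : Finset ℕ) : ℝ :=
  ⨅ w : stdSimplex ℝ K, maRisk μ X f ε K (w : K → ℝ)

/-- The closed form `‖f - P_w f‖² / n + σ² tr(P_wᵀ P_w) / n` of the risk, into which random
weights may be plugged. -/
def plugRisk {n p : ℕ} (σ : ℝ) (X : Matrix (Fin n) (Fin p) ℝ) (f : Fin n → ℝ)
    (K : Finset ℕ) (w : K → ℝ) : ℝ :=
  sqNorm (f - avgProj X K w *ᵥ f) / n
    + σ ^ 2 / n * Matrix.trace ((avgProj X K w)ᵀ * avgProj X K w)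

/-- `𝔼 L_n(ŵ | K, f)` for random weights `W`. -/
def expLoss {n p : ℕ} {Ω : Type*} [MeasurableSpace Ω] (μ : Measure Ω)
    (X : Matrix (Fin n) (Fin p) ℝ) (f : Fin n → ℝ) (ε : Fin n → Ω → ℝ)
    (K : Finset ℕ) (W : Ω → K → ℝ) : ℝ :=
  ∫ ω, loss (avgProj X K (W ω) *ᵥ response f ε ω) f ∂μ

/-- `𝔼 R_n(ŵ | K, f)` for random weights `W`. -/
def expRisk {n p : ℕ} {Ω : Type*} [MeasurableSpace Ω] (μ : Measure Ω) (σ : ℝ)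
    (X : Matrix (Fin n) (Fin p) ℝ) (f : Fin n → ℝ) (K : Finset ℕ) (W : Ω → K → ℝ) : ℝ :=
  ∫ ω, plugRisk σ X f K (W ω) ∂μ

/-- `φ_1, …, φ_p` are unit vectors with `P_j - P_{j-1} = φ_j φ_jᵀ`. -/
def IsNestedBasis {n p : ℕ} (X : Matrix (Fin n) (Fin p) ℝ) (φ : ℕ → Fin n → ℝ) : Prop :=
  ∀ j ∈ Finset.Icc 1 p, sqNorm (φ j) = 1 ∧
    nestedProj X j - nestedProj X (j - 1) = Matrix.vecMulVec (φ j) (φ j)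

/-- Transformed coefficients `θ_j = φ_jᵀ f / √n` (meaningful for `1 ≤ j ≤ p`). -/
def theta {n : ℕ} (φ : ℕ → Fin n → ℝ) (f : Fin n → ℝ) (j : ℕ) : ℝ :=
  (φ j ⬝ᵥ f) / Real.sqrt n

/-- The sizes `k_0 = 0` and `k_1 < ⋯ < k_M`, the increasing enumeration of `K`. -/
def ksize (K : Finset ℕ) (j : ℕ) : ℕ := if j = 0 then 0 else Nat.nth (· ∈ K) (j - 1)

/-- `S_j = ∑_{k_j < l ≤ k_M} θ_l²`. -/
def tailS (θ : ℕ → ℝ) (K : Finset ℕ) (j : ℕ) : ℝ :=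
  ∑ l ∈ Finset.Ioc (ksize K j) (ksize K K.card), θ l ^ 2

/-- `M' = min {1 ≤ j ≤ M : S_j = 0}`. -/
def cutM (θ : ℕ → ℝ) (K : Finset ℕ) : ℕ :=
  sInf {j : ℕ | 1 ≤ j ∧ j ≤ K.card ∧ tailS θ K j = 0}

/-- The complexity `ψ` of a set of nested candidate models. -/
def psi (θ : ℕ → ℝ) (K : Finset ℕ) : ℝ :=
  min (K.card : ℝ)
      (1 + ∑ j ∈ Finset.Ico 1 K.card,
            ((ksize K (j + 1) : ℝ) - (ksize K j : ℝ)) / (4 * (ksize K j : ℝ))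
         + ∑ j ∈ Finset.Ico 1 (cutM θ K),
            (tailS θ K (j - 1) - tailS θ K j) / (4 * tailS θ K j))
    * (1 + Real.log K.card) ^ 2

/-- The sizes between `1 ∨ ⌊m / κl⌋` and `p ∧ ⌊κu m⌋`. -/
def msSet (p : ℕ) (κl κu : ℝ) (m : ℕ) : Finset ℕ :=
  Finset.Icc (max 1 ⌊κl⁻¹ * (m : ℝ)⌋₊) (min p ⌊κu * (m : ℝ)⌋₊)

/-- `a_n ≤ [1 + o(1)] b_n` as `n → ∞`. -/
def LeOnePlusLittleO (a b : ℕ → ℝ) : Prop :=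
  ∃ δ : ℕ → ℝ, Tendsto δ atTop (𝓝 0) ∧ ∀ᶠ n in atTop, a n ≤ (1 + δ n) * b n

end MMA

end

/-! In the orthonormal basis `φ` every averaged projection is diagonal: its eigenvalues are the
cumulative weights `γ_l = ∑_{m ≥ l} w_m`, an antitone sequence in `[0, 1]`. Loss, risk and Mallows
criterion therefore live in a sequence model with signal `θ`, noise level `s = σ² / n` and such
sequences `g` as parameters (`seqLoss`, `seqRisk`, `seqCrit`).

Up to a term free of `g`, criterion minus risk is a sum of linear and quadratic noise terms weighted
by `g`, `g²` or `(1 - g)²`, plus the error of the variance estimate. Since the selected `g` depends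
on the data, these terms must be bounded uniformly over monotone weights. `sq_sum_antitone_le` does
this by dyadic chaining: the square of a weighted sum is at most a random factor, not involving the
weights, times a weighted energy that the risk dominates. The expected factor is a squared number of
scales times a sum of relative increments; for intervals of sizes this is at most a multiple of `ψ`
(`scale_mul_sizeRatioSum_le`, `scale_mul_energyRatioSum_le`). Because the fluctuation squared is at
most factor times risk, it can be absorbed into a small fraction of the risk. The result is the
oracle inequality `oracle_inequality`, and in expectation `nested_oracle_inequality`, for every
fixed window of sizes, with remainder of order `s ψ + (p / s) 𝔼 τ²`, where `τ` is the error of the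
variance estimate divided by `n`.

For the comparison of candidate sets, the coordinatewise minimum `linearOracle` of the risk bounds
the optimal risk over all nested models from below. On the event that the selected size is
comparable to `m*`, restricting to the window costs little (`exists_window_weight`): the forced
weights below the window cost at most a small multiple of `m* s`, and above it the decay condition
makes `θ²` small against `s`. Optimality of `m*` puts `s` between `θ_{m*}²` and `θ_{m*+1}²`, so `m*
s` is at most twice the optimal risk. This converts `𝔼 ψ = o(m*)` and a failure probability `o(m* /
n)` into negligible terms (`remainder_le`); on the failure event the risk at any weights is merely
bounded.

The inequality holds for each deterministic size, so it can be integrated over the selected size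
without any independence between selection and averaging (`asymptotic_optimality`). -/

noncomputable section

namespace MMA

set_option linter.unusedSectionVars false

/-! ### Dyadic chaining for sums with antitone weights. -/

/-- Partial sums `x_1 + ⋯ + x_k`. -/
def partialSum (x : ℕ → ℝ) (k : ℕ) : ℝ := ∑ i ∈ Finset.Ioc 0 k, x i

/-- Weighted sum of squares of the dyadic increments of the partial sums of `x`. -/
def chainStat (R N : ℕ) (v x : ℕ → ℝ) : ℝ :=
  R * ∑ r ∈ Finset.range R, ∑ t ∈ Finset.range (N / 2 ^ r + 1),
    (∑ i ∈ Finset.Ioc (t / 2 * 2 ^ (r + 1)) (t * 2 ^ r), x i) ^ 2 / partialSum v (t * 2 ^ r)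

lemma partialSum_sub (x : ℕ → ℝ) {j k : ℕ} (h : j ≤ k) :
    partialSum x k - partialSum x j = ∑ i ∈ Finset.Ioc j k, x i := by
  unfold partialSum
  rw [← Finset.sum_Ioc_consecutive x (Nat.zero_le j) h]; ring

lemma partialSum_zero (x : ℕ → ℝ) : partialSum x 0 = 0 := by simp [partialSum]

lemma partialSum_mono {v : ℕ → ℝ} (hv : ∀ i, 0 ≤ v i) : Monotone (partialSum v) := by
  intro j k h
  have := partialSum_sub v h
  have h2 : 0 ≤ ∑ i ∈ Finset.Ioc j k, v i := Finset.sum_nonneg fun i _ => hv i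
  linarith

lemma dyadic_le (r t : ℕ) : t / 2 * 2 ^ (r + 1) ≤ t * 2 ^ r := by
  have : t / 2 * 2 ≤ t := Nat.div_mul_le_self t 2
  calc t / 2 * 2 ^ (r + 1) = (t / 2 * 2) * 2 ^ r := by ring
    _ ≤ _ := Nat.mul_le_mul_right _ this

/-- Dyadic chaining of a partial sum. -/
lemma partialSum_eq_chain (x : ℕ → ℝ) {m R : ℕ} (hm : m < 2 ^ R) :
    partialSum x m = ∑ r ∈ Finset.range R,
      ∑ i ∈ Finset.Ioc (m / 2 ^ r / 2 * 2 ^ (r + 1)) (m / 2 ^ r * 2 ^ r), x i := by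
  have h1 : ∀ r ∈ Finset.range R,
      ∑ i ∈ Finset.Ioc (m / 2 ^ r / 2 * 2 ^ (r + 1)) (m / 2 ^ r * 2 ^ r), x i
        = partialSum x (m / 2 ^ r * 2 ^ r) - partialSum x (m / 2 ^ (r + 1) * 2 ^ (r + 1)) := by
    intro r _
    rw [← partialSum_sub x (dyadic_le r _), Nat.div_div_eq_div_mul, ← pow_succ]
  rw [Finset.sum_congr rfl h1, Finset.sum_range_sub' (fun r => partialSum x (m / 2 ^ r * 2 ^ r))]
  simp [Nat.div_eq_of_lt hm, partialSum_zero]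

/-- The jumps of `g`, with `g` replaced by `0` past `N`, telescope. This serves both Abel summation
and the construction of weights from prescribed cumulative weights. -/
lemma sum_telescope_cut (g : ℕ → ℝ) (i N : ℕ) (h : i ≤ N) :
    ∑ m ∈ Finset.range (N + 1), (if i ≤ m then (g m - if m < N then g (m + 1) else 0) else 0)
      = g i := by
  induction N, h using Nat.le_induction with
  | base =>
    rw [Finset.sum_eq_single i]
    · simp
    · intro m hm hne
      have : ¬ i ≤ m := by have := Finset.mem_range.1 hm; omega
      simp [this]
    · simp
  | succ n hn ih =>
    rw [Finset.sum_range_succ] at ih ⊢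
    rw [Finset.sum_range_succ]
    have e : ∀ m ∈ Finset.range n,
        (if i ≤ m then (g m - if m < n + 1 then g (m + 1) else 0) else 0)
        = (if i ≤ m then (g m - if m < n then g (m + 1) else 0) else 0) := by
      intro m hm
      have := Finset.mem_range.1 hm
      simp [this, show m < n + 1 by omega]
    rw [Finset.sum_congr rfl e]
    simp only [hn, if_true, lt_irrefl, if_false, Nat.lt_succ_self, show i ≤ n + 1 by omega] at ih ⊢
    linarith

lemma sum_sq_le_sq_sum_of_nonneg {ι : Type*} (s : Finset ι) (a : ι → ℝ) (h : ∀ i ∈ s, 0 ≤ a i) :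
    ∑ i ∈ s, a i ^ 2 ≤ (∑ i ∈ s, a i) ^ 2 := by
  rw [sq (∑ i ∈ s, a i), Finset.sum_mul]
  refine Finset.sum_le_sum fun i hi => ?_
  rw [sq]
  exact mul_le_mul_of_nonneg_left (Finset.single_le_sum h hi) (h i hi)

/-- Control of `∑ g_i x_i` by `(∑ g_i² v_i)^{1/2}`, uniformly over nonnegative antitone `g`. -/
theorem sq_sum_antitone_le {N R : ℕ} (hR : N < 2 ^ R) (x v g : ℕ → ℝ) (hv : ∀ i, 0 ≤ v i)
    (hV : ∀ k, 0 < k → k ≤ N → 0 < partialSum v k) (hg : Antitone g) (hg0 : ∀ i, 0 ≤ g i) :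
    (∑ i ∈ Finset.Ioc 0 N, g i * x i) ^ 2
      ≤ chainStat R N v x * ∑ i ∈ Finset.Ioc 0 N, g i ^ 2 * v i := by
  -- The jumps of `g` are nonnegative, so `g` is a positive mixture of indicators of initial
  -- segments and only partial sums of `x` need control.
  set w : ℕ → ℝ := fun m => g m - if m < N then g (m + 1) else 0 with hw
  have hw0 : ∀ m, 0 ≤ w m := by
    intro m
    simp only [hw]
    split_ifs
    · linarith [hg (Nat.le_succ m)]
    · linarith [hg0 m]
  have hcum : ∀ i ≤ N, ∑ m ∈ Finset.range (N + 1), (if i ≤ m then w m else 0) = g i :=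
    fun i hi => sum_telescope_cut g i N hi
  -- Abel summation
  have habel : ∑ i ∈ Finset.Ioc 0 N, g i * x i
      = ∑ m ∈ Finset.range (N + 1), w m * partialSum x m := by
    have : ∀ i ∈ Finset.Ioc 0 N, g i * x i
        = ∑ m ∈ Finset.range (N + 1), (if i ≤ m then w m * x i else 0) := by
      intro i hi
      rw [← hcum i (Finset.mem_Ioc.1 hi).2, Finset.sum_mul]
      refine Finset.sum_congr rfl fun m _ => ?_
      split_ifs <;> simp
    rw [Finset.sum_congr rfl this, Finset.sum_comm]
    refine Finset.sum_congr rfl fun m hm => ?_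
    rw [← Finset.sum_filter, partialSum, Finset.mul_sum]
    refine Finset.sum_congr ?_ fun _ _ => rfl
    ext i
    have := Finset.mem_range.1 hm
    simp only [Finset.mem_filter, Finset.mem_Ioc]
    omega
  set Δ : ℕ → ℕ → ℝ := fun r t => ∑ i ∈ Finset.Ioc (t / 2 * 2 ^ (r + 1)) (t * 2 ^ r), x i with hΔ
  set W : ℕ → ℕ → ℝ := fun r t => ∑ m ∈ (Finset.range (N + 1)).filter (fun m => m / 2 ^ r = t), w m
    with hW
  have hW0 : ∀ r t, 0 ≤ W r t := fun r t => Finset.sum_nonneg fun m _ => hw0 m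
  have hdec : ∑ m ∈ Finset.range (N + 1), w m * partialSum x m
      = ∑ r ∈ Finset.range R, ∑ t ∈ Finset.range (N / 2 ^ r + 1), W r t * Δ r t := by
    have : ∀ m ∈ Finset.range (N + 1), w m * partialSum x m
        = ∑ r ∈ Finset.range R, w m * Δ r (m / 2 ^ r) := by
      intro m hm
      have := Finset.mem_range.1 hm
      rw [partialSum_eq_chain x (show m < 2 ^ R by omega), Finset.mul_sum]
    rw [Finset.sum_congr rfl this, Finset.sum_comm]
    refine Finset.sum_congr rfl fun r _ => ?_
    rw [← Finset.sum_fiberwise_of_maps_to (s := Finset.range (N + 1))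
      (t := Finset.range (N / 2 ^ r + 1)) (g := fun m => m / 2 ^ r)]
    · refine Finset.sum_congr rfl fun t _ => ?_
      rw [hW, Finset.sum_mul]
      refine Finset.sum_congr rfl fun m hm => ?_
      rw [(Finset.mem_filter.1 hm).2]
    · intro m hm
      have h1 := Finset.mem_range.1 hm
      have : m / 2 ^ r ≤ N / 2 ^ r := Nat.div_le_div_right (by omega)
      simp only [Finset.mem_range]; omega
  have hVnn : ∀ k, 0 ≤ partialSum v k := fun k => Finset.sum_nonneg fun i _ => hv i
  -- Exchanging the sums, the coefficient of `v i` is the sum of `W r t ^ 2` over blocks starting at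
  -- or after `i`. It is at most the square of the sum of these `W r t`, and those blocks carry only
  -- jumps at indices `≥ i`, whose total is `g i`.
  have hlevelW : ∀ r, ∑ t ∈ Finset.range (N / 2 ^ r + 1), W r t ^ 2 * partialSum v (t * 2 ^ r)
      ≤ ∑ i ∈ Finset.Ioc 0 N, g i ^ 2 * v i := by
    intro r
    have e1 : ∀ t ∈ Finset.range (N / 2 ^ r + 1), W r t ^ 2 * partialSum v (t * 2 ^ r)
        = ∑ i ∈ Finset.Ioc 0 N, (if i ≤ t * 2 ^ r then W r t else 0) ^ 2 * v i := by
      intro t ht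
      have ht1 : t * 2 ^ r ≤ N := by
        have := Nat.mul_le_mul_right (2 ^ r) (Nat.lt_succ_iff.1 (Finset.mem_range.1 ht))
        exact this.trans (Nat.div_mul_le_self _ _)
      have : ∀ i ∈ Finset.Ioc 0 N, (if i ≤ t * 2 ^ r then W r t else 0) ^ 2 * v i
          = if i ≤ t * 2 ^ r then W r t ^ 2 * v i else 0 := by
        intro i _; split_ifs <;> simp
      rw [Finset.sum_congr rfl this, ← Finset.sum_filter, partialSum, Finset.mul_sum]
      refine Finset.sum_congr ?_ fun _ _ => rfl
      ext i
      simp only [Finset.mem_filter, Finset.mem_Ioc]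
      omega
    rw [Finset.sum_congr rfl e1, Finset.sum_comm]
    refine Finset.sum_le_sum fun i hi => ?_
    rw [← Finset.sum_mul]
    refine mul_le_mul_of_nonneg_right ?_ (hv i)
    have hnn : ∀ t ∈ Finset.range (N / 2 ^ r + 1), 0 ≤ (if i ≤ t * 2 ^ r then W r t else 0) := by
      intro t _; split_ifs; exacts [hW0 r t, le_rfl]
    refine (sum_sq_le_sq_sum_of_nonneg _ _ hnn).trans ?_
    refine pow_le_pow_left₀ (Finset.sum_nonneg hnn) ?_ 2
    rw [← hcum i (Finset.mem_Ioc.1 hi).2]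
    rw [← Finset.sum_fiberwise_of_maps_to (s := Finset.range (N + 1))
      (t := Finset.range (N / 2 ^ r + 1)) (g := fun m => m / 2 ^ r)
      (f := fun m => if i ≤ m then w m else 0)]
    · refine Finset.sum_le_sum fun t _ => ?_
      split_ifs with h
      · refine Finset.sum_le_sum fun m hm => ?_
        have hmt := (Finset.mem_filter.1 hm).2
        have h2 : t * 2 ^ r ≤ m := by rw [← hmt]; exact Nat.div_mul_le_self _ _
        rw [if_pos (h.trans h2)]
      · refine Finset.sum_nonneg fun m _ => ?_
        split_ifs; exacts [hw0 m, le_rfl]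
    · intro m hm
      have h1 := Finset.mem_range.1 hm
      have : m / 2 ^ r ≤ N / 2 ^ r := Nat.div_le_div_right (by omega)
      simp only [Finset.mem_range]; omega
  have hlevel : ∀ r, (∑ t ∈ Finset.range (N / 2 ^ r + 1), W r t * Δ r t) ^ 2
      ≤ (∑ i ∈ Finset.Ioc 0 N, g i ^ 2 * v i) *
        ∑ t ∈ Finset.range (N / 2 ^ r + 1), Δ r t ^ 2 / partialSum v (t * 2 ^ r) := by
    intro r
    refine (Finset.sum_sq_le_sum_mul_sum_of_sq_le_mul _
      (f := fun t => W r t ^ 2 * partialSum v (t * 2 ^ r))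
      (g := fun t => Δ r t ^ 2 / partialSum v (t * 2 ^ r)) ?_ ?_ ?_).trans ?_
    · intro t _; exact mul_nonneg (sq_nonneg _) (hVnn _)
    · intro t _; exact div_nonneg (sq_nonneg _) (hVnn _)
    · intro t ht
      refine le_of_eq ?_
      -- At `t = 0` the increment is an empty sum, so the division by `partialSum v 0 = 0` does no
      -- harm.
      rcases Nat.eq_zero_or_pos t with h0 | h0
      · subst h0; simp [hΔ]
      · have ht1 : t * 2 ^ r ≤ N := by
          have := Nat.mul_le_mul_right (2 ^ r) (Nat.lt_succ_iff.1 (Finset.mem_range.1 ht))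
          exact this.trans (Nat.div_mul_le_self _ _)
        have := (hV (t * 2 ^ r) (by positivity) ht1).ne'
        field_simp
    · exact mul_le_mul_of_nonneg_right (hlevelW r)
        (Finset.sum_nonneg fun t _ => div_nonneg (sq_nonneg _) (hVnn _))
  rw [habel, hdec]
  refine (sq_sum_le_card_mul_sum_sq).trans ?_
  rw [Finset.card_range, chainStat, mul_assoc]
  refine mul_le_mul_of_nonneg_left ?_ (Nat.cast_nonneg R)
  refine (Finset.sum_le_sum fun r _ => hlevel r).trans ?_
  rw [← Finset.mul_sum, mul_comm]

lemma chainStat_nonneg (R N : ℕ) {v : ℕ → ℝ} (hv : ∀ i, 0 ≤ v i) (x : ℕ → ℝ) :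
    0 ≤ chainStat R N v x := by
  refine mul_nonneg (Nat.cast_nonneg R) (Finset.sum_nonneg fun r _ => Finset.sum_nonneg fun t _ =>
    div_nonneg (sq_nonneg _) (Finset.sum_nonneg fun i _ => hv i))

/-- At a fixed scale the increments run over disjoint intervals (empty for even `t`), and replacing
the denominator at the right end of an interval by the smaller `partialSum v i` only increases each
summand. -/
lemma dyadic_ratio_sum_le (N r : ℕ) {v : ℕ → ℝ} (hv : ∀ i, 0 ≤ v i)
    (hV : ∀ k, 0 < k → k ≤ N → 0 < partialSum v k) :
    ∑ t ∈ Finset.range (N / 2 ^ r + 1),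
      (∑ i ∈ Finset.Ioc (t / 2 * 2 ^ (r + 1)) (t * 2 ^ r), v i) / partialSum v (t * 2 ^ r)
      ≤ ∑ i ∈ Finset.Ioc 0 N, v i / partialSum v i := by
  set u : ℕ → ℝ := fun i => v i / partialSum v i with hu
  have hu0 : ∀ i, 0 ≤ u i := fun i => div_nonneg (hv i) (Finset.sum_nonneg fun i _ => hv i)
  have key : ∀ T, T * 2 ^ r ≤ N → ∑ t ∈ Finset.range (T + 1),
      (∑ i ∈ Finset.Ioc (t / 2 * 2 ^ (r + 1)) (t * 2 ^ r), v i) / partialSum v (t * 2 ^ r)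
      ≤ partialSum u (T * 2 ^ r) := by
    intro T
    induction T with
    | zero => intro _; simp [partialSum_zero]
    | succ T ih =>
      intro hT
      have hT' : T * 2 ^ r ≤ (T + 1) * 2 ^ r := Nat.mul_le_mul_right _ (Nat.le_succ T)
      rw [Finset.sum_range_succ]
      have h1 := ih (hT'.trans hT)
      have h2 : (∑ i ∈ Finset.Ioc ((T + 1) / 2 * 2 ^ (r + 1)) ((T + 1) * 2 ^ r), v i)
          / partialSum v ((T + 1) * 2 ^ r) ≤ ∑ i ∈ Finset.Ioc (T * 2 ^ r) ((T + 1) * 2 ^ r), u i := by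
        rw [Finset.sum_div]
        have hsub : Finset.Ioc ((T + 1) / 2 * 2 ^ (r + 1)) ((T + 1) * 2 ^ r)
            ⊆ Finset.Ioc (T * 2 ^ r) ((T + 1) * 2 ^ r) := by
          refine Finset.Ioc_subset_Ioc_left ?_
          have : T ≤ (T + 1) / 2 * 2 := by omega
          calc T * 2 ^ r ≤ ((T + 1) / 2 * 2) * 2 ^ r := Nat.mul_le_mul_right _ this
            _ = _ := by ring
        refine (Finset.sum_le_sum_of_subset_of_nonneg hsub fun i _ _ =>
          div_nonneg (hv i) (Finset.sum_nonneg fun i _ => hv i)).trans ?_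
        refine Finset.sum_le_sum fun i hi => ?_
        have hi' := Finset.mem_Ioc.1 hi
        exact div_le_div_of_nonneg_left (hv i) (hV i (by omega) (by omega))
          (partialSum_mono hv hi'.2)
      rw [← partialSum_sub u hT'] at h2
      linarith
  refine (key _ (Nat.div_mul_le_self _ _)).trans ?_
  exact partialSum_mono hu0 (Nat.div_mul_le_self _ _)

/-- One factor `R` is the Cauchy–Schwarz loss built into `chainStat`; the other counts the scales,
each of which contributes at most the same sum of relative increments. -/
theorem chainStat_integral_le {Ω : Type*} [MeasurableSpace Ω] {μ : Measure Ω} {N : ℕ} (R : ℕ)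
    {v : ℕ → ℝ} (hv : ∀ i, 0 ≤ v i) (hV : ∀ k, 0 < k → k ≤ N → 0 < partialSum v k)
    (x : ℕ → Ω → ℝ) {C : ℝ} (hC : 0 ≤ C)
    (hint : ∀ j k, j ≤ k → k ≤ N → Integrable (fun ω => (∑ i ∈ Finset.Ioc j k, x i ω) ^ 2) μ)
    (hle : ∀ j k, j ≤ k → k ≤ N →
      ∫ ω, (∑ i ∈ Finset.Ioc j k, x i ω) ^ 2 ∂μ ≤ C * ∑ i ∈ Finset.Ioc j k, v i) :
    Integrable (fun ω => chainStat R N v (fun i => x i ω)) μ ∧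
    ∫ ω, chainStat R N v (fun i => x i ω) ∂μ
      ≤ (R : ℝ) ^ 2 * C * ∑ i ∈ Finset.Ioc 0 N, v i / partialSum v i := by
  have ht1 : ∀ r, ∀ t ∈ Finset.range (N / 2 ^ r + 1), t * 2 ^ r ≤ N := by
    intro r t ht
    have := Nat.mul_le_mul_right (2 ^ r) (Nat.lt_succ_iff.1 (Finset.mem_range.1 ht))
    exact this.trans (Nat.div_mul_le_self _ _)
  have hI : ∀ r, ∀ t ∈ Finset.range (N / 2 ^ r + 1), Integrable (fun ω =>
      (∑ i ∈ Finset.Ioc (t / 2 * 2 ^ (r + 1)) (t * 2 ^ r), x i ω) ^ 2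
        / partialSum v (t * 2 ^ r)) μ :=
    fun r t ht => (hint _ _ (dyadic_le r t) (ht1 r t ht)).div_const _
  refine ⟨(integrable_finsetSum _ fun r _ => integrable_finsetSum _ fun t ht =>
    hI r t ht).const_mul _, ?_⟩
  unfold chainStat
  rw [integral_const_mul, integral_finsetSum _ fun r _ => integrable_finsetSum _ fun t ht =>
    hI r t ht]
  have hr : ∀ r ∈ Finset.range R, ∫ ω, ∑ t ∈ Finset.range (N / 2 ^ r + 1),
      (∑ i ∈ Finset.Ioc (t / 2 * 2 ^ (r + 1)) (t * 2 ^ r), x i ω) ^ 2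
        / partialSum v (t * 2 ^ r) ∂μ ≤ C * ∑ i ∈ Finset.Ioc 0 N, v i / partialSum v i := by
    intro r _
    rw [integral_finsetSum _ fun t ht => hI r t ht]
    refine le_trans ?_ (mul_le_mul_of_nonneg_left (dyadic_ratio_sum_le N r hv hV) hC)
    rw [Finset.mul_sum]
    refine Finset.sum_le_sum fun t ht => ?_
    rw [integral_div, ← mul_div_assoc]
    exact div_le_div_of_nonneg_right (hle _ _ (dyadic_le r t) (ht1 r t ht))
      (Finset.sum_nonneg fun i _ => hv i)
  refine (mul_le_mul_of_nonneg_left (Finset.sum_le_sum hr) (Nat.cast_nonneg R)).trans ?_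
  rw [Finset.sum_const, Finset.card_range, nsmul_eq_mul]
  exact le_of_eq (by ring)

/-! ### Moments of linear and quadratic forms in independent noise. -/

section QuadraticForms

variable {Ω ι : Type*} [MeasurableSpace Ω] {μ : Measure Ω} [IsProbabilityMeasure μ]

/-- Extending by zero off `s` exhibits a functional of the whole noise vector as one of the
coordinates in `s`, so that block independence applies. -/
lemma indepFun_of_dependsOn {ε : ι → Ω → ℝ} (hmeas : ∀ i, Measurable (ε i)) (hind : iIndepFun ε μ)
    {s : Finset ι} {a : ι} (ha : a ∉ s) {F : (ι → ℝ) → ℝ} (hF : Measurable F)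
    (hdep : ∀ u v : ι → ℝ, (∀ i ∈ s, u i = v i) → F u = F v) :
    IndepFun (fun ω => F (fun i => ε i ω)) (ε a) μ := by
  classical
  have h := hind.indepFun_finset s {a} (Finset.disjoint_singleton_right.2 ha) hmeas
  let extend : (s → ℝ) → ι → ℝ := fun t i => if h : i ∈ s then t ⟨i, h⟩ else 0
  have hext : Measurable extend := by
    refine measurable_pi_lambda _ fun i => ?_
    by_cases h : i ∈ s
    · simp only [extend, h, dite_true]; exact measurable_pi_apply _
    · simp only [extend, h, dite_false]; exact measurable_const
  have hev : Measurable fun t : ({a} : Finset ι) → ℝ => t ⟨a, Finset.mem_singleton_self a⟩ :=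
    measurable_pi_apply _
  have h2 := h.comp (φ := F ∘ extend) (ψ := fun t => t ⟨a, Finset.mem_singleton_self a⟩)
    (hF.comp hext) hev
  convert h2 using 1
  · ext ω
    refine hdep _ _ fun i hi => ?_
    simp [extend, hi]
  · rfl

lemma pow_four_le_exp (x : ℝ) : x ^ 4 ≤ 24 * (Real.exp (1 * x) + Real.exp (-1 * x)) := by
  have key : ∀ y : ℝ, 0 ≤ y → y ^ 4 ≤ 24 * Real.exp y := by
    intro y hy
    have := Real.pow_div_factorial_le_exp y hy 4
    have h4 : ((Nat.factorial 4 : ℕ) : ℝ) = 24 := by norm_num [Nat.factorial]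
    rw [h4, div_le_iff₀ (by norm_num)] at this
    linarith
  rcases le_total 0 x with h | h
  · have := key x h
    have h2 := Real.exp_pos (-1 * x)
    rw [one_mul]; linarith
  · have := key (-x) (by linarith)
    have h2 := Real.exp_pos (1 * x)
    have h3 : (-x) ^ 4 = x ^ 4 := by ring
    have h4 : -1 * x = -x := by ring
    rw [h4]; linarith

/-- From `x⁴ / 4! ≤ exp |x|` and the moment generating function at `±1`; hence `48 = 2 · 4!`. -/
lemma fourth_moment_le {X : Ω → ℝ} {c : ℝ≥0} (h : HasSubgaussianMGF X c μ) :
    MemLp X 4 μ ∧ ∫ ω, X ω ^ 4 ∂μ ≤ 48 * Real.exp (c / 2) := by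
  have hm : MemLp X 4 μ := by simpa using h.memLp 4
  refine ⟨hm, ?_⟩
  have h1 := h.integrable_exp_mul 1
  have h2 := h.integrable_exp_mul (-1)
  have hint : Integrable (fun ω => 24 * (Real.exp (1 * X ω) + Real.exp (-1 * X ω))) μ :=
    (h1.add h2).const_mul 24
  have h4 : Integrable (fun ω => X ω ^ 4) μ := by
    refine hint.mono' (hm.aestronglyMeasurable.pow 4) (ae_of_all _ fun ω => ?_)
    rw [Real.norm_of_nonneg (by positivity)]
    exact pow_four_le_exp _
  refine (integral_mono h4 hint fun ω => pow_four_le_exp _).trans ?_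
  rw [integral_const_mul, integral_add h1 h2]
  have e1 := h.mgf_le 1
  have e2 := h.mgf_le (-1)
  simp only [mgf] at e1 e2
  norm_num at e1 e2 ⊢
  linarith

/-- Centred independent variables with common variance `σ²` and fourth moments at most `B`. -/
structure IsNoise (ε : ι → Ω → ℝ) (μ : Measure Ω) (σ B : ℝ) : Prop where
  meas : ∀ i, Measurable (ε i)
  indep : iIndepFun ε μ
  memLp : ∀ i, MemLp (ε i) 4 μ
  mean : ∀ i, ∫ ω, ε i ω ∂μ = 0
  var : ∀ i, ∫ ω, ε i ω ^ 2 ∂μ = σ ^ 2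
  fourth : ∀ i, ∫ ω, ε i ω ^ 4 ∂μ ≤ B

variable {ε : ι → Ω → ℝ} {σ B : ℝ}

lemma IsNoise.integrable (h : IsNoise ε μ σ B) (i : ι) : Integrable (ε i) μ :=
  (h.memLp i).integrable (by norm_num)

lemma memLp_two_mul {X Y : Ω → ℝ} (hX : MemLp X 4 μ) (hY : MemLp Y 4 μ) :
    MemLp (fun ω => X ω * Y ω) 2 μ := by
  have : ENNReal.HolderTriple 4 4 2 := ⟨by
    have : (4 : ENNReal) = 2 * 2 := by norm_num
    rw [this, ENNReal.mul_inv (by simp) (by simp), ← mul_two, mul_assoc,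
      ENNReal.inv_mul_cancel (by simp) (by simp), mul_one]⟩
  exact hY.mul hX

lemma integrable_mul_of_memLp {X Y : Ω → ℝ} (hX : MemLp X 2 μ) (hY : MemLp Y 2 μ) :
    Integrable (fun ω => X ω * Y ω) μ := hX.integrable_mul hY

lemma IsNoise.memLp_two (h : IsNoise ε μ σ B) (i : ι) : MemLp (ε i) 2 μ :=
  (h.memLp i).mono_exponent (by norm_num)

lemma IsNoise.integral_mul [DecidableEq ι] (h : IsNoise ε μ σ B) (i j : ι) :
    ∫ ω, ε i ω * ε j ω ∂μ = if i = j then σ ^ 2 else 0 := by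
  split_ifs with hij
  · subst hij
    simp only [← sq]; exact h.var i
  · rw [(h.indep.indepFun hij).integral_fun_mul_eq_mul_integral
      (h.meas i).aestronglyMeasurable (h.meas j).aestronglyMeasurable, h.mean, zero_mul]

lemma IsNoise.memLp_linear (h : IsNoise ε μ σ B) (s : Finset ι) (c : ι → ℝ) :
    MemLp (fun ω => ∑ i ∈ s, c i * ε i ω) 4 μ :=
  memLp_finsetSum s fun i _ => (h.memLp i).const_mul (c i)

lemma IsNoise.integral_linear_mul (h : IsNoise ε μ σ B) (s : Finset ι) (c d : ι → ℝ) :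
    ∫ ω, (∑ i ∈ s, c i * ε i ω) * (∑ i ∈ s, d i * ε i ω) ∂μ = σ ^ 2 * ∑ i ∈ s, c i * d i := by
  classical
  have e : ∀ ω, (∑ i ∈ s, c i * ε i ω) * (∑ i ∈ s, d i * ε i ω)
      = ∑ i ∈ s, ∑ j ∈ s, (c i * d j) * (ε i ω * ε j ω) := by
    intro ω
    rw [Finset.sum_mul_sum]
    exact Finset.sum_congr rfl fun i _ => Finset.sum_congr rfl fun j _ => by ring
  have hI : ∀ i j, Integrable (fun ω => (c i * d j) * (ε i ω * ε j ω)) μ := fun i j =>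
    (integrable_mul_of_memLp (h.memLp_two i) (h.memLp_two j)).const_mul _
  simp_rw [e]
  rw [integral_finsetSum _ fun i _ => integrable_finsetSum _ fun j _ => hI i j, Finset.mul_sum]
  refine Finset.sum_congr rfl fun i hi => ?_
  rw [integral_finsetSum _ fun j _ => hI i j]
  simp_rw [integral_const_mul, h.integral_mul]
  simp [hi]; ring

/-- The centred quadratic form `∑_{i,j ∈ s} A_ij ε_i ε_j - σ² ∑_{i ∈ s} A_ii`. -/
def centredQuad (σ : ℝ) (A : ι → ι → ℝ) (s : Finset ι) (u : ι → ℝ) : ℝ :=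
  ∑ i ∈ s, ∑ j ∈ s, A i j * (u i * u j) - σ ^ 2 * ∑ i ∈ s, A i i

lemma centredQuad_insert [DecidableEq ι] (A : ι → ι → ℝ) {s : Finset ι} {a : ι} (ha : a ∉ s)
    (u : ι → ℝ) :
    centredQuad σ A (insert a s) u = centredQuad σ A s u
      + (A a a * (u a ^ 2 - σ ^ 2) + u a * ∑ j ∈ s, (A a j + A j a) * u j) := by
  unfold centredQuad
  simp only [Finset.sum_insert ha, Finset.sum_add_distrib, add_mul, Finset.mul_sum, mul_add]
  have : ∀ i ∈ s, u a * (A i a * u i) = A i a * (u i * u a) := fun i _ => by ring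
  rw [Finset.sum_congr rfl this]
  have : ∀ i ∈ s, u a * (A a i * u i) = A a i * (u a * u i) := fun i _ => by ring
  rw [Finset.sum_congr rfl this]
  ring

lemma IsNoise.memLp_quad (h : IsNoise ε μ σ B) (A : ι → ι → ℝ) (s : Finset ι) :
    MemLp (fun ω => centredQuad σ A s (fun i => ε i ω)) 2 μ :=
  (memLp_finsetSum s fun i _ => memLp_finsetSum s fun j _ =>
    (memLp_two_mul (h.memLp i) (h.memLp j)).const_mul (A i j)).sub (memLp_const _)

/-- Adding one index `a` adds the martingale increment `A_aa (ε_a² - σ²) + ε_a Y`, with `Y` linear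
in the earlier noise. It is orthogonal to the earlier form, so second moments add. Its diagonal part
costs `2 B A_aa²`, and its off-diagonal part at most `4 σ⁴` times the new entries squared, after
splitting `(A_aj + A_ja)²`. No symmetry of `A` is needed. -/
theorem IsNoise.integral_quad_sq_le (h : IsNoise ε μ σ B) (A : ι → ι → ℝ) (s : Finset ι) :
    ∫ ω, centredQuad σ A s (fun i => ε i ω) ^ 2 ∂μ
      ≤ (2 * B + 4 * σ ^ 4) * ∑ i ∈ s, ∑ j ∈ s, A i j ^ 2 := by
  classical
  induction s using Finset.induction_on with
  | empty => simp [centredQuad]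
  | insert a s ha ih =>
    set q : Ω → ℝ := fun ω => centredQuad σ A s (fun i => ε i ω) with hq
    set Y : Ω → ℝ := fun ω => ∑ j ∈ s, (A a j + A j a) * ε j ω with hY
    set Z : Ω → ℝ := fun ω => ε a ω ^ 2 - σ ^ 2 with hZ
    have hqL : MemLp q 2 μ := h.memLp_quad A s
    have hYL4 : MemLp Y 4 μ := h.memLp_linear s _
    have hYL : MemLp Y 2 μ := hYL4.mono_exponent (by norm_num)
    have hZL : MemLp Z 2 μ := by
      have := memLp_two_mul (h.memLp a) (h.memLp a)
      simp only [← sq] at this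
      exact this.sub (memLp_const _)
    have hεY : MemLp (fun ω => ε a ω * Y ω) 2 μ := memLp_two_mul (h.memLp a) hYL4
    have hYm : Measurable (fun u : ι → ℝ => ∑ j ∈ s, (A a j + A j a) * u j) := by fun_prop
    have hYd : ∀ u v : ι → ℝ, (∀ i ∈ s, u i = v i) →
        ∑ j ∈ s, (A a j + A j a) * u j = ∑ j ∈ s, (A a j + A j a) * v j := fun u v huv =>
      Finset.sum_congr rfl fun j hj => by rw [huv j hj]
    have hqm : Measurable (fun u : ι → ℝ => centredQuad σ A s u) := by
      unfold centredQuad; fun_prop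
    have hqd : ∀ u v : ι → ℝ, (∀ i ∈ s, u i = v i) → centredQuad σ A s u = centredQuad σ A s v := by
      intro u v huv
      unfold centredQuad
      congr 1
      exact Finset.sum_congr rfl fun i hi => Finset.sum_congr rfl fun j hj => by
        rw [huv i hi, huv j hj]
    have hεm : AEStronglyMeasurable (ε a) μ := (h.meas a).aestronglyMeasurable
    have hεm2 : Measurable (fun x : ℝ => x ^ 2) := by fun_prop
    have hZm : Measurable (fun x : ℝ => x ^ 2 - σ ^ 2) := by fun_prop
    have hsqint : Integrable (fun ω => ε a ω ^ 2) μ := (h.memLp_two a).integrable_sq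
    have hZ0 : ∫ ω, Z ω ∂μ = 0 := by
      rw [integral_sub hsqint (integrable_const _), h.var]; simp
    -- cross terms
    have c1 : ∫ ω, q ω * Z ω ∂μ = 0 := by
      have hi := (indepFun_of_dependsOn h.meas h.indep ha hqm hqd).comp measurable_id hZm
      have := hi.integral_fun_mul_eq_mul_integral (hqL.aestronglyMeasurable)
        (hZL.aestronglyMeasurable)
      simp only [Function.comp_def, id] at this
      rw [this]
      exact mul_eq_zero_of_right _ hZ0
    have c2 : ∫ ω, (q ω * Y ω) * ε a ω ∂μ = 0 := by
      have hi := indepFun_of_dependsOn h.meas h.indep ha (hqm.mul hYm)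
        (fun u v huv => by simp only [Pi.mul_apply]; rw [hqd u v huv, hYd u v huv])
      have := hi.integral_fun_mul_eq_mul_integral
        ((hqL.aestronglyMeasurable).mul (hYL.aestronglyMeasurable)) hεm
      simp only [Pi.mul_apply] at this
      rw [this, h.mean, mul_zero]
    have c3 : ∫ ω, (ε a ω * Y ω) ^ 2 ∂μ
        = σ ^ 2 * (σ ^ 2 * ∑ j ∈ s, (A a j + A j a) ^ 2) := by
      have hi := (indepFun_of_dependsOn h.meas h.indep ha (hYm.pow_const 2)
        (fun u v huv => by rw [hYd u v huv])).comp measurable_id hεm2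
      have := hi.integral_fun_mul_eq_mul_integral (hYL.aestronglyMeasurable.pow 2)
        (hεm.pow 2)
      simp only [Function.comp_def, id] at this
      have e : ∀ ω, (ε a ω * Y ω) ^ 2 = Y ω ^ 2 * ε a ω ^ 2 := fun ω => by ring
      simp_rw [e]
      rw [this, h.var, mul_comm]
      congr 1
      have := h.integral_linear_mul s (fun j => A a j + A j a) (fun j => A a j + A j a)
      simp only [← sq] at this
      exact this
    have c4 : ∫ ω, Z ω ^ 2 ∂μ ≤ B := by
      have h4 : Integrable (fun ω => ε a ω ^ 4) μ := by
        have := memLp_two_mul (h.memLp a) (h.memLp a)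
        have := this.integrable_sq
        refine this.congr (ae_of_all _ fun ω => ?_)
        simp only; ring
      have e : ∀ ω, Z ω ^ 2 = ε a ω ^ 4 - 2 * σ ^ 2 * ε a ω ^ 2 + σ ^ 4 := fun ω => by
        simp only [hZ]; ring
      simp_rw [e]
      have h6 : Integrable (fun ω => ε a ω ^ 4 - 2 * σ ^ 2 * ε a ω ^ 2) μ :=
        h4.sub (hsqint.const_mul _)
      rw [integral_add h6 (integrable_const _), integral_sub h4 (hsqint.const_mul _), integral_const_mul, h.var]
      have := h.fourth a
      have h5 : 0 ≤ σ ^ 4 := by positivity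
      simp only [integral_const, probReal_univ, smul_eq_mul, one_mul]
      nlinarith
    have hB : 0 ≤ B := le_trans (integral_nonneg fun ω => sq_nonneg _) c4
    -- expansion of the square
    have hTL : MemLp (fun ω => A a a * Z ω + ε a ω * Y ω) 2 μ := (hZL.const_mul _).add hεY
    have hcross : ∫ ω, q ω * (A a a * Z ω + ε a ω * Y ω) ∂μ = 0 := by
      have e : ∀ ω, q ω * (A a a * Z ω + ε a ω * Y ω)
          = A a a * (q ω * Z ω) + (q ω * Y ω) * ε a ω := fun ω => by ring
      have i2 : Integrable (fun ω => (q ω * Y ω) * ε a ω) μ :=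
        (integrable_mul_of_memLp hqL hεY).congr (ae_of_all _ fun ω => by simp only; ring)
      simp_rw [e]
      rw [integral_add ((integrable_mul_of_memLp hqL hZL).const_mul _) i2, integral_const_mul,
        c1, c2]
      simp
    have hT2 : ∫ ω, (A a a * Z ω + ε a ω * Y ω) ^ 2 ∂μ
        ≤ 2 * A a a ^ 2 * B + 2 * (σ ^ 2 * (σ ^ 2 * ∑ j ∈ s, (A a j + A j a) ^ 2)) := by
      have i1 : Integrable (fun ω => 2 * A a a ^ 2 * Z ω ^ 2) μ := hZL.integrable_sq.const_mul _
      have i2 : Integrable (fun ω => 2 * (ε a ω * Y ω) ^ 2) μ := hεY.integrable_sq.const_mul _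
      refine (integral_mono hTL.integrable_sq (i1.add i2) fun ω => ?_).trans ?_
      · simp only [Pi.add_apply]
        nlinarith [sq_nonneg (A a a * Z ω - ε a ω * Y ω)]
      · simp only [Pi.add_apply]
        rw [integral_add i1 i2, integral_const_mul, integral_const_mul, c3]
        have := mul_le_mul_of_nonneg_left c4 (show 0 ≤ 2 * A a a ^ 2 by positivity)
        linarith
    have e : ∀ ω, centredQuad σ A (insert a s) (fun i => ε i ω) ^ 2
        = q ω ^ 2 + 2 * (q ω * (A a a * Z ω + ε a ω * Y ω))
          + (A a a * Z ω + ε a ω * Y ω) ^ 2 := by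
      intro ω
      rw [centredQuad_insert A ha]
      simp only [hq, hZ, hY]; ring
    simp_rw [e]
    have iq := integrable_mul_of_memLp hqL hTL
    have i3 : Integrable (fun ω => q ω ^ 2 + 2 * (q ω * (A a a * Z ω + ε a ω * Y ω))) μ :=
      hqL.integrable_sq.add (iq.const_mul 2)
    rw [integral_add i3 hTL.integrable_sq,
      integral_add hqL.integrable_sq (iq.const_mul 2), integral_const_mul, hcross]
    have hsplit : ∑ j ∈ s, (A a j + A j a) ^ 2
        ≤ 2 * ∑ j ∈ s, A a j ^ 2 + 2 * ∑ j ∈ s, A j a ^ 2 := by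
      rw [Finset.mul_sum, Finset.mul_sum, ← Finset.sum_add_distrib]
      refine Finset.sum_le_sum fun j _ => ?_
      nlinarith [sq_nonneg (A a j - A j a)]
    have hsum : ∑ i ∈ insert a s, ∑ j ∈ insert a s, A i j ^ 2
        = ∑ i ∈ s, ∑ j ∈ s, A i j ^ 2 + A a a ^ 2 + ∑ j ∈ s, A a j ^ 2 + ∑ j ∈ s, A j a ^ 2 := by
      simp only [Finset.sum_insert ha, Finset.sum_add_distrib]; ring
    rw [hsum]
    have h1 : 0 ≤ ∑ j ∈ s, A a j ^ 2 := Finset.sum_nonneg fun j _ => sq_nonneg _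
    have h2 : 0 ≤ ∑ j ∈ s, A j a ^ 2 := Finset.sum_nonneg fun j _ => sq_nonneg _
    have h3 : 0 ≤ σ ^ 4 := by positivity
    have h4 : 0 ≤ A a a ^ 2 := sq_nonneg _
    have h5 := mul_le_mul_of_nonneg_left hsplit h3
    have h6 := mul_nonneg h3 h4
    have h7 := mul_nonneg hB h1
    have h8 := mul_nonneg hB h2
    have hqdef : ∫ ω, q ω ^ 2 ∂μ ≤ (2 * B + 4 * σ ^ 4) * ∑ i ∈ s, ∑ j ∈ s, A i j ^ 2 := ih
    nlinarith

end QuadraticForms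

/-! ### Diagonalization of nested projections and of their averages. -/

section LinearAlgebra

variable {n p : ℕ} {X : Matrix (Fin n) (Fin p) ℝ} {φ : ℕ → Fin n → ℝ}

lemma sqNorm_eq_dotProduct (v : Fin n → ℝ) : sqNorm v = v ⬝ᵥ v := by
  simp [sqNorm, dotProduct, sq]

lemma isUnit_gram (hX : LinearIndependent ℝ (fun j : Fin p => Xᵀ j)) (I : Finset (Fin p)) :
    IsUnit ((X.submatrix id (fun j : I => (j : Fin p)))ᵀ *
      X.submatrix id (fun j : I => (j : Fin p))).det := by
  have h1 : LinearIndependent ℝ (X.submatrix id (fun j : I => (j : Fin p))).col :=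
    hX.comp (fun j : I => (j : Fin p)) Subtype.val_injective
  have h2 := Matrix.PosDef.conjTranspose_mul_self _ (Matrix.mulVec_injective_iff.2 h1)
  rw [Matrix.conjTranspose_eq_transpose_of_trivial] at h2
  exact h2.det_pos.ne'.isUnit

lemma lsProj_transpose (X : Matrix (Fin n) (Fin p) ℝ) (I : Finset (Fin p)) :
    (lsProj X I)ᵀ = lsProj X I := by
  simp only [lsProj, Matrix.transpose_mul, Matrix.transpose_transpose,
    Matrix.transpose_nonsing_inv, Matrix.mul_assoc]

lemma lsProj_mul_submatrix (hX : LinearIndependent ℝ (fun j : Fin p => Xᵀ j))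
    (I : Finset (Fin p)) :
    lsProj X I * X.submatrix id (fun j : I => (j : Fin p))
      = X.submatrix id (fun j : I => (j : Fin p)) := by
  simp only [lsProj]
  rw [Matrix.mul_assoc, Matrix.mul_assoc, Matrix.nonsing_inv_mul _ (isUnit_gram hX I),
    Matrix.mul_one]

lemma lsProj_mul_self (hX : LinearIndependent ℝ (fun j : Fin p => Xᵀ j)) (I : Finset (Fin p)) :
    lsProj X I * lsProj X I = lsProj X I := by
  have e : lsProj X I = X.submatrix id (fun j : I => (j : Fin p)) *
      (((X.submatrix id (fun j : I => (j : Fin p)))ᵀ *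
        X.submatrix id (fun j : I => (j : Fin p)))⁻¹ *
          (X.submatrix id (fun j : I => (j : Fin p)))ᵀ) := by
    simp only [lsProj, Matrix.mul_assoc]
  conv_lhs => arg 2; rw [e]
  rw [← Matrix.mul_assoc, lsProj_mul_submatrix hX, ← e]

lemma nestedProj_zero (X : Matrix (Fin n) (Fin p) ℝ) : nestedProj X 0 = 0 := by
  ext i j
  have : IsEmpty (nestedIdx p 0) := ⟨fun x => by
    have := x.2
    simp [nestedIdx] at this⟩
  simp [nestedProj, lsProj, Matrix.mul_apply]

lemma nestedProj_full_mulVec (hX : LinearIndependent ℝ (fun j : Fin p => Xᵀ j)) (β : Fin p → ℝ) :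
    nestedProj X p *ᵥ (X *ᵥ β) = X *ᵥ β := by
  have hmem : ∀ j : Fin p, j ∈ nestedIdx p p := fun j => by simp [nestedIdx]
  have : X *ᵥ β = X.submatrix id (fun j : nestedIdx p p => (j : Fin p)) *ᵥ
      (fun j : nestedIdx p p => β j) := by
    ext i
    simp only [Matrix.mulVec, dotProduct, Matrix.submatrix_apply, id]
    exact (Fintype.sum_equiv (Equiv.subtypeUnivEquiv hmem) _ _ fun j => by simp).symm
  rw [this, nestedProj, Matrix.mulVec_mulVec, lsProj_mul_submatrix hX]

lemma nestedProj_eq_sum (hφ : IsNestedBasis X φ) {m : ℕ} (hm : m ≤ p) :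
    nestedProj X m = ∑ j ∈ Finset.Ioc 0 m, Matrix.vecMulVec (φ j) (φ j) := by
  induction m with
  | zero => simp [nestedProj_zero]
  | succ m ih =>
    have := (hφ (m + 1) (Finset.mem_Icc.2 ⟨by omega, hm⟩)).2
    rw [Finset.sum_Ioc_succ_top (Nat.zero_le m), ← ih (by omega), ← this]
    simp

lemma nestedProj_mulVec (hφ : IsNestedBasis X φ) {m : ℕ} (hm : m ≤ p) (v : Fin n → ℝ) :
    nestedProj X m *ᵥ v = ∑ j ∈ Finset.Ioc 0 m, (φ j ⬝ᵥ v) • φ j := by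
  rw [nestedProj_eq_sum hφ hm, Matrix.sum_mulVec]
  refine Finset.sum_congr rfl fun j _ => ?_
  rw [Matrix.vecMulVec_mulVec]
  simp

lemma dotProduct_nestedProj_le (hX : LinearIndependent ℝ (fun j : Fin p => Xᵀ j)) (m : ℕ)
    (v : Fin n → ℝ) : v ⬝ᵥ (nestedProj X m *ᵥ v) ≤ v ⬝ᵥ v := by
  have h0 : 0 ≤ (v - nestedProj X m *ᵥ v) ⬝ᵥ (v - nestedProj X m *ᵥ v) := by
    rw [← sqNorm_eq_dotProduct]; exact Finset.sum_nonneg fun i _ => sq_nonneg _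
  have h1 : (nestedProj X m *ᵥ v) ⬝ᵥ (nestedProj X m *ᵥ v) = v ⬝ᵥ (nestedProj X m *ᵥ v) := by
    rw [Matrix.dotProduct_mulVec, ← Matrix.mulVec_transpose, nestedProj, lsProj_transpose,
      Matrix.mulVec_mulVec, lsProj_mul_self hX, dotProduct_comm]
  rw [sub_dotProduct, dotProduct_sub, dotProduct_sub, h1,
    dotProduct_comm (nestedProj X m *ᵥ v) v] at h0
  linarith

/-- Orthogonality comes from contraction: for `i < j`, `φ_jᵀ P_j φ_j ≤ 1` is a sum of the squares
`(φ_k ⬝ᵥ φ_j)²` over `k ≤ j`, and the term `k = j` already equals `1`. -/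
lemma IsNestedBasis.dotProduct_eq (hX : LinearIndependent ℝ (fun j : Fin p => Xᵀ j))
    (hφ : IsNestedBasis X φ) {i j : ℕ} (hi : i ∈ Finset.Ioc 0 p) (hj : j ∈ Finset.Ioc 0 p) :
    φ i ⬝ᵥ φ j = if i = j then 1 else 0 := by
  have hunit : ∀ j ∈ Finset.Ioc 0 p, φ j ⬝ᵥ φ j = 1 := fun j hj => by
    rw [← sqNorm_eq_dotProduct]; exact (hφ j hj).1
  have key : ∀ i j, i ∈ Finset.Ioc 0 p → j ∈ Finset.Ioc 0 p → i < j → φ i ⬝ᵥ φ j = 0 := by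
    intro i j hi hj hij
    have h1 := dotProduct_nestedProj_le hX j (φ j)
    have hi' := Finset.mem_Ioc.1 hi
    have hj' := Finset.mem_Ioc.1 hj
    rw [nestedProj_mulVec hφ hj'.2, dotProduct_sum, hunit j hj] at h1
    have e : ∀ k ∈ Finset.Ioc 0 j, φ j ⬝ᵥ ((φ k ⬝ᵥ φ j) • φ k) = (φ k ⬝ᵥ φ j) ^ 2 := by
      intro k _
      rw [dotProduct_smul, dotProduct_comm (φ j), smul_eq_mul, sq]
    rw [Finset.sum_congr rfl e] at h1
    have hsub : ({i, j} : Finset ℕ) ⊆ Finset.Ioc 0 j := by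
      intro k hk
      simp only [Finset.mem_insert, Finset.mem_singleton] at hk
      simp only [Finset.mem_Ioc]; omega
    have h2 := Finset.sum_le_sum_of_subset_of_nonneg (f := fun k => (φ k ⬝ᵥ φ j) ^ 2) hsub
      (fun k _ _ => sq_nonneg _)
    rw [Finset.sum_pair hij.ne, hunit j hj] at h2
    nlinarith [sq_nonneg (φ i ⬝ᵥ φ j)]
  split_ifs with h
  · subst h; exact hunit i hi
  · rcases lt_or_gt_of_ne h with h | h
    · exact key i j hi hj h
    · rw [dotProduct_comm]; exact key j i hj hi h

lemma dotProduct_sum_smul (hX : LinearIndependent ℝ (fun j : Fin p => Xᵀ j))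
    (hφ : IsNestedBasis X φ) (c : ℕ → ℝ) {j : ℕ} (hj : j ∈ Finset.Ioc 0 p) :
    φ j ⬝ᵥ (∑ l ∈ Finset.Ioc 0 p, c l • φ l) = c j := by
  rw [dotProduct_sum]
  have : ∀ l ∈ Finset.Ioc 0 p, φ j ⬝ᵥ (c l • φ l) = if j = l then c l else 0 := by
    intro l hl
    rw [dotProduct_smul, hφ.dotProduct_eq hX hj hl]
    split_ifs <;> simp
  rw [Finset.sum_congr rfl this]
  simp only [Finset.sum_ite_eq, hj, if_true]

lemma sqNorm_sum_smul (hX : LinearIndependent ℝ (fun j : Fin p => Xᵀ j))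
    (hφ : IsNestedBasis X φ) (c : ℕ → ℝ) :
    sqNorm (∑ l ∈ Finset.Ioc 0 p, c l • φ l) = ∑ l ∈ Finset.Ioc 0 p, c l ^ 2 := by
  rw [sqNorm_eq_dotProduct]
  conv_lhs => rw [sum_dotProduct]
  refine Finset.sum_congr rfl fun l hl => ?_
  rw [smul_dotProduct, dotProduct_sum_smul hX hφ c hl, smul_eq_mul, sq]

/-- Cumulative weights `γ_l = ∑_{m ≥ l} w_m`. -/
def cumWeight (K : Finset ℕ) (w : K → ℝ) (l : ℕ) : ℝ := ∑ m : K, if l ≤ (m : ℕ) then w m else 0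

lemma nestedProj_eq_sum_indicator (hφ : IsNestedBasis X φ) {m : ℕ} (hm : m ≤ p) :
    nestedProj X m = ∑ l ∈ Finset.Ioc 0 p,
      (if l ≤ m then (1 : ℝ) else 0) • Matrix.vecMulVec (φ l) (φ l) := by
  simp only [ite_smul, one_smul, zero_smul]
  rw [nestedProj_eq_sum hφ hm, ← Finset.sum_filter]
  refine Finset.sum_congr ?_ fun _ _ => rfl
  ext i
  simp only [Finset.mem_filter, Finset.mem_Ioc]
  omega

lemma avgProj_eq_sum (hφ : IsNestedBasis X φ) {K : Finset ℕ} (hK : K ⊆ Finset.Icc 1 p)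
    (w : K → ℝ) :
    avgProj X K w = ∑ l ∈ Finset.Ioc 0 p, cumWeight K w l • Matrix.vecMulVec (φ l) (φ l) := by
  unfold avgProj cumWeight
  simp_rw [Finset.sum_smul]
  rw [Finset.sum_comm]
  refine Finset.sum_congr rfl fun m _ => ?_
  rw [nestedProj_eq_sum_indicator hφ (Finset.mem_Icc.1 (hK m.2)).2, Finset.smul_sum]
  refine Finset.sum_congr rfl fun l _ => ?_
  split_ifs <;> simp

lemma sum_smul_vecMulVec_mulVec (c : ℕ → ℝ) (v : Fin n → ℝ) (s : Finset ℕ) :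
    (∑ l ∈ s, c l • Matrix.vecMulVec (φ l) (φ l)) *ᵥ v = ∑ l ∈ s, (c l * (φ l ⬝ᵥ v)) • φ l := by
  rw [Matrix.sum_mulVec]
  refine Finset.sum_congr rfl fun l _ => ?_
  rw [Matrix.smul_mulVec, Matrix.vecMulVec_mulVec]
  simp [smul_smul]

lemma eq_sum_of_mem_range (hX : LinearIndependent ℝ (fun j : Fin p => Xᵀ j))
    (hφ : IsNestedBasis X φ) {f : Fin n → ℝ} {β : Fin p → ℝ} (hf : f = X *ᵥ β) :
    f = ∑ l ∈ Finset.Ioc 0 p, (φ l ⬝ᵥ f) • φ l := by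
  rw [← nestedProj_mulVec hφ le_rfl, hf, nestedProj_full_mulVec hX]

lemma theta_sq (f : Fin n → ℝ) (l : ℕ) : theta φ f l ^ 2 = (φ l ⬝ᵥ f) ^ 2 / n := by
  rw [theta, div_pow, Real.sq_sqrt (Nat.cast_nonneg n)]

/-- Since `f` lies in the span of the `φ l`, the error vector has no component outside it and the
loss splits over coordinates. -/
lemma loss_sum_mulVec (hX : LinearIndependent ℝ (fun j : Fin p => Xᵀ j))
    (hφ : IsNestedBasis X φ) {f : Fin n → ℝ} {β : Fin p → ℝ} (hf : f = X *ᵥ β) (g : ℕ → ℝ)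
    (e : Fin n → ℝ) :
    loss ((∑ l ∈ Finset.Ioc 0 p, g l • Matrix.vecMulVec (φ l) (φ l)) *ᵥ (f + e)) f
      = ∑ l ∈ Finset.Ioc 0 p, (g l * (theta φ f l + theta φ e l) - theta φ f l) ^ 2 := by
  have h : (∑ l ∈ Finset.Ioc 0 p, g l • Matrix.vecMulVec (φ l) (φ l)) *ᵥ (f + e) - f
      = ∑ l ∈ Finset.Ioc 0 p, (g l * (φ l ⬝ᵥ (f + e)) - φ l ⬝ᵥ f) • φ l := by
    conv_lhs => arg 2; rw [eq_sum_of_mem_range hX hφ hf]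
    rw [sum_smul_vecMulVec_mulVec, ← Finset.sum_sub_distrib]
    simp_rw [sub_smul]
  rw [loss, h, sqNorm_sum_smul hX hφ, Finset.sum_div]
  refine Finset.sum_congr rfl fun l _ => ?_
  rw [dotProduct_add, theta, theta, ← add_div, mul_div_assoc', ← sub_div, div_pow,
    Real.sq_sqrt (Nat.cast_nonneg n)]

lemma loss_avgProj (hX : LinearIndependent ℝ (fun j : Fin p => Xᵀ j))
    (hφ : IsNestedBasis X φ) {f : Fin n → ℝ} {β : Fin p → ℝ} (hf : f = X *ᵥ β) {K : Finset ℕ}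
    (hK : K ⊆ Finset.Icc 1 p) (w : K → ℝ) (e : Fin n → ℝ) :
    loss (avgProj X K w *ᵥ (f + e)) f
      = ∑ l ∈ Finset.Ioc 0 p,
        (cumWeight K w l * (theta φ f l + theta φ e l) - theta φ f l) ^ 2 := by
  rw [avgProj_eq_sum hφ hK, loss_sum_mulVec hX hφ hf]

lemma trace_avgProj (hX : LinearIndependent ℝ (fun j : Fin p => Xᵀ j))
    (hφ : IsNestedBasis X φ) {K : Finset ℕ} (hK : K ⊆ Finset.Icc 1 p) (w : K → ℝ) :
    Matrix.trace ((avgProj X K w)ᵀ * avgProj X K w)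
      = ∑ l ∈ Finset.Ioc 0 p, cumWeight K w l ^ 2 := by
  rw [avgProj_eq_sum hφ hK, Matrix.transpose_sum, Finset.sum_mul, Matrix.trace_sum]
  refine Finset.sum_congr rfl fun l hl => ?_
  rw [Finset.mul_sum, Matrix.trace_sum]
  have : ∀ k ∈ Finset.Ioc 0 p, Matrix.trace ((cumWeight K w l • Matrix.vecMulVec (φ l) (φ l))ᵀ
      * (cumWeight K w k • Matrix.vecMulVec (φ k) (φ k)))
      = if l = k then cumWeight K w l * cumWeight K w k else 0 := by
    intro k hk
    rw [Matrix.transpose_smul, Matrix.transpose_vecMulVec, Matrix.smul_mul, Matrix.mul_smul,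
      Matrix.trace_smul, Matrix.trace_smul, Matrix.vecMulVec_mul_vecMulVec,
      hφ.dotProduct_eq hX hl hk, smul_eq_mul, smul_eq_mul]
    split_ifs with h
    · subst h
      rw [one_smul, Matrix.trace_vecMulVec, hφ.dotProduct_eq hX hl hl]; simp
    · simp
  rw [Finset.sum_congr rfl this]
  simp only [Finset.sum_ite_eq, hl, if_true, sq]

lemma plugRisk_eq (hX : LinearIndependent ℝ (fun j : Fin p => Xᵀ j))
    (hφ : IsNestedBasis X φ) {f : Fin n → ℝ} {β : Fin p → ℝ} (hf : f = X *ᵥ β) {K : Finset ℕ}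
    (hK : K ⊆ Finset.Icc 1 p) (w : K → ℝ) (σ : ℝ) :
    plugRisk σ X f K w = ∑ l ∈ Finset.Ioc 0 p, (1 - cumWeight K w l) ^ 2 * theta φ f l ^ 2
      + σ ^ 2 / n * ∑ l ∈ Finset.Ioc 0 p, cumWeight K w l ^ 2 := by
  rw [plugRisk, trace_avgProj hX hφ hK]
  congr 1
  have h : f - avgProj X K w *ᵥ f
      = ∑ l ∈ Finset.Ioc 0 p, ((1 - cumWeight K w l) * (φ l ⬝ᵥ f)) • φ l := by
    conv_lhs => arg 1; rw [eq_sum_of_mem_range hX hφ hf]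
    rw [avgProj_eq_sum hφ hK, sum_smul_vecMulVec_mulVec, ← Finset.sum_sub_distrib]
    refine Finset.sum_congr rfl fun l _ => ?_
    rw [← sub_smul]; congr 1; ring
  rw [h, sqNorm_sum_smul hX hφ, Finset.sum_div]
  refine Finset.sum_congr rfl fun l _ => ?_
  rw [theta_sq]; ring

lemma sum_size_mul_weight {K : Finset ℕ} (hK : K ⊆ Finset.Icc 1 p) (w : K → ℝ) :
    ∑ m : K, ((m : ℕ) : ℝ) * w m = ∑ l ∈ Finset.Ioc 0 p, cumWeight K w l := by
  unfold cumWeight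
  rw [Finset.sum_comm]
  refine Finset.sum_congr rfl fun m _ => ?_
  rw [← Finset.sum_filter]
  have : (Finset.Ioc 0 p).filter (fun l => l ≤ (m : ℕ)) = Finset.Ioc 0 (m : ℕ) := by
    have := (Finset.mem_Icc.1 (hK m.2)).2
    ext i
    simp only [Finset.mem_filter, Finset.mem_Ioc]
    omega
  rw [this]; simp

/-- The penalty is linear in the cumulative weights because `∑ m w_m = ∑ γ_l`, so the entire
dependence on `w` is through `cumWeight`. -/
lemma criterion_eq (hX : LinearIndependent ℝ (fun j : Fin p => Xᵀ j))
    (hφ : IsNestedBasis X φ) {K : Finset ℕ} (hK : K ⊆ Finset.Icc 1 p) (w : K → ℝ)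
    (y : Fin n → ℝ) (s : ℝ) :
    criterion X K y s w = sqNorm y / n
      + ∑ l ∈ Finset.Ioc 0 p, (cumWeight K w l ^ 2 - 2 * cumWeight K w l) * theta φ y l ^ 2
      + 2 * s / n * ∑ l ∈ Finset.Ioc 0 p, cumWeight K w l := by
  rw [criterion, sum_size_mul_weight hK]
  congr 1
  rw [avgProj_eq_sum hφ hK, sum_smul_vecMulVec_mulVec, sqNorm_eq_dotProduct]
  set u := ∑ l ∈ Finset.Ioc 0 p, (cumWeight K w l * (φ l ⬝ᵥ y)) • φ l with hu
  have h1 : u ⬝ᵥ u = ∑ l ∈ Finset.Ioc 0 p, (cumWeight K w l * (φ l ⬝ᵥ y)) ^ 2 := by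
    rw [← sqNorm_eq_dotProduct, hu, sqNorm_sum_smul hX hφ]
  have h2 : u ⬝ᵥ y = ∑ l ∈ Finset.Ioc 0 p, cumWeight K w l * (φ l ⬝ᵥ y) ^ 2 := by
    rw [hu, sum_dotProduct]
    refine Finset.sum_congr rfl fun l _ => ?_
    rw [smul_dotProduct, smul_eq_mul]; ring
  rw [sub_dotProduct, dotProduct_sub, dotProduct_sub, dotProduct_comm y u, h1, h2,
    ← sqNorm_eq_dotProduct]
  simp_rw [theta_sq]
  have h3 : ∑ l ∈ Finset.Ioc 0 p, (cumWeight K w l ^ 2 - 2 * cumWeight K w l)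
      * ((φ l ⬝ᵥ y) ^ 2 / n) = (∑ l ∈ Finset.Ioc 0 p, (cumWeight K w l * (φ l ⬝ᵥ y)) ^ 2
        - 2 * ∑ l ∈ Finset.Ioc 0 p, cumWeight K w l * (φ l ⬝ᵥ y) ^ 2) / n := by
    rw [Finset.mul_sum, ← Finset.sum_sub_distrib, Finset.sum_div]
    exact Finset.sum_congr rfl fun l _ => by ring
  rw [h3]; ring

lemma sqNorm_div_eq (hX : LinearIndependent ℝ (fun j : Fin p => Xᵀ j))
    (hφ : IsNestedBasis X φ) {f : Fin n → ℝ} {β : Fin p → ℝ} (hf : f = X *ᵥ β) :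
    sqNorm f / n = ∑ l ∈ Finset.Ioc 0 p, theta φ f l ^ 2 := by
  conv_lhs => rw [eq_sum_of_mem_range hX hφ hf, sqNorm_sum_smul hX hφ]
  simp_rw [theta_sq]
  rw [Finset.sum_div]

end LinearAlgebra

/-! ### The noise in the coordinates of the nested basis. -/

section SequenceModel

variable {Ω : Type*} [MeasurableSpace Ω] {μ : Measure Ω}

/-- Noise of the sequence model: uncorrelated coordinates of variance `s`, such that
the centred sums of squares over intervals have variance at most `D s²` times the length. -/
structure IsSeqNoise (e : ℕ → Ω → ℝ) (μ : Measure Ω) (p : ℕ) (s D : ℝ) : Prop where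
  meas : ∀ l, Measurable (e l)
  memLp : ∀ l, MemLp (e l) 4 μ
  mean : ∀ l, ∫ ω, e l ω ∂μ = 0
  var : ∀ l ∈ Finset.Ioc 0 p, ∫ ω, e l ω ^ 2 ∂μ = s
  linear : ∀ (c : ℕ → ℝ) (j k : ℕ), j ≤ k → k ≤ p →
    ∫ ω, (∑ l ∈ Finset.Ioc j k, c l * e l ω) ^ 2 ∂μ = s * ∑ l ∈ Finset.Ioc j k, c l ^ 2
  quad : ∀ j k : ℕ, j ≤ k → k ≤ p →
    ∫ ω, (∑ l ∈ Finset.Ioc j k, (e l ω ^ 2 - s)) ^ 2 ∂μ ≤ D * s ^ 2 * ((k : ℝ) - j)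

/-- The rotated noise is uncorrelated but in general not independent, so the quadratic bound has to
come from `IsNoise.integral_quad_sq_le` in the original coordinates. -/
theorem IsNoise.isSeqNoise [IsProbabilityMeasure μ] {n p : ℕ} {X : Matrix (Fin n) (Fin p) ℝ}
    {φ : ℕ → Fin n → ℝ} (hn : 1 ≤ n) (hX : LinearIndependent ℝ (fun j : Fin p => Xᵀ j))
    (hφ : IsNestedBasis X φ) {ε : Fin n → Ω → ℝ} {σ B : ℝ} (hσ : 0 < σ) (h : IsNoise ε μ σ B) :
    IsSeqNoise (fun l ω => theta φ (fun i => ε i ω) l) μ p (σ ^ 2 / n)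
      ((2 * B + 4 * σ ^ 4) / σ ^ 4) := by
  have hn0 : (0 : ℝ) < n := by exact_mod_cast hn
  have hsqrt : 0 < Real.sqrt n := Real.sqrt_pos.2 hn0
  have he : ∀ l ω, theta φ (fun i => ε i ω) l = ∑ i, (φ l i / Real.sqrt n) * ε i ω := by
    intro l ω
    rw [theta, dotProduct, Finset.sum_div]
    exact Finset.sum_congr rfl fun i _ => by ring
  have hlin : ∀ (c : ℕ → ℝ) (j k : ℕ), j ≤ k → k ≤ p →
      ∫ ω, (∑ l ∈ Finset.Ioc j k, c l * theta φ (fun i => ε i ω) l) ^ 2 ∂μ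
        = σ ^ 2 / n * ∑ l ∈ Finset.Ioc j k, c l ^ 2 := by
    intro c j k hjk hkp
    set d : Fin n → ℝ := fun i => ∑ l ∈ Finset.Ioc j k, c l * (φ l i / Real.sqrt n) with hd
    have e1 : ∀ ω, ∑ l ∈ Finset.Ioc j k, c l * theta φ (fun i => ε i ω) l
        = ∑ i, d i * ε i ω := by
      intro ω
      simp_rw [he, hd, Finset.mul_sum, Finset.sum_mul]
      rw [Finset.sum_comm]
      exact Finset.sum_congr rfl fun i _ => Finset.sum_congr rfl fun l _ => by ring
    simp_rw [e1]
    have := h.integral_linear_mul Finset.univ d d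
    simp only [← sq] at this
    rw [this]
    have e2 : ∑ i, d i ^ 2 = (∑ l ∈ Finset.Ioc j k, c l ^ 2) / n := by
      set c' : ℕ → ℝ := fun l => if l ∈ Finset.Ioc j k then c l else 0 with hc'
      have hsub : (Finset.Ioc 0 p).filter (fun l => l ∈ Finset.Ioc j k) = Finset.Ioc j k := by
        ext l; simp only [Finset.mem_filter, Finset.mem_Ioc]; omega
      have h1 := sqNorm_sum_smul hX hφ c'
      have h2 : ∑ l ∈ Finset.Ioc 0 p, c' l • φ l = ∑ l ∈ Finset.Ioc j k, c l • φ l := by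
        simp only [hc', ite_smul, zero_smul]
        rw [← Finset.sum_filter, hsub]
      have h3 : ∑ l ∈ Finset.Ioc 0 p, c' l ^ 2 = ∑ l ∈ Finset.Ioc j k, c l ^ 2 := by
        have : ∀ l ∈ Finset.Ioc 0 p, c' l ^ 2 = if l ∈ Finset.Ioc j k then c l ^ 2 else 0 := by
          intro l _; simp only [hc']; split_ifs <;> simp
        rw [Finset.sum_congr rfl this, ← Finset.sum_filter, hsub]
      rw [h2, h3] at h1
      rw [← h1, sqNorm, Finset.sum_div]
      refine Finset.sum_congr rfl fun i _ => ?_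
      rw [hd]
      simp only [Finset.sum_apply, Pi.smul_apply, smul_eq_mul]
      have : ∑ l ∈ Finset.Ioc j k, c l * (φ l i / Real.sqrt n)
          = (∑ l ∈ Finset.Ioc j k, c l * φ l i) / Real.sqrt n := by
        rw [Finset.sum_div]; exact Finset.sum_congr rfl fun l _ => by ring
      rw [this, div_pow, Real.sq_sqrt hn0.le]
    rw [e2]; ring
  refine ⟨fun l => ?_, fun l => ?_, fun l => ?_, fun l hl => ?_, hlin, fun j k hjk hkp => ?_⟩
  · simp_rw [he]
    have := h.meas
    fun_prop
  · simp_rw [he]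
    exact h.memLp_linear Finset.univ _
  · simp_rw [he]
    rw [integral_finsetSum _ fun i _ => (h.integrable i).const_mul _]
    simp_rw [integral_const_mul, h.mean]
    simp
  · have hl' := Finset.mem_Ioc.1 hl
    have := hlin (fun _ => 1) (l - 1) l (by omega) hl'.2
    have e1 : Finset.Ioc (l - 1) l = {l} := by
      ext i; simp only [Finset.mem_Ioc, Finset.mem_singleton]; omega
    rw [e1] at this
    simpa using this
  · set A : Fin n → Fin n → ℝ := fun i i' => ∑ l ∈ Finset.Ioc j k, φ l i * φ l i' with hA
    have hmem : ∀ l ∈ Finset.Ioc j k, l ∈ Finset.Ioc 0 p := fun l hl => by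
      simp only [Finset.mem_Ioc] at hl ⊢; omega
    have hcard : (∑ l ∈ Finset.Ioc j k, (1 : ℝ)) = (k : ℝ) - j := by
      simp [Nat.cast_sub hjk]
    have htr : ∑ i, A i i = (k : ℝ) - j := by
      simp only [hA]
      rw [Finset.sum_comm, ← hcard]
      refine Finset.sum_congr rfl fun l hl => ?_
      have := hφ.dotProduct_eq hX (hmem l hl) (hmem l hl)
      rw [if_pos rfl] at this
      exact this
    -- `A` is the orthogonal projection onto the span of `φ l`, `j < l ≤ k`; its squared Frobenius
    -- norm equals its trace.
    have hfrob : ∑ i, ∑ i', A i i' ^ 2 = (k : ℝ) - j := by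
      have e1 : ∀ i i', A i i' ^ 2 = ∑ l ∈ Finset.Ioc j k, ∑ m ∈ Finset.Ioc j k,
          (φ l i * φ m i) * (φ l i' * φ m i') := by
        intro i i'
        rw [sq, hA, Finset.sum_mul_sum]
        exact Finset.sum_congr rfl fun l _ => Finset.sum_congr rfl fun m _ => by ring
      simp_rw [e1]
      have e2 : ∀ i, ∑ i', ∑ l ∈ Finset.Ioc j k, ∑ m ∈ Finset.Ioc j k,
          (φ l i * φ m i) * (φ l i' * φ m i') = ∑ l ∈ Finset.Ioc j k, φ l i * φ l i := by
        intro i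
        rw [Finset.sum_comm]
        refine Finset.sum_congr rfl fun l hl => ?_
        rw [Finset.sum_comm]
        have : ∀ m ∈ Finset.Ioc j k, ∑ i', (φ l i * φ m i) * (φ l i' * φ m i')
            = if l = m then φ l i * φ m i else 0 := by
          intro m hm
          rw [← Finset.mul_sum]
          have := hφ.dotProduct_eq hX (hmem l hl) (hmem m hm)
          rw [dotProduct] at this
          rw [this]; split_ifs <;> simp
        rw [Finset.sum_congr rfl this]
        simp only [Finset.sum_ite_eq, hl, if_true]
      simp_rw [e2]
      exact htr
    have e3 : ∀ ω, ∑ l ∈ Finset.Ioc j k, (theta φ (fun i => ε i ω) l ^ 2 - σ ^ 2 / n)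
        = centredQuad σ A Finset.univ (fun i => ε i ω) / n := by
      intro ω
      rw [centredQuad, htr, Finset.sum_sub_distrib, sub_div]
      congr 1
      · simp_rw [theta_sq]
        rw [← Finset.sum_div]
        congr 1
        simp_rw [hA, dotProduct, sq, Finset.sum_mul_sum, Finset.sum_mul]
        rw [Finset.sum_comm]
        refine Finset.sum_congr rfl fun i _ => ?_
        rw [Finset.sum_comm]
        exact Finset.sum_congr rfl fun i' _ => Finset.sum_congr rfl fun l _ => by ring
      · rw [← hcard, Finset.mul_sum, Finset.sum_div]
        exact Finset.sum_congr rfl fun l _ => by ring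
    simp_rw [e3, div_pow]
    rw [integral_div]
    have h1 := h.integral_quad_sq_le A Finset.univ
    rw [hfrob] at h1
    rw [div_le_iff₀ (by positivity)]
    refine h1.trans (le_of_eq ?_)
    field_simp

end SequenceModel

/-! ### Blocks of coordinates and the number of dyadic scales. -/

/-- Last index of the `j`-th block of coordinates for the sizes `a, a + 1, …`. -/
def blockEnd (a j : ℕ) : ℕ := if j = 0 then 0 else a + j - 1

lemma blockEnd_zero (a : ℕ) : blockEnd a 0 = 0 := rfl

lemma blockEnd_succ (a j : ℕ) : blockEnd a (j + 1) = a + j := by simp [blockEnd]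

lemma blockEnd_mono (a : ℕ) : Monotone (blockEnd a) := by
  intro i j h
  unfold blockEnd
  split_ifs <;> omega

lemma sum_Ioc_blocks (k : ℕ → ℕ) (hk : Monotone k) (F : ℕ → ℝ) {i j : ℕ} (hij : i ≤ j) :
    ∑ m ∈ Finset.Ioc i j, ∑ l ∈ Finset.Ioc (k (m - 1)) (k m), F l
      = ∑ l ∈ Finset.Ioc (k i) (k j), F l := by
  induction j, hij using Nat.le_induction with
  | base => simp
  | succ j hj ih =>
    rw [Finset.sum_Ioc_succ_top hj, ih, Nat.add_sub_cancel,
      Finset.sum_Ioc_consecutive F (hk hj) (hk (Nat.le_succ j))]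

lemma sum_Ioc_reverse (F : ℕ → ℝ) {b j k : ℕ} (hk : k ≤ b) :
    ∑ i ∈ Finset.Ioc j k, F (b + 1 - i) = ∑ l ∈ Finset.Ioc (b - k) (b - j), F l := by
  refine Finset.sum_nbij' (fun i => b + 1 - i) (fun l => b + 1 - l) ?_ ?_ ?_ ?_ ?_
  · intro i hi; simp only [Finset.mem_Ioc] at hi ⊢; omega
  · intro i hi; simp only [Finset.mem_Ioc] at hi ⊢; omega
  · intro i hi; simp only [Finset.mem_Ioc] at hi; omega
  · intro i hi; simp only [Finset.mem_Ioc] at hi; omega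
  · intro i _; rfl

/-- The number of dyadic scales used for `M` candidate models. -/
def scaleCount (M : ℕ) : ℕ := Nat.log 2 M + 1

lemma lt_two_pow_scaleCount (M : ℕ) : M < 2 ^ scaleCount M := Nat.lt_pow_succ_log_self (by norm_num) M

lemma scaleCount_sq_le {M : ℕ} (hM : 1 ≤ M) :
    (scaleCount M : ℝ) ^ 2 ≤ 4 * (1 + Real.log M) ^ 2 := by
  have hM0 : (0 : ℝ) < M := by exact_mod_cast hM
  have h1 : ((2 : ℝ)) ^ Nat.log 2 M ≤ M := by
    exact_mod_cast Nat.pow_log_le_self 2 (by omega)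
  have h2 : Nat.log 2 M * Real.log 2 ≤ Real.log M := by
    rw [← Real.log_pow]; exact Real.log_le_log (by positivity) h1
  have h3 := Real.log_two_gt_d9
  have h4 : (0 : ℝ) ≤ Nat.log 2 M := Nat.cast_nonneg _
  have h5 : (scaleCount M : ℝ) ≤ 2 * (1 + Real.log M) := by
    simp only [scaleCount, Nat.cast_add, Nat.cast_one]
    nlinarith
  have h6 : (0 : ℝ) ≤ scaleCount M := Nat.cast_nonneg _
  nlinarith

/-! ### Random factors that are uniform over monotone weights. -/

section NoiseStatistics

variable {Ω : Type*} [MeasurableSpace Ω] {μ : Measure Ω} [IsProbabilityMeasure μ]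

/-- Relative block lengths of the sizes `a, …, b`. -/
def sizeRatioSum (a b : ℕ) : ℝ :=
  ∑ i ∈ Finset.Ioc 0 (b - a + 1), ((blockEnd a i : ℝ) - blockEnd a (i - 1)) / blockEnd a i

/-- Relative coefficient energies of the sizes `a, …, b`. -/
def energyRatioSum (θ : ℕ → ℝ) (a b : ℕ) : ℝ :=
  ∑ l ∈ Finset.Ioc a b, θ l ^ 2 / ∑ m ∈ Finset.Ioc (l - 1) b, θ m ^ 2

/-- Admissible weights are constant on the blocks `(0, a], {a + 1}, …, {b}`. Chaining over blocks,
weighted by their lengths, makes the cost depend on the number of candidate sizes instead of on `p`.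
The factor `U` is fixed before `g`, so `g` may depend on the data. -/
theorem exists_quad_stat {e : ℕ → Ω → ℝ} {p : ℕ} {s D : ℝ} (h : IsSeqNoise e μ p s D) (hD : 0 ≤ D)
    {a b : ℕ} (ha : 1 ≤ a) (hab : a ≤ b) (hb : b ≤ p) :
    ∃ U : Ω → ℝ, Integrable U μ ∧ (∀ ω, 0 ≤ U ω) ∧
      ∫ ω, U ω ∂μ ≤ (scaleCount (b - a + 1) : ℝ) ^ 2 * (D * s ^ 2) * sizeRatioSum a b ∧
      ∀ ω, ∀ g : ℕ → ℝ, Antitone g → (∀ l, 0 ≤ g l) → (∀ l ≤ a, g l = g a) → (∀ l, b < l → g l = 0) →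
        (∑ l ∈ Finset.Ioc 0 p, g l * (e l ω ^ 2 - s)) ^ 2
          ≤ U ω * ∑ l ∈ Finset.Ioc 0 p, g l ^ 2 := by
  set M := b - a + 1 with hM
  have hMend : blockEnd a M = b := by rw [hM, blockEnd_succ]; omega
  set v : ℕ → ℝ := fun i => (blockEnd a i : ℝ) - blockEnd a (i - 1) with hv
  set x : ℕ → Ω → ℝ := fun i ω =>
    ∑ l ∈ Finset.Ioc (blockEnd a (i - 1)) (blockEnd a i), (e l ω ^ 2 - s) with hx
  have hv0 : ∀ i, 0 ≤ v i := fun i => by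
    have : (blockEnd a (i - 1) : ℝ) ≤ blockEnd a i := by
      exact_mod_cast blockEnd_mono a (Nat.sub_le i 1)
    simp only [hv]; linarith
  have hvcard : ∀ i, v i = ∑ l ∈ Finset.Ioc (blockEnd a (i - 1)) (blockEnd a i), (1 : ℝ) := by
    intro i
    simp [hv, Nat.cast_sub (blockEnd_mono a (Nat.sub_le i 1))]
  have hvsum : ∀ j k, j ≤ k → ∑ i ∈ Finset.Ioc j k, v i = (blockEnd a k : ℝ) - blockEnd a j := by
    intro j k hjk
    simp_rw [hvcard]
    rw [sum_Ioc_blocks _ (blockEnd_mono a) _ hjk]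
    simp [Nat.cast_sub (blockEnd_mono a hjk)]
  have hps : ∀ k, partialSum v k = blockEnd a k := by
    intro k
    rw [partialSum, hvsum 0 k (Nat.zero_le k), blockEnd_zero]; simp
  have hV : ∀ k, 0 < k → k ≤ M → 0 < partialSum v k := by
    intro k hk _
    rw [hps]
    have : 0 < blockEnd a k := by
      unfold blockEnd; split_ifs <;> omega
    exact_mod_cast this
  have hxsum : ∀ j k ω, j ≤ k → ∑ i ∈ Finset.Ioc j k, x i ω
      = ∑ l ∈ Finset.Ioc (blockEnd a j) (blockEnd a k), (e l ω ^ 2 - s) := fun j k ω hjk =>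
    sum_Ioc_blocks _ (blockEnd_mono a) _ hjk
  have hL2 : ∀ l, MemLp (fun ω => e l ω ^ 2 - s) 2 μ := by
    intro l
    have := memLp_two_mul (h.memLp l) (h.memLp l)
    simp only [← sq] at this
    exact this.sub (memLp_const s)
  have hend : ∀ k, k ≤ M → blockEnd a k ≤ p := fun k hk =>
    ((blockEnd_mono a hk).trans_eq hMend).trans hb
  obtain ⟨hint, hle⟩ := chainStat_integral_le (μ := μ) (N := M) (scaleCount M) hv0 hV x
    (C := D * s ^ 2) (by positivity)
    (fun j k hjk hk => by
      simp_rw [hxsum j k _ hjk]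
      exact (memLp_finsetSum _ fun l _ => hL2 l).integrable_sq)
    (fun j k hjk hk => by
      simp_rw [hxsum j k _ hjk]
      rw [hvsum j k hjk]
      exact h.quad _ _ (blockEnd_mono a hjk) (hend k hk))
  refine ⟨_, hint, fun ω => chainStat_nonneg _ _ hv0 _, ?_, ?_⟩
  · refine hle.trans (le_of_eq ?_)
    simp_rw [hps]
    rfl
  · intro ω g hg hg0 hga hgb
    have hmain := sq_sum_antitone_le (lt_two_pow_scaleCount M) (fun i => x i ω) v
      (fun i => g (blockEnd a i)) hv0 hV (fun i j hij => hg (blockEnd_mono a hij)) (fun i => hg0 _)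
    have hconst : ∀ i ∈ Finset.Ioc 0 M, ∀ l ∈ Finset.Ioc (blockEnd a (i - 1)) (blockEnd a i),
        g (blockEnd a i) = g l := by
      intro i hi l hl
      rw [Finset.mem_Ioc] at hi hl
      obtain ⟨i, rfl⟩ : ∃ i', i = i' + 1 := ⟨i - 1, by omega⟩
      rw [blockEnd_succ] at hl ⊢
      rcases Nat.eq_zero_or_pos i with h0 | h0
      · subst h0
        rw [add_zero] at hl ⊢
        exact (hga l hl.2).symm
      · have : blockEnd a (i + 1 - 1) = a + i - 1 := by
          simp [blockEnd]; omega
        rw [this] at hl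
        congr 1; omega
    have hcut : ∀ F : ℕ → ℝ, (∀ l, b < l → F l = 0) →
        ∑ l ∈ Finset.Ioc 0 p, F l = ∑ l ∈ Finset.Ioc 0 b, F l := by
      intro F hF
      rw [← Finset.sum_Ioc_consecutive F (Nat.zero_le b) hb]
      rw [Finset.sum_eq_zero (s := Finset.Ioc b p), add_zero]
      intro l hl; exact hF l (Finset.mem_Ioc.1 hl).1
    have e1 : ∑ i ∈ Finset.Ioc 0 M, g (blockEnd a i) * x i ω
        = ∑ l ∈ Finset.Ioc 0 p, g l * (e l ω ^ 2 - s) := by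
      rw [hcut _ fun l hl => by rw [hgb l hl, zero_mul], ← hMend, ← blockEnd_zero a,
        ← sum_Ioc_blocks _ (blockEnd_mono a) _ (Nat.zero_le M), blockEnd_zero a]
      refine Finset.sum_congr rfl fun i hi => ?_
      rw [hx, Finset.mul_sum]
      refine Finset.sum_congr rfl fun l hl => ?_
      rw [hconst i hi l hl]
    have e2 : ∑ i ∈ Finset.Ioc 0 M, g (blockEnd a i) ^ 2 * v i
        = ∑ l ∈ Finset.Ioc 0 p, g l ^ 2 := by
      rw [hcut _ fun l hl => by rw [hgb l hl]; simp, ← hMend, ← blockEnd_zero a,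
        ← sum_Ioc_blocks _ (blockEnd_mono a) _ (Nat.zero_le M), blockEnd_zero a]
      refine Finset.sum_congr rfl fun i hi => ?_
      rw [hvcard, Finset.mul_sum]
      refine Finset.sum_congr rfl fun l hl => ?_
      rw [hconst i hi l hl, mul_one]
    rw [e1, e2] at hmain
    exact hmain

/-- The weights here, such as `1 - g`, are increasing, so the chain runs from `b` downwards. With `v
= θ²` the partial sums become tail energies, which is where the ratios of the `S_j` in `ψ`
originate. -/
theorem exists_linear_stat {e : ℕ → Ω → ℝ} {p : ℕ} {s D : ℝ} (h : IsSeqNoise e μ p s D)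
    (hs : 0 ≤ s) {θ : ℕ → ℝ} (hθ : ∀ l ∈ Finset.Icc 1 p, 0 < |θ l|)
    {a b : ℕ} (hab : a ≤ b) (hb : b ≤ p) :
    ∃ U : Ω → ℝ, Integrable U μ ∧ (∀ ω, 0 ≤ U ω) ∧
      ∫ ω, U ω ∂μ ≤ (scaleCount (b - a + 1) : ℝ) ^ 2 * s * energyRatioSum θ a b ∧
      ∀ ω, ∀ g : ℕ → ℝ, Monotone g → (∀ l, 0 ≤ g l) →
        (∑ l ∈ Finset.Ioc a b, g l * (θ l * e l ω)) ^ 2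
          ≤ U ω * ∑ l ∈ Finset.Ioc a b, g l ^ 2 * θ l ^ 2 := by
  set N := b - a with hN
  set v : ℕ → ℝ := fun i => θ (b + 1 - i) ^ 2 with hv
  set x : ℕ → Ω → ℝ := fun i ω => θ (b + 1 - i) * e (b + 1 - i) ω with hx
  have hv0 : ∀ i, 0 ≤ v i := fun i => sq_nonneg _
  have hvsum : ∀ j k, k ≤ N → ∑ i ∈ Finset.Ioc j k, v i
      = ∑ l ∈ Finset.Ioc (b - k) (b - j), θ l ^ 2 := fun j k hk =>
    sum_Ioc_reverse (fun l => θ l ^ 2) (by omega)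
  have hxsum : ∀ j k ω, k ≤ N → ∑ i ∈ Finset.Ioc j k, x i ω
      = ∑ l ∈ Finset.Ioc (b - k) (b - j), θ l * e l ω := fun j k ω hk =>
    sum_Ioc_reverse (fun l => θ l * e l ω) (by omega)
  have hV : ∀ k, 0 < k → k ≤ N → 0 < partialSum v k := by
    intro k hk hkN
    rw [partialSum]
    refine Finset.sum_pos (fun i hi => ?_) ⟨k, Finset.mem_Ioc.2 ⟨hk, le_rfl⟩⟩
    rw [Finset.mem_Ioc] at hi
    have := hθ (b + 1 - i) (Finset.mem_Icc.2 ⟨by omega, by omega⟩)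
    simp only [hv]
    rw [← sq_abs]; positivity
  obtain ⟨hint, hle⟩ := chainStat_integral_le (μ := μ) (N := N) (scaleCount (b - a + 1)) hv0 hV x
    (C := s) hs
    (fun j k hjk hk => by
      exact (memLp_finsetSum _ fun l _ =>
        ((h.memLp _).const_mul _).mono_exponent (by norm_num)).integrable_sq)
    (fun j k hjk hk => by
      simp_rw [hxsum j k _ hk]
      rw [hvsum j k hk]
      exact (h.linear θ _ _ (by omega) (by omega)).le)
  -- There are `b - a` indices here, but the scale count of `b - a + 1` is kept so that both
  -- statistics share one factor.
  have hNlt : N < 2 ^ scaleCount (b - a + 1) :=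
    lt_trans (by omega) (lt_two_pow_scaleCount (b - a + 1))
  refine ⟨_, hint, fun ω => chainStat_nonneg _ _ hv0 _, ?_, ?_⟩
  · refine hle.trans (le_of_eq ?_)
    congr 1
    have e0 : Finset.Ioc a b = Finset.Ioc (b - N) (b - 0) := by
      congr 1; omega
    rw [energyRatioSum, e0, ← sum_Ioc_reverse _ (show N ≤ b by omega)]
    refine Finset.sum_congr rfl fun i hi => ?_
    rw [Finset.mem_Ioc] at hi
    rw [partialSum, hvsum 0 i hi.2]
    congr 2
    congr 1; omega
  · intro ω g hg hg0
    have hmain := sq_sum_antitone_le hNlt (fun i => x i ω) v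
      (fun i => g (b + 1 - i)) hv0 hV (fun i j hij => hg (by omega)) (fun i => hg0 _)
    have e0 : Finset.Ioc a b = Finset.Ioc (b - N) (b - 0) := by
      congr 1; omega
    rw [e0, ← sum_Ioc_reverse (fun l => g l * (θ l * e l ω)) (show N ≤ b by omega),
      ← sum_Ioc_reverse (fun l => g l ^ 2 * θ l ^ 2) (show N ≤ b by omega)]
    exact hmain

end NoiseStatistics

/-! ### Evaluation of `ψ` on intervals of sizes, and bounds by `ψ`. -/

lemma ksize_Icc {a b j : ℕ} (hj : j ≤ b - a + 1) (hab : a ≤ b) :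
    ksize (Finset.Icc a b) j = blockEnd a j := by
  rcases Nat.eq_zero_or_pos j with h0 | h0
  · subst h0; simp [ksize, blockEnd]
  · obtain ⟨i, rfl⟩ : ∃ i, j = i + 1 := ⟨j - 1, by omega⟩
    rw [blockEnd_succ]
    simp only [ksize, Nat.add_eq_zero_iff, one_ne_zero, and_false, if_false, Nat.add_sub_cancel]
    have hlow : ∀ m ≤ a, Nat.count (· ∈ Finset.Icc a b) m = 0 := by
      intro m hm
      induction m with
      | zero => simp
      | succ m ih =>
        rw [Nat.count_succ, ih (by omega), if_neg]
        simp only [Finset.mem_Icc]; omega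
    have hcount : ∀ i, i ≤ b - a → Nat.count (· ∈ Finset.Icc a b) (a + i) = i := by
      intro i
      induction i with
      | zero => intro _; exact hlow a le_rfl
      | succ i ih =>
        intro hi
        rw [← add_assoc, Nat.count_succ, ih (by omega), if_pos]
        simp only [Finset.mem_Icc]; omega
    have hmem : a + i ∈ Finset.Icc a b := by simp only [Finset.mem_Icc]; omega
    have := Nat.nth_count (p := (· ∈ Finset.Icc a b)) hmem
    rw [hcount i (by omega)] at this
    exact this

lemma blockEnd_last {a b : ℕ} (hab : a ≤ b) : blockEnd a (b - a + 1) = b := by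
  rw [blockEnd_succ]; omega

lemma tailS_Icc (θ : ℕ → ℝ) {a b j : ℕ} (hj : j ≤ b - a + 1) (hab : a ≤ b) :
    tailS θ (Finset.Icc a b) j = ∑ l ∈ Finset.Ioc (blockEnd a j) b, θ l ^ 2 := by
  have hc : (Finset.Icc a b).card = b - a + 1 := by rw [Nat.card_Icc]; omega
  rw [tailS, hc, ksize_Icc hj hab, ksize_Icc le_rfl hab, blockEnd_last hab]

lemma tail_pos {θ : ℕ → ℝ} {p : ℕ} (hθ : ∀ l ∈ Finset.Icc 1 p, 0 < |θ l|) {k b : ℕ} (hk : k < b)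
    (hb : b ≤ p) : 0 < ∑ l ∈ Finset.Ioc k b, θ l ^ 2 := by
  refine Finset.sum_pos (fun i hi => ?_) ⟨b, Finset.mem_Ioc.2 ⟨hk, le_rfl⟩⟩
  rw [Finset.mem_Ioc] at hi
  have := hθ i (Finset.mem_Icc.2 ⟨by omega, by omega⟩)
  rw [← sq_abs]; positivity

/-- Nonvanishing coefficients keep every tail energy positive until the last size. -/
lemma cutM_Icc {θ : ℕ → ℝ} {p : ℕ} (hθ : ∀ l ∈ Finset.Icc 1 p, 0 < |θ l|) {a b : ℕ}
    (hab : a ≤ b) (hb : b ≤ p) : cutM θ (Finset.Icc a b) = b - a + 1 := by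
  have hc : (Finset.Icc a b).card = b - a + 1 := by rw [Nat.card_Icc]; omega
  have : {j : ℕ | 1 ≤ j ∧ j ≤ (Finset.Icc a b).card ∧ tailS θ (Finset.Icc a b) j = 0}
      = {b - a + 1} := by
    ext j
    rw [hc]
    simp only [Set.mem_ofPred_eq, Set.mem_singleton_iff]
    constructor
    · rintro ⟨h1, h2, h3⟩
      by_contra hne
      rw [tailS_Icc θ h2 hab] at h3
      obtain ⟨i, rfl⟩ : ∃ i, j = i + 1 := ⟨j - 1, by omega⟩
      rw [blockEnd_succ] at h3
      exact (tail_pos hθ (show a + i < b by omega) hb).ne' h3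
    · rintro rfl
      refine ⟨by omega, le_rfl, ?_⟩
      rw [tailS_Icc θ le_rfl hab, blockEnd_last hab]; simp
  rw [cutM, this, csInf_singleton]

/-- The contribution of the sizes to `ψ`. -/
def psiSize (a b : ℕ) : ℝ := ∑ j ∈ Finset.Ico 1 (b - a + 1),
  ((blockEnd a (j + 1) : ℝ) - blockEnd a j) / (4 * blockEnd a j)

/-- The contribution of the coefficients to `ψ`. -/
def psiEnergy (θ : ℕ → ℝ) (a b : ℕ) : ℝ := ∑ j ∈ Finset.Ico 1 (b - a + 1),
  (∑ l ∈ Finset.Ioc (blockEnd a (j - 1)) b, θ l ^ 2 - ∑ l ∈ Finset.Ioc (blockEnd a j) b, θ l ^ 2)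
    / (4 * ∑ l ∈ Finset.Ioc (blockEnd a j) b, θ l ^ 2)

lemma psi_Icc {θ : ℕ → ℝ} {p : ℕ} (hθ : ∀ l ∈ Finset.Icc 1 p, 0 < |θ l|) {a b : ℕ}
    (hab : a ≤ b) (hb : b ≤ p) : psi θ (Finset.Icc a b)
      = min ((b - a + 1 : ℕ) : ℝ) (1 + psiSize a b + psiEnergy θ a b)
        * (1 + Real.log (b - a + 1 : ℕ)) ^ 2 := by
  have hc : (Finset.Icc a b).card = b - a + 1 := by rw [Nat.card_Icc]; omega
  rw [psi, cutM_Icc hθ hab hb, hc, psiSize, psiEnergy]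
  congr 3
  · congr 1
    refine Finset.sum_congr rfl fun j hj => ?_
    rw [Finset.mem_Ico] at hj
    rw [ksize_Icc (by omega) hab, ksize_Icc (by omega) hab]
  · refine Finset.sum_congr rfl fun j hj => ?_
    rw [Finset.mem_Ico] at hj
    rw [tailS_Icc θ (by omega) hab, tailS_Icc θ (by omega) hab]

lemma psiSize_nonneg (a b : ℕ) : 0 ≤ psiSize a b := by
  refine Finset.sum_nonneg fun j _ => div_nonneg ?_ (by positivity)
  have : (blockEnd a j : ℝ) ≤ blockEnd a (j + 1) := by
    exact_mod_cast blockEnd_mono a (Nat.le_succ j)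
  linarith

lemma sum_Ioc_antitone (θ : ℕ → ℝ) {j k : ℕ} (b : ℕ) (h : j ≤ k) :
    ∑ l ∈ Finset.Ioc k b, θ l ^ 2 ≤ ∑ l ∈ Finset.Ioc j b, θ l ^ 2 :=
  Finset.sum_le_sum_of_subset_of_nonneg (Finset.Ioc_subset_Ioc_left h) fun _ _ _ => sq_nonneg _

lemma psiEnergy_nonneg (θ : ℕ → ℝ) (a b : ℕ) : 0 ≤ psiEnergy θ a b := by
  refine Finset.sum_nonneg fun j _ => div_nonneg ?_
    (mul_nonneg (by norm_num) (Finset.sum_nonneg fun _ _ => sq_nonneg _))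
  have := sum_Ioc_antitone θ b (blockEnd_mono a (Nat.sub_le j 1))
  linarith

lemma one_le_psi {θ : ℕ → ℝ} {p : ℕ} (hθ : ∀ l ∈ Finset.Icc 1 p, 0 < |θ l|) {a b : ℕ}
    (hab : a ≤ b) (hb : b ≤ p) : 1 ≤ psi θ (Finset.Icc a b) := by
  rw [psi_Icc hθ hab hb]
  have h1 := psiSize_nonneg a b
  have h2 := psiEnergy_nonneg θ a b
  have h3 : (1 : ℝ) ≤ ((b - a + 1 : ℕ) : ℝ) := by exact_mod_cast Nat.le_add_left 1 _
  have h4 := Real.log_nonneg h3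
  have h5 : 1 ≤ min ((b - a + 1 : ℕ) : ℝ) (1 + psiSize a b + psiEnergy θ a b) :=
    le_min h3 (by linarith)
  nlinarith

lemma sizeRatioSum_le_card (a b : ℕ) : sizeRatioSum a b ≤ (b - a + 1 : ℕ) := by
  have : ∀ i ∈ Finset.Ioc 0 (b - a + 1),
      ((blockEnd a i : ℝ) - blockEnd a (i - 1)) / blockEnd a i ≤ 1 := by
    intro i _
    refine div_le_one_of_le₀ ?_ (Nat.cast_nonneg _)
    have : (0 : ℝ) ≤ blockEnd a (i - 1) := Nat.cast_nonneg _
    linarith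
  refine (Finset.sum_le_sum this).trans ?_
  simp

/-- The first block has relative length at most `1`. A later one has `1 / (a + j)`, at most the term
`1 / (a + j - 1)` of four times `psiSize`, which divides by the preceding size. -/
lemma sizeRatioSum_le {a : ℕ} (ha : 1 ≤ a) (b : ℕ) : sizeRatioSum a b ≤ 1 + 4 * psiSize a b := by
  rw [sizeRatioSum, ← Finset.sum_Ioc_consecutive _ (Nat.zero_le 1) (Nat.le_add_left 1 (b - a))]
  have e1 : ∑ i ∈ Finset.Ioc 0 1, ((blockEnd a i : ℝ) - blockEnd a (i - 1)) / blockEnd a i ≤ 1 := by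
    simp only [zero_add, Nat.Ioc_succ_singleton, Finset.sum_singleton]
    refine div_le_one_of_le₀ ?_ (Nat.cast_nonneg _)
    simp [blockEnd]
  have e2 : ∑ i ∈ Finset.Ioc 1 (b - a + 1), ((blockEnd a i : ℝ) - blockEnd a (i - 1)) / blockEnd a i
      ≤ 4 * psiSize a b := by
    have : Finset.Ioc 1 (b - a + 1) = (Finset.Ico 1 (b - a + 1)).map (addRightEmbedding 1) := by
      rw [Finset.map_add_right_Ico]
      ext i; simp only [Finset.mem_Ioc, Finset.mem_Ico]; omega
    rw [this, Finset.sum_map, psiSize, Finset.mul_sum]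
    refine Finset.sum_le_sum fun j hj => ?_
    rw [Finset.mem_Ico] at hj
    obtain ⟨i, rfl⟩ : ∃ i, j = i + 1 := ⟨j - 1, by omega⟩
    simp only [addRightEmbedding_apply, Nat.add_sub_cancel, blockEnd_succ]
    have h0 : (0 : ℝ) < ((a + i : ℕ) : ℝ) := by exact_mod_cast (show 0 < a + i by omega)
    have h1 : ((a + (i + 1) : ℕ) : ℝ) = ((a + i : ℕ) : ℝ) + 1 := by push_cast; ring
    rw [h1]
    have h2 : 4 * ((((a + i : ℕ) : ℝ) + 1 - ((a + i : ℕ) : ℝ)) / (4 * ((a + i : ℕ) : ℝ)))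
        = 1 / ((a + i : ℕ) : ℝ) := by field_simp; ring
    rw [h2, add_sub_cancel_left]
    exact one_div_le_one_div_of_le h0 (by linarith)
  linarith

lemma energyRatioSum_term_le_one (θ : ℕ → ℝ) {l b : ℕ} (hl : 1 ≤ l) (hlb : l ≤ b) :
    θ l ^ 2 / ∑ m ∈ Finset.Ioc (l - 1) b, θ m ^ 2 ≤ 1 := by
  refine div_le_one_of_le₀ ?_ (Finset.sum_nonneg fun _ _ => sq_nonneg _)
  exact Finset.single_le_sum (f := fun m => θ m ^ 2) (fun _ _ => sq_nonneg _)
    (Finset.mem_Ioc.2 ⟨by omega, hlb⟩)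

lemma energyRatioSum_le_card (θ : ℕ → ℝ) (a b : ℕ) :
    energyRatioSum θ a b ≤ (b - a + 1 : ℕ) := by
  have : ∀ l ∈ Finset.Ioc a b, θ l ^ 2 / ∑ m ∈ Finset.Ioc (l - 1) b, θ m ^ 2 ≤ 1 := by
    intro l hl
    rw [Finset.mem_Ioc] at hl
    exact energyRatioSum_term_le_one θ (by omega) hl.2
  refine (Finset.sum_le_sum this).trans ?_
  simp

/-- The last index contributes at most `1`. For an earlier `l`, dropping `θ l ^ 2` from the
denominator gives a term of four times `psiEnergy`. -/
lemma energyRatioSum_le {θ : ℕ → ℝ} {p : ℕ} (hθ : ∀ l ∈ Finset.Icc 1 p, 0 < |θ l|) {a b : ℕ}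
    (hab : a ≤ b) (hb : b ≤ p) : energyRatioSum θ a b ≤ 1 + 4 * psiEnergy θ a b := by
  rcases Nat.eq_or_lt_of_le hab with h | h
  · subst h
    have := psiEnergy_nonneg θ a a
    simp [energyRatioSum]; linarith
  obtain ⟨c, rfl⟩ : ∃ c, b = c + 1 := ⟨b - 1, by omega⟩
  rw [energyRatioSum, Finset.sum_Ioc_succ_top (by omega)]
  have e1 := energyRatioSum_term_le_one θ (l := c + 1) (b := c + 1) (by omega) le_rfl
  have e2 : ∑ l ∈ Finset.Ioc a c, θ l ^ 2 / ∑ m ∈ Finset.Ioc (l - 1) (c + 1), θ m ^ 2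
      ≤ 4 * psiEnergy θ a (c + 1) := by
    set F : ℕ → ℝ := fun j =>
      4 * ((∑ l ∈ Finset.Ioc (blockEnd a (j - 1)) (c + 1), θ l ^ 2
        - ∑ l ∈ Finset.Ioc (blockEnd a j) (c + 1), θ l ^ 2)
        / (4 * ∑ l ∈ Finset.Ioc (blockEnd a j) (c + 1), θ l ^ 2)) with hF
    have hF0 : ∀ j, 0 ≤ F j := by
      intro j
      refine mul_nonneg (by norm_num) (div_nonneg ?_
        (mul_nonneg (by norm_num) (Finset.sum_nonneg fun _ _ => sq_nonneg _)))
      have := sum_Ioc_antitone θ (c + 1) (blockEnd_mono a (Nat.sub_le j 1))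
      linarith
    -- Only the indices `j ≥ 2` of `psiEnergy` are hit; the nonnegative term of the first block, `j
    -- = 1`, is discarded.
    have hmap : (Finset.Ioc a c).image (fun l => l + 1 - a) ⊆ Finset.Ico 1 (c + 1 - a + 1) := by
      intro j hj
      obtain ⟨l, hl, rfl⟩ := Finset.mem_image.1 hj
      rw [Finset.mem_Ioc] at hl
      rw [Finset.mem_Ico]; omega
    have hinj : Set.InjOn (fun l => l + 1 - a) (Finset.Ioc a c) := by
      intro l hl m hm hlm
      simp only [Finset.coe_Ioc, Set.mem_Ioc] at hl hm hlm
      omega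
    rw [psiEnergy, Finset.mul_sum]
    refine le_trans ?_ (Finset.sum_le_sum_of_subset_of_nonneg hmap fun j _ _ => hF0 j)
    rw [Finset.sum_image hinj]
    refine Finset.sum_le_sum fun l hl => ?_
    rw [Finset.mem_Ioc] at hl
    have h1 : blockEnd a (l + 1 - a) = l := by unfold blockEnd; split_ifs <;> omega
    have h2 : blockEnd a (l + 1 - a - 1) = l - 1 := by unfold blockEnd; split_ifs <;> omega
    have hpos := tail_pos hθ (show l < c + 1 by omega) hb
    have h3 : ∑ m ∈ Finset.Ioc (l - 1) (c + 1), θ m ^ 2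
        = θ l ^ 2 + ∑ m ∈ Finset.Ioc l (c + 1), θ m ^ 2 := by
      rw [← Finset.sum_Ioc_consecutive _ (show l - 1 ≤ l by omega) (show l ≤ c + 1 by omega)]
      congr 1
      have : Finset.Ioc (l - 1) l = {l} := by
        ext i; simp only [Finset.mem_Ioc, Finset.mem_singleton]; omega
      rw [this, Finset.sum_singleton]
    simp only [h1, h2]
    rw [h3, add_sub_cancel_right]
    have h4 : 4 * (θ l ^ 2 / (4 * ∑ m ∈ Finset.Ioc l (c + 1), θ m ^ 2))
        = θ l ^ 2 / ∑ m ∈ Finset.Ioc l (c + 1), θ m ^ 2 := by field_simp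
    rw [h4]
    exact div_le_div_of_nonneg_left (sq_nonneg _) hpos (by linarith [sq_nonneg (θ l)])
  linarith

/-- The constant is `16 = 4 · 4`: one factor from `scaleCount_sq_le`, one from the quarters in `ψ`.
-/
lemma scale_mul_le_psi {θ : ℕ → ℝ} {p : ℕ} (hθ : ∀ l ∈ Finset.Icc 1 p, 0 < |θ l|) {a b : ℕ}
    (hab : a ≤ b) (hb : b ≤ p) {H : ℝ} (h1 : H ≤ (b - a + 1 : ℕ))
    (h2 : H ≤ 1 + 4 * (psiSize a b + psiEnergy θ a b)) :
    (scaleCount (b - a + 1) : ℝ) ^ 2 * H ≤ 16 * psi θ (Finset.Icc a b) := by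
  rw [psi_Icc hθ hab hb]
  have h3 : H ≤ 4 * min ((b - a + 1 : ℕ) : ℝ) (1 + psiSize a b + psiEnergy θ a b) := by
    rw [mul_min_of_nonneg _ _ (by norm_num)]
    have : (0 : ℝ) ≤ ((b - a + 1 : ℕ) : ℝ) := Nat.cast_nonneg _
    exact le_min (by linarith) (by linarith)
  have h4 := scaleCount_sq_le (Nat.le_add_left 1 (b - a))
  have h5 : 0 ≤ min ((b - a + 1 : ℕ) : ℝ) (1 + psiSize a b + psiEnergy θ a b) :=
    le_min (Nat.cast_nonneg _)
      (by linarith [psiSize_nonneg a b, psiEnergy_nonneg θ a b])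
  calc (scaleCount (b - a + 1) : ℝ) ^ 2 * H
      ≤ (scaleCount (b - a + 1) : ℝ) ^ 2
        * (4 * min ((b - a + 1 : ℕ) : ℝ) (1 + psiSize a b + psiEnergy θ a b)) :=
        mul_le_mul_of_nonneg_left h3 (sq_nonneg _)
    _ ≤ (4 * (1 + Real.log (b - a + 1 : ℕ)) ^ 2)
        * (4 * min ((b - a + 1 : ℕ) : ℝ) (1 + psiSize a b + psiEnergy θ a b)) :=
        mul_le_mul_of_nonneg_right h4 (by linarith)
    _ = _ := by ring

theorem scale_mul_sizeRatioSum_le {θ : ℕ → ℝ} {p : ℕ} (hθ : ∀ l ∈ Finset.Icc 1 p, 0 < |θ l|)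
    {a b : ℕ} (ha : 1 ≤ a) (hab : a ≤ b) (hb : b ≤ p) :
    (scaleCount (b - a + 1) : ℝ) ^ 2 * sizeRatioSum a b ≤ 16 * psi θ (Finset.Icc a b) :=
  scale_mul_le_psi hθ hab hb (sizeRatioSum_le_card a b)
    (by linarith [sizeRatioSum_le ha b, psiEnergy_nonneg θ a b])

theorem scale_mul_energyRatioSum_le {θ : ℕ → ℝ} {p : ℕ} (hθ : ∀ l ∈ Finset.Icc 1 p, 0 < |θ l|)
    {a b : ℕ} (hab : a ≤ b) (hb : b ≤ p) :
    (scaleCount (b - a + 1) : ℝ) ^ 2 * energyRatioSum θ a b ≤ 16 * psi θ (Finset.Icc a b) :=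
  scale_mul_le_psi hθ hab hb (energyRatioSum_le_card θ a b)
    (by linarith [energyRatioSum_le hθ hab hb, psiSize_nonneg a b])

/-! ### Deterministic oracle inequality in the sequence model. -/

/-- Cumulative weight sequences of averages over the nested models of sizes `a, …, b`. -/
structure IsWeightSeq (a b : ℕ) (g : ℕ → ℝ) : Prop where
  anti : Antitone g
  nonneg : ∀ l, 0 ≤ g l
  le_one : ∀ l, g l ≤ 1
  one : ∀ l ≤ a, g l = 1
  zero : ∀ l, b < l → g l = 0

lemma cumWeight_antitone {K : Finset ℕ} {w : K → ℝ} (hw : ∀ m, 0 ≤ w m) :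
    Antitone (cumWeight K w) := by
  intro i j hij
  refine Finset.sum_le_sum fun m _ => ?_
  split_ifs with h1 h2
  · exact le_rfl
  · exact absurd (hij.trans h1) h2
  · exact hw m
  · exact le_rfl

lemma cumWeight_nonneg {K : Finset ℕ} {w : K → ℝ} (hw : ∀ m, 0 ≤ w m) (l : ℕ) :
    0 ≤ cumWeight K w l := by
  refine Finset.sum_nonneg fun m _ => ?_
  split_ifs; exacts [hw m, le_rfl]

lemma cumWeight_le_one {K : Finset ℕ} {w : K → ℝ} (hw : w ∈ stdSimplex ℝ K) (l : ℕ) :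
    cumWeight K w l ≤ 1 := by
  rw [← hw.2]
  refine Finset.sum_le_sum fun m _ => ?_
  split_ifs; exacts [le_rfl, hw.1 m]

lemma cumWeight_isWeightSeq {a b : ℕ} {w : Finset.Icc a b → ℝ}
    (hw : w ∈ stdSimplex ℝ (Finset.Icc a b)) :
    IsWeightSeq a b (cumWeight (Finset.Icc a b) w) where
  anti := cumWeight_antitone hw.1
  nonneg := cumWeight_nonneg hw.1
  le_one := cumWeight_le_one hw
  one l hl := by
    rw [← hw.2]
    refine Finset.sum_congr rfl fun m _ => ?_
    rw [if_pos (hl.trans (Finset.mem_Icc.1 m.2).1)]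
  zero l hl := by
    refine Finset.sum_eq_zero fun m _ => ?_
    rw [if_neg]
    have := (Finset.mem_Icc.1 m.2).2
    omega

/-- Risk of the cumulative weights `g` in the sequence model. -/
def seqRisk (p : ℕ) (s : ℝ) (θ g : ℕ → ℝ) : ℝ :=
  ∑ l ∈ Finset.Ioc 0 p, (1 - g l) ^ 2 * θ l ^ 2 + s * ∑ l ∈ Finset.Ioc 0 p, g l ^ 2

/-- Loss of the cumulative weights `g` in the sequence model. -/
def seqLoss (p : ℕ) (θ e g : ℕ → ℝ) : ℝ :=
  ∑ l ∈ Finset.Ioc 0 p, (g l * (θ l + e l) - θ l) ^ 2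

/-- The part of the Mallows criterion that depends on the cumulative weights `g`. -/
def seqCrit (p : ℕ) (t : ℝ) (z g : ℕ → ℝ) : ℝ :=
  ∑ l ∈ Finset.Ioc 0 p, (g l ^ 2 - 2 * g l) * z l ^ 2 + 2 * t * ∑ l ∈ Finset.Ioc 0 p, g l

/-- Fluctuation of the Mallows criterion around the risk, with error `τ` in the penalty. -/
def critDev (p a b : ℕ) (s τ : ℝ) (θ e g : ℕ → ℝ) : ℝ :=
  2 * ∑ l ∈ Finset.Ioc a b, (1 - g l) ^ 2 * (θ l * e l)
    - 2 * ∑ l ∈ Finset.Ioc 0 p, g l * (e l ^ 2 - s)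
    + ∑ l ∈ Finset.Ioc 0 p, g l ^ 2 * (e l ^ 2 - s)
    + 2 * τ * ∑ l ∈ Finset.Ioc 0 p, g l

/-- Fluctuation of the loss around the risk. -/
def lossDev (p a b : ℕ) (s : ℝ) (θ e g : ℕ → ℝ) : ℝ :=
  ∑ l ∈ Finset.Ioc 0 p, g l ^ 2 * (e l ^ 2 - s)
    - 2 * (∑ l ∈ Finset.Ioc a b, (1 - g l) * (θ l * e l)
      - ∑ l ∈ Finset.Ioc a b, (1 - g l) ^ 2 * (θ l * e l))

lemma seqRisk_nonneg (p : ℕ) {s : ℝ} (hs : 0 ≤ s) (θ g : ℕ → ℝ) : 0 ≤ seqRisk p s θ g :=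
  add_nonneg (Finset.sum_nonneg fun _ _ => by positivity)
    (mul_nonneg hs (Finset.sum_nonneg fun _ _ => by positivity))

lemma sum_Ioc_three {a b p : ℕ} (hab : a ≤ b) (hb : b ≤ p) (F : ℕ → ℝ) :
    ∑ l ∈ Finset.Ioc 0 p, F l = ∑ l ∈ Finset.Ioc 0 a, F l + ∑ l ∈ Finset.Ioc a b, F l
      + ∑ l ∈ Finset.Ioc b p, F l := by
  rw [Finset.sum_Ioc_consecutive F (Nat.zero_le a) hab,
    Finset.sum_Ioc_consecutive F (Nat.zero_le b) hb]

/-- The cross term carries `g (1 - g)`, which vanishes outside `(a, b]` but is not monotone. Writing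
it as `(1 - g) - (1 - g)²`, a difference of two monotone sequences, brings it within reach of
chaining. -/
lemma seqLoss_eq {a b p : ℕ} (hab : a ≤ b) (hb : b ≤ p) (s : ℝ) (θ e : ℕ → ℝ) {g : ℕ → ℝ}
    (hg : IsWeightSeq a b g) :
    seqLoss p θ e g = seqRisk p s θ g + lossDev p a b s θ e g := by
  have h1 : ∑ l ∈ Finset.Ioc 0 p, ((1 - g l) - (1 - g l) ^ 2) * (θ l * e l)
      = ∑ l ∈ Finset.Ioc a b, ((1 - g l) - (1 - g l) ^ 2) * (θ l * e l) := by
    rw [sum_Ioc_three hab hb,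
      Finset.sum_eq_zero (s := Finset.Ioc 0 a) fun l hl => by
        rw [hg.one l (Finset.mem_Ioc.1 hl).2]; ring,
      Finset.sum_eq_zero (s := Finset.Ioc b p) fun l hl => by
        rw [hg.zero l (Finset.mem_Ioc.1 hl).1]; ring]
    ring
  have h2 : lossDev p a b s θ e g = ∑ l ∈ Finset.Ioc 0 p, g l ^ 2 * (e l ^ 2 - s)
      - 2 * ∑ l ∈ Finset.Ioc 0 p, ((1 - g l) - (1 - g l) ^ 2) * (θ l * e l) := by
    rw [h1, lossDev, ← Finset.sum_sub_distrib]
    congr 2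
    exact Finset.sum_congr rfl fun l _ => by ring
  rw [h2, seqRisk, seqLoss]
  simp only [Finset.mul_sum]
  rw [← Finset.sum_sub_distrib, ← Finset.sum_add_distrib, ← Finset.sum_add_distrib]
  exact Finset.sum_congr rfl fun l _ => by ring

/-- Beyond `b` the factor `(1 - g)²` is `1`, so that part of the linear noise joins the terms free
of `g`; these cancel when two weight sequences are compared. -/
lemma seqCrit_eq {a b p : ℕ} (hab : a ≤ b) (hb : b ≤ p) (s τ : ℝ) (θ e : ℕ → ℝ) {g : ℕ → ℝ}
    (hg : IsWeightSeq a b g) :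
    seqCrit p (s + τ) (fun l => θ l + e l) g = seqRisk p s θ g + critDev p a b s τ θ e g
      + (2 * ∑ l ∈ Finset.Ioc b p, θ l * e l
        + ∑ l ∈ Finset.Ioc 0 p, (e l ^ 2 - (θ l + e l) ^ 2)) := by
  have h1 : ∑ l ∈ Finset.Ioc 0 p, (1 - g l) ^ 2 * (θ l * e l)
      = ∑ l ∈ Finset.Ioc a b, (1 - g l) ^ 2 * (θ l * e l) + ∑ l ∈ Finset.Ioc b p, θ l * e l := by
    rw [sum_Ioc_three hab hb,
      Finset.sum_eq_zero (s := Finset.Ioc 0 a) fun l hl => by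
        rw [hg.one l (Finset.mem_Ioc.1 hl).2]; ring,
      Finset.sum_congr (s₁ := Finset.Ioc b p) rfl fun l hl => by
        rw [hg.zero l (Finset.mem_Ioc.1 hl).1]]
    simp
  have h2 : critDev p a b s τ θ e g + 2 * ∑ l ∈ Finset.Ioc b p, θ l * e l
      = 2 * ∑ l ∈ Finset.Ioc 0 p, (1 - g l) ^ 2 * (θ l * e l)
    - 2 * ∑ l ∈ Finset.Ioc 0 p, g l * (e l ^ 2 - s)
    + ∑ l ∈ Finset.Ioc 0 p, g l ^ 2 * (e l ^ 2 - s)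
    + 2 * τ * ∑ l ∈ Finset.Ioc 0 p, g l := by
    rw [h1, critDev]; ring
  rw [← add_assoc, add_assoc (seqRisk p s θ g), h2, seqRisk, seqCrit]
  simp only [Finset.mul_sum, ← Finset.sum_sub_distrib, ← Finset.sum_add_distrib]
  exact Finset.sum_congr rfl fun l _ => by ring

section Deterministic

variable {a b p : ℕ} {s τ Ul Uq : ℝ} {θ e : ℕ → ℝ}

/-- The random factor that controls the fluctuations of criterion and loss. -/
def noiseFactor (p : ℕ) (s τ Ul Uq : ℝ) : ℝ := 16 * Ul + 20 * (Uq / s) + 16 * (τ ^ 2 * (p / s))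

lemma noiseFactor_nonneg (hs : 0 < s) (hUl : 0 ≤ Ul) (hUq : 0 ≤ Uq) :
    0 ≤ noiseFactor p s τ Ul Uq := by
  unfold noiseFactor; positivity

/-- Each fluctuation term is a monotone weighting of noise whose weighted energy is at most the risk
(linear terms) or the risk over `s` (quadratic terms), because powers of numbers in `[0, 1]` do not
exceed their base. The penalty error uses Cauchy–Schwarz over `p` coordinates. In `noiseFactor`, `20
= 4 (4 + 1)` collects the terms in `g` and `g²`. -/
lemma dev_sq_le (hs : 0 < s) (hb : b ≤ p) (hUl : 0 ≤ Ul) (hUq : 0 ≤ Uq)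
    (hq : ∀ g : ℕ → ℝ, Antitone g → (∀ l, 0 ≤ g l) → (∀ l ≤ a, g l = g a) →
      (∀ l, b < l → g l = 0) →
      (∑ l ∈ Finset.Ioc 0 p, g l * (e l ^ 2 - s)) ^ 2 ≤ Uq * ∑ l ∈ Finset.Ioc 0 p, g l ^ 2)
    (hl : ∀ g : ℕ → ℝ, Monotone g → (∀ l, 0 ≤ g l) →
      (∑ l ∈ Finset.Ioc a b, g l * (θ l * e l)) ^ 2
        ≤ Ul * ∑ l ∈ Finset.Ioc a b, g l ^ 2 * θ l ^ 2)
    {g : ℕ → ℝ} (hg : IsWeightSeq a b g) :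
    critDev p a b s τ θ e g ^ 2 ≤ noiseFactor p s τ Ul Uq * seqRisk p s θ g ∧
    lossDev p a b s θ e g ^ 2 ≤ 2 * noiseFactor p s τ Ul Uq * seqRisk p s θ g := by
  have g0 := hg.nonneg
  have g1 := hg.le_one
  set R := seqRisk p s θ g with hR
  have hR1 : ∑ l ∈ Finset.Ioc a b, (1 - g l) ^ 2 * θ l ^ 2 ≤ R := by
    have h1 : ∑ l ∈ Finset.Ioc a b, (1 - g l) ^ 2 * θ l ^ 2
        ≤ ∑ l ∈ Finset.Ioc 0 p, (1 - g l) ^ 2 * θ l ^ 2 :=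
      Finset.sum_le_sum_of_subset_of_nonneg (Finset.Ioc_subset_Ioc (Nat.zero_le a) hb)
        fun _ _ _ => by positivity
    have h2 : 0 ≤ s * ∑ l ∈ Finset.Ioc 0 p, g l ^ 2 :=
      mul_nonneg hs.le (Finset.sum_nonneg fun _ _ => sq_nonneg _)
    rw [hR, seqRisk]; linarith
  have hR1' : ∑ l ∈ Finset.Ioc a b, ((1 - g l) ^ 2) ^ 2 * θ l ^ 2 ≤ R := by
    refine le_trans (Finset.sum_le_sum fun l _ => ?_) hR1
    refine mul_le_mul_of_nonneg_right ?_ (sq_nonneg _)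
    have := g0 l; have := g1 l
    have h3 : (1 - g l) ^ 2 ≤ 1 := by nlinarith
    nlinarith [sq_nonneg (1 - g l)]
  have hR2 : ∑ l ∈ Finset.Ioc 0 p, g l ^ 2 ≤ R / s := by
    rw [le_div_iff₀ hs, hR, seqRisk]
    have : 0 ≤ ∑ l ∈ Finset.Ioc 0 p, (1 - g l) ^ 2 * θ l ^ 2 :=
      Finset.sum_nonneg fun _ _ => by positivity
    linarith
  have hR2' : ∑ l ∈ Finset.Ioc 0 p, (g l ^ 2) ^ 2 ≤ R / s := by
    refine le_trans (Finset.sum_le_sum fun l _ => ?_) hR2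
    have := g0 l; have := g1 l
    have h3 : g l ^ 2 ≤ 1 := by nlinarith
    nlinarith [sq_nonneg (g l)]
  set t1 := ∑ l ∈ Finset.Ioc a b, (1 - g l) ^ 2 * (θ l * e l) with ht1
  set t1' := ∑ l ∈ Finset.Ioc a b, (1 - g l) * (θ l * e l) with ht1'
  set t2 := ∑ l ∈ Finset.Ioc 0 p, g l * (e l ^ 2 - s) with ht2
  set t3 := ∑ l ∈ Finset.Ioc 0 p, g l ^ 2 * (e l ^ 2 - s) with ht3
  set t4 := ∑ l ∈ Finset.Ioc 0 p, g l with ht4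
  have b1 : t1 ^ 2 ≤ Ul * R :=
    (hl (fun l => (1 - g l) ^ 2) (fun i j hij => by
      have := hg.anti hij; have := g1 i; have := g1 j
      simp only; nlinarith) fun l => sq_nonneg _).trans (mul_le_mul_of_nonneg_left hR1' hUl)
  have b1' : t1' ^ 2 ≤ Ul * R :=
    (hl (fun l => 1 - g l) (fun i j hij => by have := hg.anti hij; simp only; linarith)
      fun l => by linarith [g1 l]).trans (mul_le_mul_of_nonneg_left hR1 hUl)
  have b2 : t2 ^ 2 ≤ Uq / s * R := by
    refine ((hq g hg.anti g0 (fun l hl => by rw [hg.one l hl, hg.one a le_rfl]) hg.zero).trans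
      (mul_le_mul_of_nonneg_left hR2 hUq)).trans (le_of_eq (by ring))
  have b3 : t3 ^ 2 ≤ Uq / s * R := by
    refine ((hq (fun l => g l ^ 2) (fun i j hij => pow_le_pow_left₀ (g0 j) (hg.anti hij) 2)
      (fun l => sq_nonneg _) (fun l hl => by simp only [hg.one l hl, hg.one a le_rfl])
      (fun l hl => by simp [hg.zero l hl])).trans
      (mul_le_mul_of_nonneg_left hR2' hUq)).trans (le_of_eq (by ring))
  have b4 : t4 ^ 2 ≤ p / s * R := by
    have := sq_sum_le_card_mul_sum_sq (s := Finset.Ioc 0 p) (f := g)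
    rw [Nat.card_Ioc, Nat.sub_zero] at this
    refine (this.trans (mul_le_mul_of_nonneg_left hR2 (Nat.cast_nonneg p))).trans
      (le_of_eq (by ring))
  have b4' : τ ^ 2 * t4 ^ 2 ≤ τ ^ 2 * (p / s * R) := mul_le_mul_of_nonneg_left b4 (sq_nonneg τ)
  have hR0 : 0 ≤ R := seqRisk_nonneg p hs.le θ g
  have hq0 : 0 ≤ Uq / s * R := by positivity
  have hl0 : 0 ≤ Ul * R := by positivity
  have hp0 : 0 ≤ τ ^ 2 * (p / s * R) := by positivity
  constructor
  · have : critDev p a b s τ θ e g = 2 * t1 - 2 * t2 + t3 + 2 * τ * t4 := rfl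
    rw [this]
    have h4 : (2 * t1 - 2 * t2 + t3 + 2 * τ * t4) ^ 2
        ≤ 4 * (4 * t1 ^ 2 + 4 * t2 ^ 2 + t3 ^ 2 + 4 * (τ ^ 2 * t4 ^ 2)) := by
      nlinarith [sq_nonneg (2 * t1 + 2 * t2), sq_nonneg (2 * t1 - t3),
        sq_nonneg (2 * t1 - 2 * τ * t4), sq_nonneg (2 * t2 + t3), sq_nonneg (2 * t2 + 2 * τ * t4),
        sq_nonneg (t3 - 2 * τ * t4)]
    refine h4.trans ?_
    unfold noiseFactor
    linarith
  · have : lossDev p a b s θ e g = t3 - 2 * (t1' - t1) := rfl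
    rw [this]
    have h4 : (t3 - 2 * (t1' - t1)) ^ 2 ≤ 3 * (t3 ^ 2 + 4 * t1' ^ 2 + 4 * t1 ^ 2) := by
      nlinarith [sq_nonneg (t3 + 2 * t1'), sq_nonneg (t3 - 2 * t1), sq_nonneg (2 * t1' + 2 * t1)]
    refine h4.trans ?_
    unfold noiseFactor
    linarith

/-- The arithmetic–geometric mean inequality applied to `√(A R)`. -/
lemma abs_le_of_sq_le_mul {N A R δ : ℝ} (hA : 0 ≤ A) (hR : 0 ≤ R) (hδ : 0 < δ)
    (h : N ^ 2 ≤ A * R) : |N| ≤ δ * R + A / (4 * δ) := by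
  have h0 : 0 ≤ δ * R + A / (4 * δ) := by positivity
  refine abs_le_of_sq_le_sq ?_ h0
  refine h.trans ?_
  have h1 : δ * R * (A / (4 * δ)) = A * R / 4 := by field_simp
  nlinarith [sq_nonneg (δ * R - A / (4 * δ))]

/-- Minimality gives `R(g) + N(g) ≤ R(g') + N(g')` for the fluctuations `N`. Since `N² ≤ A R`, each
`N` costs a fraction `δ` of its own risk plus `A / (4 δ)`, and the fraction on the left is absorbed.
-/
theorem oracle_inequality (hs : 0 < s) (hab : a ≤ b) (hb : b ≤ p) (hUl : 0 ≤ Ul) (hUq : 0 ≤ Uq)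
    (hq : ∀ g : ℕ → ℝ, Antitone g → (∀ l, 0 ≤ g l) → (∀ l ≤ a, g l = g a) →
      (∀ l, b < l → g l = 0) →
      (∑ l ∈ Finset.Ioc 0 p, g l * (e l ^ 2 - s)) ^ 2 ≤ Uq * ∑ l ∈ Finset.Ioc 0 p, g l ^ 2)
    (hl : ∀ g : ℕ → ℝ, Monotone g → (∀ l, 0 ≤ g l) →
      (∑ l ∈ Finset.Ioc a b, g l * (θ l * e l)) ^ 2
        ≤ Ul * ∑ l ∈ Finset.Ioc a b, g l ^ 2 * θ l ^ 2)
    {g g' : ℕ → ℝ} (hg : IsWeightSeq a b g) (hg' : IsWeightSeq a b g')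
    (hmin : seqCrit p (s + τ) (fun l => θ l + e l) g ≤ seqCrit p (s + τ) (fun l => θ l + e l) g')
    {δ : ℝ} (hδ : 0 < δ) (hδ' : δ ≤ 1 / 2) :
    seqRisk p s θ g ≤ (1 + 7 * δ) * seqRisk p s θ g' + 2 / δ * noiseFactor p s τ Ul Uq ∧
    seqLoss p θ e g ≤ (1 + 7 * δ) * seqRisk p s θ g' + 2 / δ * noiseFactor p s τ Ul Uq := by
  rw [seqCrit_eq hab hb s τ θ e hg, seqCrit_eq hab hb s τ θ e hg'] at hmin
  obtain ⟨c1, l1⟩ := dev_sq_le (τ := τ) hs hb hUl hUq hq hl hg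
  obtain ⟨c2, -⟩ := dev_sq_le (τ := τ) hs hb hUl hUq hq hl hg'
  have hA := noiseFactor_nonneg (p := p) (τ := τ) hs hUl hUq
  have hR := seqRisk_nonneg p hs.le θ g
  have hR' := seqRisk_nonneg p hs.le θ g'
  rw [seqLoss_eq hab hb s θ e hg]
  set A := noiseFactor p s τ Ul Uq
  set R := seqRisk p s θ g
  set R' := seqRisk p s θ g'
  have d1 := abs_le.1 (abs_le_of_sq_le_mul hA hR hδ c1)
  have d2 := abs_le.1 (abs_le_of_sq_le_mul hA hR' hδ c2)
  have d3 := abs_le.1 (abs_le_of_sq_le_mul (by positivity : (0 : ℝ) ≤ 2 * A) hR hδ l1)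
  set B := A / δ with hB
  have e1 : A / (4 * δ) = B / 4 := by rw [hB]; field_simp
  have e2 : 2 * A / (4 * δ) = B / 2 := by rw [hB]; field_simp; ring
  have e3 : 2 / δ * A = 2 * B := by rw [hB]; ring
  have hB0 : 0 ≤ B := by positivity
  rw [e1] at d1 d2
  rw [e2] at d3
  rw [e3]
  have k1 : (1 - δ) * R ≤ (1 + δ) * R' + B / 2 := by linarith [d1.1, d2.2]
  have k2 : R ≤ (1 + 4 * δ) * R' + B := by
    -- `(1 - δ)(1 + 4 δ) ≥ 1 + δ` is precisely where `δ ≤ 1 / 2` is needed.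
    have h1 : (1 + δ) * R' + B / 2 ≤ (1 - δ) * ((1 + 4 * δ) * R' + B) := by
      have : 0 ≤ (2 * δ - 4 * δ ^ 2) * R' := mul_nonneg (by nlinarith) hR'
      nlinarith
    exact le_of_mul_le_mul_left (k1.trans h1) (by linarith)
  have hδR : 0 ≤ δ * R' := by positivity
  refine ⟨by linarith, ?_⟩
  -- The loss pays `δ R` once more: `(1 + δ)(1 + 4 δ) ≤ 1 + 7 δ` for `δ ≤ 1 / 2`.
  have k3 : (1 + δ) * R ≤ (1 + δ) * ((1 + 4 * δ) * R' + B) :=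
    mul_le_mul_of_nonneg_left k2 (by linarith)
  have k4 : 0 ≤ (2 * δ - 4 * δ ^ 2) * R' := mul_nonneg (by nlinarith) hR'
  nlinarith [d3.2]

end Deterministic

/-! ### Oracle inequality in expectation. -/

section ExpectedRisk

variable {Ω : Type*} [MeasurableSpace Ω] {μ : Measure Ω} [IsProbabilityMeasure μ]
  {e : ℕ → Ω → ℝ} {p : ℕ} {s D : ℝ} {θ : ℕ → ℝ}

lemma IsSeqNoise.integrable_sq (h : IsSeqNoise e μ p s D) (l : ℕ) :
    Integrable (fun ω => e l ω ^ 2) μ :=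
  ((h.memLp l).mono_exponent (by norm_num : (2 : ENNReal) ≤ 4)).integrable_sq

lemma IsSeqNoise.integrable (h : IsSeqNoise e μ p s D) (l : ℕ) : Integrable (e l) μ :=
  (h.memLp l).integrable (by norm_num)

lemma IsSeqNoise.integral_seqLoss (h : IsSeqNoise e μ p s D) (g : ℕ → ℝ) :
    ∫ ω, seqLoss p θ (fun l => e l ω) g ∂μ = seqRisk p s θ g := by
  have e1 : ∀ l ω, (g l * (θ l + e l ω) - θ l) ^ 2
      = g l ^ 2 * e l ω ^ 2 + (-2 * g l * (1 - g l) * θ l) * e l ω + (1 - g l) ^ 2 * θ l ^ 2 :=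
    fun l ω => by ring
  have i1 : ∀ l, Integrable (fun ω => g l ^ 2 * e l ω ^ 2) μ := fun l =>
    (h.integrable_sq l).const_mul _
  have i2 : ∀ l, Integrable (fun ω => (-2 * g l * (1 - g l) * θ l) * e l ω) μ := fun l =>
    (h.integrable l).const_mul _
  have i3 : ∀ l, Integrable (fun ω => g l ^ 2 * e l ω ^ 2
      + (-2 * g l * (1 - g l) * θ l) * e l ω) μ := fun l => (i1 l).add (i2 l)
  have i4 : ∀ l, Integrable (fun ω => g l ^ 2 * e l ω ^ 2
      + (-2 * g l * (1 - g l) * θ l) * e l ω + (1 - g l) ^ 2 * θ l ^ 2) μ := fun l =>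
    (i3 l).add (integrable_const _)
  unfold seqLoss
  simp_rw [e1]
  rw [integral_finsetSum _ fun l _ => i4 l, seqRisk, Finset.mul_sum,
    ← Finset.sum_add_distrib]
  refine Finset.sum_congr rfl fun l hl => ?_
  rw [integral_add (i3 l) (integrable_const _), integral_add (i1 l) (i2 l), integral_const_mul,
    integral_const_mul, h.var l hl, h.mean]
  simp only [integral_const, probReal_univ, smul_eq_mul, one_mul]
  ring

lemma measurable_cumWeight {K : Finset ℕ} {W : Ω → K → ℝ} (hW : Measurable W) (l : ℕ) :
    Measurable (fun ω => cumWeight K (W ω) l) := by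
  unfold cumWeight
  refine Finset.measurable_fun_sum _ fun m _ => ?_
  split_ifs
  · exact (measurable_pi_apply m).comp hW
  · exact measurable_const

lemma integrable_seqRisk (p : ℕ) (s : ℝ) (θ : ℕ → ℝ) {K : Finset ℕ} {W : Ω → K → ℝ}
    (hW : Measurable W) (hmem : ∀ ω, W ω ∈ stdSimplex ℝ K) :
    Integrable (fun ω => seqRisk p s θ (cumWeight K (W ω))) μ := by
  have hm := measurable_cumWeight hW
  have hb : ∀ l ω, |cumWeight K (W ω) l| ≤ 1 := fun l ω => by
    rw [abs_of_nonneg (cumWeight_nonneg (hmem ω).1 l)]; exact cumWeight_le_one (hmem ω) l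
  unfold seqRisk
  refine (integrable_finsetSum _ fun l _ => ?_).add
    ((integrable_finsetSum _ fun l _ => ?_).const_mul s)
  · refine Integrable.mul_const ?_ _
    refine Integrable.of_bound (C := 1) (((hm l).const_sub 1).pow_const 2).aestronglyMeasurable (ae_of_all _ fun ω => ?_)
    have h0 := cumWeight_nonneg (hmem ω).1 l
    have h1 := cumWeight_le_one (hmem ω) l
    rw [Real.norm_of_nonneg (sq_nonneg _)]
    nlinarith
  · refine Integrable.of_bound (C := 1) ((hm l).pow_const 2).aestronglyMeasurable (ae_of_all _ fun ω => ?_)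
    have h0 := cumWeight_nonneg (hmem ω).1 l
    have h1 := cumWeight_le_one (hmem ω) l
    rw [Real.norm_of_nonneg (sq_nonneg _)]
    nlinarith

lemma IsSeqNoise.integrable_seqLoss (h : IsSeqNoise e μ p s D) (θ : ℕ → ℝ) {K : Finset ℕ}
    {W : Ω → K → ℝ} (hW : Measurable W) (hmem : ∀ ω, W ω ∈ stdSimplex ℝ K) :
    Integrable (fun ω => seqLoss p θ (fun l => e l ω) (cumWeight K (W ω))) μ := by
  have hm := measurable_cumWeight hW
  have he := h.meas
  unfold seqLoss
  refine integrable_finsetSum _ fun l _ => ?_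
  have hdom : Integrable (fun ω => 2 * e l ω ^ 2 + 2 * θ l ^ 2) μ :=
    ((h.integrable_sq l).const_mul 2).add (integrable_const _)
  refine hdom.mono' (by fun_prop) (ae_of_all _ fun ω => ?_)
  have h0 := cumWeight_nonneg (hmem ω).1 l
  have h1 := cumWeight_le_one (hmem ω) l
  rw [Real.norm_of_nonneg (sq_nonneg _)]
  set c := cumWeight K (W ω) l
  have e1 : c * (θ l + e l ω) - θ l = c * e l ω - (1 - c) * θ l := by ring
  rw [e1]
  have h2 : c ^ 2 ≤ 1 := by nlinarith
  have h3 : (1 - c) ^ 2 ≤ 1 := by nlinarith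
  have h4 := mul_le_mul_of_nonneg_right h2 (sq_nonneg (e l ω))
  have h5 := mul_le_mul_of_nonneg_right h3 (sq_nonneg (θ l))
  nlinarith [sq_nonneg (c * e l ω + (1 - c) * θ l)]

/-- The pointwise inequality is integrated; `256 = 16 · 16` and `320 = 20 · 16` multiply the
coefficients of `noiseFactor` by the constant of the `ψ` bounds. -/
theorem IsSeqNoise.expected_oracle_inequality (h : IsSeqNoise e μ p s D) (hs : 0 < s) (hD : 0 ≤ D)
    (hθ : ∀ l ∈ Finset.Icc 1 p, 0 < |θ l|) {a b : ℕ} (ha : 1 ≤ a) (hab : a ≤ b) (hb : b ≤ p)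
    {τ : Ω → ℝ} (hτ : Integrable (fun ω => τ ω ^ 2) μ) {W : Ω → Finset.Icc a b → ℝ}
    (hW : Measurable W) (hmem : ∀ ω, W ω ∈ stdSimplex ℝ (Finset.Icc a b))
    {w : Finset.Icc a b → ℝ} (hw : w ∈ stdSimplex ℝ (Finset.Icc a b))
    (hmin : ∀ ω, seqCrit p (s + τ ω) (fun l => θ l + e l ω) (cumWeight _ (W ω))
      ≤ seqCrit p (s + τ ω) (fun l => θ l + e l ω) (cumWeight _ w))
    {δ : ℝ} (hδ : 0 < δ) (hδ' : δ ≤ 1 / 2) :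
    ∫ ω, seqRisk p s θ (cumWeight _ (W ω)) ∂μ ≤ (1 + 7 * δ) * seqRisk p s θ (cumWeight _ w)
      + 2 / δ * ((256 + 320 * D) * s * psi θ (Finset.Icc a b) + 16 * (p / s) * ∫ ω, τ ω ^ 2 ∂μ) ∧
    ∫ ω, seqLoss p θ (fun l => e l ω) (cumWeight _ (W ω)) ∂μ
      ≤ (1 + 7 * δ) * seqRisk p s θ (cumWeight _ w)
      + 2 / δ * ((256 + 320 * D) * s * psi θ (Finset.Icc a b)
        + 16 * (p / s) * ∫ ω, τ ω ^ 2 ∂μ) := by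
  obtain ⟨Uq, iq, q0, Eq, hq⟩ := exists_quad_stat h hD ha hab hb
  obtain ⟨Ul, il, l0, El, hl⟩ := exists_linear_stat h hs.le hθ hab hb
  have hpt := fun ω => oracle_inequality (τ := τ ω) hs hab hb (l0 ω) (q0 ω) (hq ω) (hl ω)
    (cumWeight_isWeightSeq (hmem ω)) (cumWeight_isWeightSeq hw) (hmin ω) hδ hδ'
  have iU : Integrable (fun ω => 16 * Ul ω + 20 * (Uq ω / s)) μ :=
    (il.const_mul 16).add ((iq.div_const s).const_mul 20)
  have iA : Integrable (fun ω => noiseFactor p s (τ ω) (Ul ω) (Uq ω)) μ :=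
    iU.add ((hτ.mul_const _).const_mul 16)
  have iB : Integrable (fun ω => (1 + 7 * δ) * seqRisk p s θ (cumWeight _ w)
      + 2 / δ * noiseFactor p s (τ ω) (Ul ω) (Uq ω)) μ :=
    (integrable_const _).add (iA.const_mul _)
  have hEA : ∫ ω, noiseFactor p s (τ ω) (Ul ω) (Uq ω) ∂μ
      ≤ (256 + 320 * D) * s * psi θ (Finset.Icc a b) + 16 * (p / s) * ∫ ω, τ ω ^ 2 ∂μ := by
    unfold noiseFactor
    rw [integral_add iU ((hτ.mul_const _).const_mul 16), integral_add (il.const_mul 16)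
      ((iq.div_const s).const_mul 20), integral_const_mul, integral_const_mul, integral_const_mul,
      integral_div, integral_mul_const]
    have k1 := scale_mul_energyRatioSum_le hθ hab hb
    have k2 := scale_mul_sizeRatioSum_le hθ ha hab hb
    have m1 : ∫ ω, Ul ω ∂μ ≤ 16 * s * psi θ (Finset.Icc a b) :=
      El.trans (by nlinarith [mul_le_mul_of_nonneg_left k1 hs.le])
    have m2 : (∫ ω, Uq ω ∂μ) / s ≤ 16 * D * s * psi θ (Finset.Icc a b) := by
      rw [div_le_iff₀ hs]
      refine Eq.trans ?_
      have := mul_le_mul_of_nonneg_left k2 (show 0 ≤ D * s ^ 2 by positivity)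
      nlinarith
    nlinarith
  have hB : ∫ ω, ((1 + 7 * δ) * seqRisk p s θ (cumWeight _ w)
      + 2 / δ * noiseFactor p s (τ ω) (Ul ω) (Uq ω)) ∂μ ≤ (1 + 7 * δ) * seqRisk p s θ (cumWeight _ w)
      + 2 / δ * ((256 + 320 * D) * s * psi θ (Finset.Icc a b)
        + 16 * (p / s) * ∫ ω, τ ω ^ 2 ∂μ) := by
    rw [integral_add (integrable_const _) (iA.const_mul _), integral_const_mul (2 / δ)]
    simp only [integral_const, probReal_univ, smul_eq_mul, one_mul]
    have := mul_le_mul_of_nonneg_left hEA (show 0 ≤ 2 / δ by positivity)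
    linarith
  exact ⟨(integral_mono (integrable_seqRisk p s θ hW hmem) iB fun ω => (hpt ω).1).trans hB,
    (integral_mono (h.integrable_seqLoss θ hW hmem) iB fun ω => (hpt ω).2).trans hB⟩

end ExpectedRisk

/-! Comparison of candidate sets. -/

section Window

/-- The pointwise oracle risk `∑ θ² s / (θ² + s)`. -/
def linearOracle (p : ℕ) (s : ℝ) (θ : ℕ → ℝ) : ℝ :=
  ∑ l ∈ Finset.Ioc 0 p, θ l ^ 2 * s / (θ l ^ 2 + s)

variable {p : ℕ} {s : ℝ} {θ : ℕ → ℝ}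

/-- Each coordinate is minimized separately at `g = θ² / (θ² + s)`, with no monotonicity or simplex
constraint; the gap is a perfect square over `θ² + s`. -/
lemma linearOracle_le_seqRisk (hs : 0 < s) (g : ℕ → ℝ) :
    linearOracle p s θ ≤ seqRisk p s θ g := by
  rw [seqRisk, Finset.mul_sum, ← Finset.sum_add_distrib, linearOracle]
  refine Finset.sum_le_sum fun l _ => ?_
  have h0 : 0 < θ l ^ 2 + s := by positivity
  rw [div_le_iff₀ h0]
  nlinarith [sq_nonneg ((1 - g l) * θ l ^ 2 - s * g l)]

lemma half_mul_le_linearOracle (hs : 0 < s) {m : ℕ} (hm : m ≤ p)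
    (hθ : ∀ l ∈ Finset.Ioc 0 m, s ≤ θ l ^ 2) : m * s / 2 ≤ linearOracle p s θ := by
  have h1 : ∑ l ∈ Finset.Ioc 0 m, s / 2 ≤ ∑ l ∈ Finset.Ioc 0 m, θ l ^ 2 * s / (θ l ^ 2 + s) := by
    refine Finset.sum_le_sum fun l hl => ?_
    have := hθ l hl
    rw [div_le_div_iff₀ (by norm_num) (by positivity)]
    nlinarith
  have h2 : ∑ l ∈ Finset.Ioc 0 m, θ l ^ 2 * s / (θ l ^ 2 + s) ≤ linearOracle p s θ :=
    Finset.sum_le_sum_of_subset_of_nonneg (Finset.Ioc_subset_Ioc_right hm)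
      fun l _ _ => by positivity
  refine le_trans (le_of_eq ?_) (h1.trans h2)
  simp; ring

/-- Weights on the sizes `a, …, b` with prescribed cumulative weights. -/
def weightOfCum (a b : ℕ) (g : ℕ → ℝ) : Finset.Icc a b → ℝ :=
  fun m => g m - if (m : ℕ) < b then g (m + 1) else 0

lemma cumWeight_weightOfCum {a b : ℕ} (g : ℕ → ℝ) {l : ℕ} (hal : a ≤ l) (hlb : l ≤ b) :
    cumWeight (Finset.Icc a b) (weightOfCum a b g) l = g l := by
  have h := sum_telescope_cut g l b hlb
  rw [← h, cumWeight]
  have e1 : ∑ m : Finset.Icc a b, (if l ≤ (m : ℕ) then weightOfCum a b g m else 0)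
      = ∑ m ∈ Finset.Icc a b, (if l ≤ m then (g m - if m < b then g (m + 1) else 0) else 0) :=
    Finset.sum_coe_sort (Finset.Icc a b)
      (fun m => if l ≤ m then (g m - if m < b then g (m + 1) else 0) else 0)
  rw [e1]
  refine Finset.sum_subset ?_ fun m hm hm' => ?_
  · intro m hm
    simp only [Finset.mem_Icc, Finset.mem_range] at hm ⊢; omega
  · simp only [Finset.mem_Icc, Finset.mem_range] at hm hm'
    rw [if_neg (by omega)]

lemma weightOfCum_mem {a b : ℕ} (hab : a ≤ b) {g : ℕ → ℝ} (hg : AntitoneOn g (Set.Icc a b))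
    (hg0 : ∀ l, 0 ≤ g l) (hga : g a = 1) :
    weightOfCum a b g ∈ stdSimplex ℝ (Finset.Icc a b) := by
  constructor
  · intro m
    have hm := Finset.mem_Icc.1 m.2
    unfold weightOfCum
    split_ifs with h
    · have := hg (Set.mem_Icc.2 hm) (Set.mem_Icc.2 ⟨by omega, by omega⟩) (Nat.le_succ m)
      simp only [Nat.succ_eq_add_one] at this
      linarith
    · linarith [hg0 m]
  · have := cumWeight_weightOfCum g le_rfl hab
    rw [hga] at this
    rw [← this, cumWeight]
    refine Finset.sum_congr rfl fun m _ => ?_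
    rw [if_pos (Finset.mem_Icc.1 m.2).1]

/-- Restricting to the sizes `a, …, b` costs at most `a s` plus the tail energy, which is a small
multiple of the oracle risk when the coefficients beyond `b` are small. -/
theorem exists_weight_seqRisk_le (hs : 0 < s) {a b : ℕ} (ha : 1 ≤ a) (hab : a ≤ b) (hb : b ≤ p)
    (hanti : ∀ i ∈ Finset.Icc 1 p, ∀ j ∈ Finset.Icc 1 p, i ≤ j → |θ j| ≤ |θ i|) {ρ : ℝ}
    (htail : ∀ l ∈ Finset.Ioc b p, θ l ^ 2 ≤ ρ * s) (hρ : 0 ≤ ρ) :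
    ∃ w ∈ stdSimplex ℝ (Finset.Icc a b),
      seqRisk p s θ (cumWeight (Finset.Icc a b) w) ≤ a * s + (1 + ρ) * linearOracle p s θ := by
  -- The unconstrained minimizer, overwritten by the forced value `1` up to `a`; ordered
  -- coefficients make it antitone, hence realizable by simplex weights.
  set g : ℕ → ℝ := fun l => if l ≤ a then 1 else θ l ^ 2 / (θ l ^ 2 + s) with hg
  have hsq : ∀ i j, a ≤ i → i ≤ j → j ≤ b → θ j ^ 2 ≤ θ i ^ 2 := by
    intro i j hi hij hj
    have := hanti i (Finset.mem_Icc.2 ⟨by omega, by omega⟩) j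
      (Finset.mem_Icc.2 ⟨by omega, by omega⟩) hij
    rw [← sq_abs (θ j), ← sq_abs (θ i)]
    exact pow_le_pow_left₀ (abs_nonneg _) this 2
  have hg1 : ∀ l, θ l ^ 2 / (θ l ^ 2 + s) ≤ 1 := fun l =>
    div_le_one_of_le₀ (by linarith) (by positivity)
  have hgm : AntitoneOn g (Set.Icc a b) := by
    intro i hi j hj hij
    rw [Set.mem_Icc] at hi hj
    simp only [hg]
    split_ifs with h1 h2
    · exact le_rfl
    · omega
    · exact hg1 j
    · have h := hsq i j hi.1 hij hj.2
      rw [div_le_div_iff₀ (by positivity) (by positivity)]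
      nlinarith
  have hg0 : ∀ l, 0 ≤ g l := by
    intro l; simp only [hg]; split_ifs
    · norm_num
    · positivity
  have hmem := weightOfCum_mem hab hgm hg0 (by simp [hg])
  refine ⟨_, hmem, ?_⟩
  have hw := cumWeight_isWeightSeq hmem
  set c := cumWeight (Finset.Icc a b) (weightOfCum a b g) with hc
  set o : ℕ → ℝ := fun l => θ l ^ 2 * s / (θ l ^ 2 + s) with ho
  have ho0 : ∀ l, 0 ≤ o l := fun l => by simp only [ho]; positivity
  rw [seqRisk, Finset.mul_sum, ← Finset.sum_add_distrib, sum_Ioc_three hab hb]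
  have s1 : ∑ l ∈ Finset.Ioc 0 a, ((1 - c l) ^ 2 * θ l ^ 2 + s * c l ^ 2) ≤ a * s := by
    rw [Finset.sum_congr rfl fun l hl => by rw [hw.one l (Finset.mem_Ioc.1 hl).2]]
    simp
  have s2 : ∑ l ∈ Finset.Ioc a b, ((1 - c l) ^ 2 * θ l ^ 2 + s * c l ^ 2)
      ≤ ∑ l ∈ Finset.Ioc a b, o l := by
    refine Finset.sum_le_sum fun l hl => ?_
    rw [Finset.mem_Ioc] at hl
    rw [hc, cumWeight_weightOfCum g hl.1.le hl.2]
    simp only [hg, show ¬ l ≤ a by omega, if_false, ho]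
    have : 0 < θ l ^ 2 + s := by positivity
    refine le_of_eq ?_
    field_simp
    ring
  -- Here `g = 0` and the cost is `θ²`, which is at most `1 + ρ` times the oracle term since `θ² + s
  -- ≤ (1 + ρ) s`.
  have s3 : ∑ l ∈ Finset.Ioc b p, ((1 - c l) ^ 2 * θ l ^ 2 + s * c l ^ 2)
      ≤ (1 + ρ) * ∑ l ∈ Finset.Ioc b p, o l := by
    rw [Finset.mul_sum]
    refine Finset.sum_le_sum fun l hl => ?_
    rw [hw.zero l (Finset.mem_Ioc.1 hl).1]
    have h1 := htail l hl
    have : 0 < θ l ^ 2 + s := by positivity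
    simp only [ho]
    rw [mul_div_assoc', le_div_iff₀ this]
    nlinarith [mul_le_mul_of_nonneg_left h1 (sq_nonneg (θ l))]
  have s4 : ∑ l ∈ Finset.Ioc a b, o l + ∑ l ∈ Finset.Ioc b p, o l ≤ linearOracle p s θ := by
    rw [linearOracle, sum_Ioc_three hab hb]
    linarith [Finset.sum_nonneg fun l (_ : l ∈ Finset.Ioc 0 a) => ho0 l]
  have s5 : 0 ≤ ∑ l ∈ Finset.Ioc a b, o l := Finset.sum_nonneg fun l _ => ho0 l
  nlinarith

end Window

/-! ### Passage to the limit. -/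

section Asymptotics

lemma leOnePlusLittleO_of_forall {a b : ℕ → ℝ} (hb : ∀ᶠ n in atTop, 0 < b n)
    (h : ∀ η : ℝ, 0 < η → η ≤ 1 → ∀ᶠ n in atTop, a n ≤ (1 + η) * b n) :
    LeOnePlusLittleO a b := by
  refine ⟨fun n => max 0 (a n / b n - 1), ?_, ?_⟩
  · rw [Metric.tendsto_nhds]
    intro ε hε
    have hη : 0 < min (ε / 2) 1 := lt_min (by linarith) one_pos
    filter_upwards [hb, h _ hη (min_le_right _ _)] with n hn han
    rw [Real.dist_eq, sub_zero, abs_of_nonneg (le_max_left _ _)]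
    refine max_lt hε ?_
    have : a n / b n ≤ 1 + min (ε / 2) 1 := by rwa [div_le_iff₀ hn]
    have := min_le_left (ε / 2) 1
    linarith
  · filter_upwards [hb] with n hn
    have h1 : a n = (1 + (a n / b n - 1)) * b n := by field_simp; ring
    have h2 : (1 + (a n / b n - 1)) * b n ≤ (1 + max 0 (a n / b n - 1)) * b n :=
      mul_le_mul_of_nonneg_right (by linarith [le_max_right 0 (a n / b n - 1)]) hn.le
    linarith

lemma integrable_comp_nat {Ω : Type*} [MeasurableSpace Ω] {μ : Measure Ω} [IsProbabilityMeasure μ]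
    {m : Ω → ℕ} (hm : Measurable m) {p : ℕ} (hp : ∀ ω, m ω ∈ Finset.Icc 1 p) (F : ℕ → ℝ) :
    Integrable (fun ω => F (m ω)) μ := by
  refine Integrable.of_bound (C := ∑ k ∈ Finset.Icc 1 p, |F k|)
    ((measurable_from_top (f := F)).comp hm).aestronglyMeasurable (ae_of_all _ fun ω => ?_)
  exact Finset.single_le_sum (f := fun k => |F k|) (fun _ _ => abs_nonneg _) (hp ω)

lemma msSet_bounds {p m : ℕ} {κl κu : ℝ} (hl : 1 < κl) (hu : 1 < κu) (hm : m ∈ Finset.Icc 1 p) :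
    1 ≤ max 1 ⌊κl⁻¹ * (m : ℝ)⌋₊ ∧ max 1 ⌊κl⁻¹ * (m : ℝ)⌋₊ ≤ min p ⌊κu * (m : ℝ)⌋₊ ∧
      min p ⌊κu * (m : ℝ)⌋₊ ≤ p := by
  rw [Finset.mem_Icc] at hm
  have hm0 : (0 : ℝ) ≤ m := Nat.cast_nonneg m
  have h1 : ⌊κl⁻¹ * (m : ℝ)⌋₊ ≤ m := by
    have : κl⁻¹ * (m : ℝ) ≤ m := mul_le_of_le_one_left hm0 (inv_le_one_of_one_le₀ hl.le)
    exact Nat.floor_le_of_le this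
  have h2 : m ≤ ⌊κu * (m : ℝ)⌋₊ := Nat.le_floor (le_mul_of_one_le_left hm0 hu.le)
  refine ⟨le_max_left _ _, max_le ?_ ?_, min_le_left _ _⟩
  · exact le_min (by omega) (by omega)
  · exact le_min (by omega) (by omega)

/-- On a window of sizes around the best nested model, some weight is nearly as good as `r`. -/
lemma exists_window_weight {p n mstar m : ℕ} {θ : ℕ → ℝ} {s σ r κl κu κ₀ c₁ c₂ C ρ : ℝ}
    (hp_le : p ≤ n) (hs : 0 < s) (hsn : s * n = σ ^ 2) (hκl : 1 < κl) (hκu : 1 < κu)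
    (hc₁ : 0 < c₁) (hc₂ : 1 < c₂) (hρ : 0 < ρ) (hrn : 0 < r) (hm : m ∈ Finset.Icc 1 p)
    (hr : linearOracle p s θ ≤ r) (hlow : mstar * s ≤ 2 * r)
    (hCn : ∑ l ∈ Finset.Ioc 0 p, θ l ^ 2 ≤ C)
    (h_pos : ∀ j ∈ Finset.Icc 1 p, 0 < |θ j|)
    (h_anti : ∀ i ∈ Finset.Icc 1 p, ∀ j ∈ Finset.Icc 1 p, i ≤ j → |θ j| ≤ |θ i|)
    (hκ₀ : ∀ l : ℕ, 1 ≤ l → ⌊κ₀ * (l : ℝ)⌋₊ ≤ p → |θ ⌊κ₀ * (l : ℝ)⌋₊ / θ l| ≤ Real.sqrt ρ)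
    (hκ₁ : 1 ≤ κ₀) (hm_up : mstar + 1 ≤ p → θ (mstar + 1) ^ 2 ≤ s)
    (hm1 : 2 / c₁ ≤ mstar) (hm2 : 1 / ρ ≤ mstar) (hm3 : (1 : ℝ) ≤ mstar)
    (hκln : 1 / ρ ≤ κl) (hκun : 4 * κ₀ / c₁ ≤ κu) :
    ∃ w ∈ stdSimplex ℝ (msSet p κl κu m),
      seqRisk p s θ (cumWeight _ w) ≤ (1 + (4 + 2 * c₂) * ρ) * r + (|C| + σ ^ 2) *
        Set.indicator {m | ¬ (⌊c₁ * (mstar : ℝ)⌋₊ ≤ m ∧ m ≤ ⌊c₂ * (mstar : ℝ)⌋₊)} 1 m := by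
  have hm0 : (0 : ℝ) < mstar := by linarith
  set Bad : Set ℕ := {m | ¬ (⌊c₁ * (mstar : ℝ)⌋₊ ≤ m ∧ m ≤ ⌊c₂ * (mstar : ℝ)⌋₊)} with hBad
  obtain ⟨ha, hab, hb⟩ := msSet_bounds hκl hκu hm
  have hm' := Finset.mem_Icc.1 hm
  by_cases hbadm : m ∈ Bad
  · rw [Set.indicator_of_mem hbadm]
    -- On the failure event any weights will do: bias at most `C`, variance at most `s p ≤ σ²`. A
    -- point mass on the smallest size is used.
    have hne : (max 1 ⌊(κl)⁻¹ * (m : ℝ)⌋₊) ∈ msSet (p) (κl) (κu) m :=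
      Finset.mem_Icc.2 ⟨le_rfl, hab⟩
    have hw := single_mem_stdSimplex ℝ (⟨_, hne⟩ : msSet (p) (κl) (κu) m)
    refine ⟨_, hw, ?_⟩
    set w : msSet (p) (κl) (κu) m → ℝ :=
      Pi.single (⟨_, hne⟩ : msSet (p) (κl) (κu) m) 1
    have hc0 := fun l => cumWeight_nonneg hw.1 l
    have hc1 := fun l => cumWeight_le_one hw l
    have e1 : ∑ l ∈ Finset.Ioc 0 (p), (1 - cumWeight _ w l) ^ 2 * θ l ^ 2 ≤ |C| := by
      refine le_trans (Finset.sum_le_sum fun l _ => ?_) (hCn.trans (le_abs_self C))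
      refine mul_le_of_le_one_left (sq_nonneg _) ?_
      nlinarith [hc0 l, hc1 l]
    have e2 : s * ∑ l ∈ Finset.Ioc 0 (p), cumWeight _ w l ^ 2 ≤ σ ^ 2 := by
      have : ∑ l ∈ Finset.Ioc 0 (p), cumWeight _ w l ^ 2 ≤ n := by
        have h1 : ∑ l ∈ Finset.Ioc 0 (p), cumWeight _ w l ^ 2
            ≤ ∑ l ∈ Finset.Ioc 0 (p), (1 : ℝ) :=
          Finset.sum_le_sum fun l _ => by nlinarith [hc0 l, hc1 l]
        refine h1.trans ?_
        simpa using hp_le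
      calc s * ∑ l ∈ Finset.Ioc 0 (p), cumWeight _ w l ^ 2 ≤ s * n :=
            mul_le_mul_of_nonneg_left this hs.le
        _ = σ ^ 2 := hsn
    have e3 : 0 ≤ (1 + (4 + 2 * c₂) * ρ) * r := by positivity
    simp only [Pi.one_apply, mul_one]
    rw [seqRisk]
    linarith
  · rw [Set.indicator_of_notMem hbadm, mul_zero, add_zero]
    have hgood : ⌊c₁ * (mstar : ℝ)⌋₊ ≤ m ∧ m ≤ ⌊c₂ * (mstar : ℝ)⌋₊ := by
      by_contra h; exact hbadm h
    have hmup : (m : ℝ) ≤ c₂ * mstar :=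
      (Nat.le_floor_iff (by positivity)).1 hgood.2
    have hmlow : c₁ * mstar / 2 ≤ m := by
      have h1 := Nat.lt_floor_add_one (c₁ * (mstar : ℝ))
      have h2 : ((⌊c₁ * (mstar : ℝ)⌋₊ : ℕ) : ℝ) ≤ m := by exact_mod_cast hgood.1
      rw [div_le_iff₀ hc₁] at hm1
      linarith
    -- The window reaches beyond `κ₀ (m* + 1)`. There `θ²` has dropped by a factor `ρ` from
    -- `θ_{m*+1}²`, which is at most `s`.
    have htail : ∀ l ∈ Finset.Ioc (min (p) ⌊κu * (m : ℝ)⌋₊) (p), θ l ^ 2 ≤ ρ * s := by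
      intro l hl
      rw [Finset.mem_Ioc] at hl
      have hlt : ⌊κu * (m : ℝ)⌋₊ < l := by
        rcases min_lt_iff.1 hl.1 with h | h
        · omega
        · exact h
      have hlt' : κu * m < l := (Nat.floor_lt (by have := hκu; positivity)).1 hlt
      set q := ⌊κ₀ * ((mstar + 1 : ℕ) : ℝ)⌋₊ with hq
      have hkey : κ₀ * ((mstar + 1 : ℕ) : ℝ) ≤ κu * m := by
        push_cast
        have h1 : κ₀ * ((mstar : ℝ) + 1) ≤ κ₀ * (2 * mstar) :=
          mul_le_mul_of_nonneg_left (by linarith) (by linarith)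
        have h2 : (4 * κ₀ / c₁) * (c₁ * mstar / 2) ≤ κu * m :=
          mul_le_mul hκun hmlow (by positivity) (by linarith [hκu])
        have h3 : (4 * κ₀ / c₁) * (c₁ * mstar / 2) = κ₀ * (2 * mstar) := by
          field_simp; ring
        linarith
      have hql : q ≤ l := by
        have := Nat.floor_le_of_le (hkey.trans hlt'.le)
        exact this
      have hqm : mstar + 1 ≤ q := by
        refine Nat.le_floor ?_
        exact le_mul_of_one_le_left (Nat.cast_nonneg _) hκ₁
      have hd := hκ₀ (mstar + 1) (by omega) (by rw [← hq]; omega)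
      rw [← hq, abs_div] at hd
      have hpos := h_pos (mstar + 1) (Finset.mem_Icc.2 ⟨by omega, by omega⟩)
      rw [div_le_iff₀ hpos] at hd
      have h1 := h_anti q (Finset.mem_Icc.2 ⟨by omega, by omega⟩) l
        (Finset.mem_Icc.2 ⟨by omega, by omega⟩) hql
      have h2 := pow_le_pow_left₀ (abs_nonneg _) (h1.trans hd) 2
      rw [mul_pow, sq_abs, sq_abs, Real.sq_sqrt hρ.le] at h2
      exact h2.trans (mul_le_mul_of_nonneg_left (hm_up (by omega)) hρ.le)
    obtain ⟨w, hw, hwr⟩ := exists_weight_seqRisk_le hs ha hab hb h_anti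
      htail hρ.le
    refine ⟨w, hw, hwr.trans ?_⟩
    have h1 : ((max 1 ⌊(κl)⁻¹ * (m : ℝ)⌋₊ : ℕ) : ℝ) ≤ 1 + c₂ * ρ * mstar := by
      have h2 : ((⌊(κl)⁻¹ * (m : ℝ)⌋₊ : ℕ) : ℝ) ≤ c₂ * ρ * mstar := by
        have hκ0 : 0 < κl := by linarith [hκl]
        refine (Nat.floor_le (by positivity)).trans ?_
        have h3 : (κl)⁻¹ ≤ ρ := by
          rw [inv_le_comm₀ hκ0 hρ]
          simpa using hκln
        calc (κl)⁻¹ * (m : ℝ) ≤ ρ * (c₂ * mstar) :=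
              mul_le_mul h3 hmup (Nat.cast_nonneg _) hρ.le
          _ = _ := by ring
      rw [Nat.cast_max]
      refine max_le ?_ ?_
      · have : 0 ≤ c₂ * ρ * mstar := by positivity
        simp only [Nat.cast_one]; linarith
      · linarith
    -- Absorbs the `1` of the `max`, so that the forced cost `a s` is of order `ρ m* s`.
    have h2 : (1 : ℝ) ≤ ρ * mstar := by
      rw [div_le_iff₀ hρ] at hm2; linarith
    have h3 : ((max 1 ⌊(κl)⁻¹ * (m : ℝ)⌋₊ : ℕ) : ℝ) * s
        ≤ ((1 + c₂) * ρ) * (mstar * s) := by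
      have : ((max 1 ⌊(κl)⁻¹ * (m : ℝ)⌋₊ : ℕ) : ℝ) ≤ (1 + c₂) * ρ * mstar := by linarith
      calc _ ≤ ((1 + c₂) * ρ * mstar) * s := mul_le_mul_of_nonneg_right this hs.le
        _ = _ := by ring
    have h4 : ((1 + c₂) * ρ) * (mstar * s) ≤ ((1 + c₂) * ρ) * (2 * r) :=
      mul_le_mul_of_nonneg_left hlow (by positivity)
    have h5 : (1 + ρ) * linearOracle (p) s (θ) ≤ (1 + ρ) * r :=
      mul_le_mul_of_nonneg_left hr (by positivity)
    have h6 : 0 ≤ ρ * r := by positivity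
    linarith

/-- Every error is brought to the form constant times `ρ r`. Failure probability and `ψ` use `m* s ≤
2 r`, with `m* / n = m* s / σ²`; the variance term is compared with `n r` directly. `A` collects
what is multiplied by `1 + η / 4`, and `B / η` the rest. -/
lemma remainder_le {p n mstar : ℕ} {η ρ D σ C c₂ r P Ψ V s : ℝ} (hσ : 0 < σ) (hη : 0 < η)
    (hη1 : η ≤ 1) (hρ : 0 < ρ) (hD : 0 ≤ D) (hn0 : (0 : ℝ) < n) (hm0 : (0 : ℝ) < mstar)
    (hs_def : s = σ ^ 2 / n) (hs : 0 < s) (hrn : 0 < r) (hlow : mstar * s ≤ 2 * r) {A B : ℝ}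
    (hA : A = 4 + 2 * c₂ + 2 * (|C| + σ ^ 2) / σ ^ 2) (hA0 : 0 < A)
    (hB : B = 56 * (2 * D + 16 / σ ^ 2)) (hρA : 2 * (A * ρ) ≤ η / 2) (hρB : B * ρ / η ≤ η / 4)
    (hbad : ‖P‖ ≤ ρ * ‖(mstar : ℝ) / n‖) (hψ : ‖Ψ‖ ≤ ρ * ‖(mstar : ℝ)‖)
    (hvar : ‖p * V‖ ≤ ρ * ‖n * r‖) :
    (1 + η / 4) * ((1 + (4 + 2 * c₂) * ρ) * r) + 56 / η * (16 * (p / s) * (V / n ^ 2))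
      + ((1 + η / 4) * (|C| + σ ^ 2)) * P + (56 / η * (D * s)) * Ψ ≤ (1 + η) * r := by
  have hσ2 : 0 < σ ^ 2 := by positivity
  have hm_n : mstar / n = mstar * s / σ ^ 2 := by
    rw [hs_def]; field_simp
  have hP1 : P ≤ 2 * ρ / σ ^ 2 * r := by
    have h1 : P ≤ ρ * (mstar * s / σ ^ 2) := by
      have := (le_abs_self P).trans hbad
      rw [hm_n, Real.norm_of_nonneg (by positivity)] at this
      exact this
    refine h1.trans ?_
    have : mstar * s / σ ^ 2 ≤ 2 * r / σ ^ 2 := div_le_div_of_nonneg_right hlow hσ2.le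
    refine (mul_le_mul_of_nonneg_left this hρ.le).trans (le_of_eq (by ring))
  have hΨ1 : s * Ψ ≤ 2 * ρ * r := by
    have h1 : Ψ ≤ ρ * mstar := by
      have := (le_abs_self Ψ).trans hψ
      rwa [Real.norm_of_nonneg hm0.le] at this
    have h2 := mul_le_mul_of_nonneg_left h1 hs.le
    have h3 := mul_le_mul_of_nonneg_left hlow hρ.le
    linarith
  have hV1 : 16 * (p / s) * (V / n ^ 2) ≤ 16 / σ ^ 2 * ρ * r := by
    have h1 : p * V ≤ ρ * (n * r) := by
      have := (le_abs_self _).trans hvar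
      rwa [Real.norm_of_nonneg (by positivity)] at this
    have h2 : 16 * (p / s) * (V / n ^ 2) = 16 / σ ^ 2 * ((p * V) / n) := by
      rw [hs_def]; field_simp
    rw [h2, mul_assoc]
    refine mul_le_mul_of_nonneg_left ?_ (by positivity)
    rw [div_le_iff₀ hn0]; linarith
  have t1 : ((1 + η / 4) * (|C| + σ ^ 2)) * P
      ≤ (1 + η / 4) * (2 * (|C| + σ ^ 2) / σ ^ 2 * ρ * r) := by
    rw [mul_assoc]
    refine mul_le_mul_of_nonneg_left ?_ (by positivity)
    refine (mul_le_mul_of_nonneg_left hP1 (by positivity)).trans (le_of_eq (by ring))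
  have t2 : (56 / η * (D * s)) * Ψ ≤ 56 / η * (2 * D * ρ * r) := by
    rw [mul_assoc]
    refine mul_le_mul_of_nonneg_left ?_ (by positivity)
    have := mul_le_mul_of_nonneg_left hΨ1 hD
    linarith
  have t3 : 56 / η * (16 * (p / s) * (V / n ^ 2)) ≤ 56 / η * (16 / σ ^ 2 * ρ * r) :=
    mul_le_mul_of_nonneg_left hV1 (by positivity)
  have t4 : 56 / η * (2 * D * ρ * r) + 56 / η * (16 / σ ^ 2 * ρ * r) = (B * ρ / η) * r := by
    rw [hB]; ring
  have t5 : (1 + η / 4) * ((1 + (4 + 2 * c₂) * ρ) * r)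
      + (1 + η / 4) * (2 * (|C| + σ ^ 2) / σ ^ 2 * ρ * r) = (1 + η / 4) * (1 + A * ρ) * r := by
    rw [hA]; ring
  have t6 : (1 + η / 4) * (1 + A * ρ) ≤ 1 + η / 4 + 2 * (A * ρ) := by
    have : 0 ≤ A * ρ := by positivity
    nlinarith
  have t7 : ((1 + η / 4) * (1 + A * ρ) + B * ρ / η) * r ≤ (1 + η) * r :=
    mul_le_mul_of_nonneg_right (by linarith) hrn.le
  linarith

/-- Stated for an abstract `F n m` with the oracle bound at each deterministic size `m`, so that one
argument covers expected loss and expected risk. -/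
theorem asymptotic_optimality {Ω : ℕ → Type*} [∀ n, MeasurableSpace (Ω n)]
    (μ : ∀ n, Measure (Ω n)) [∀ n, IsProbabilityMeasure (μ n)]
    {p : ℕ → ℕ} (hp_le : ∀ n, p n ≤ n) {σ : ℝ} (hσ : 0 < σ) {θ : ℕ → ℕ → ℝ}
    (h_bdd : ∃ C : ℝ, ∀ᶠ n in atTop, ∑ l ∈ Finset.Ioc 0 (p n), θ n l ^ 2 ≤ C)
    (h_pos : ∀ n, ∀ j ∈ Finset.Icc 1 (p n), 0 < |θ n j|)
    (h_anti : ∀ n, ∀ i ∈ Finset.Icc 1 (p n), ∀ j ∈ Finset.Icc 1 (p n), i ≤ j →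
      |θ n j| ≤ |θ n i|)
    (h_decay : ∀ e : ℝ, 0 < e → ∀ᶠ κ : ℝ in atTop, ∀ n l : ℕ, 1 ≤ l → ⌊κ * (l : ℝ)⌋₊ ≤ p n →
      |θ n ⌊κ * (l : ℝ)⌋₊ / θ n l| ≤ e)
    {r V : ℕ → ℝ} (hr : ∀ n, 1 ≤ n → linearOracle (p n) (σ ^ 2 / n) (θ n) ≤ r n)
    (h_var : (fun n => (p n : ℝ) * V n) =o[atTop] (fun n => (n : ℝ) * r n))
    {mstar : ℕ → ℕ} (hm_mem : ∀ n, 1 ≤ n → mstar n ∈ Finset.Icc 1 (p n))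
    (hm_low : ∀ n, 1 ≤ n → 2 ≤ mstar n → σ ^ 2 / n ≤ θ n (mstar n) ^ 2)
    (hm_up : ∀ n, 1 ≤ n → mstar n + 1 ≤ p n → θ n (mstar n + 1) ^ 2 ≤ σ ^ 2 / n)
    {mhat : ∀ n, Ω n → ℕ} (hmhat_meas : ∀ n, Measurable (mhat n))
    (hmhat_mem : ∀ n, 1 ≤ n → ∀ ω, mhat n ω ∈ Finset.Icc 1 (p n))
    {κl κu : ℕ → ℝ} (hκl : ∀ n, 1 < κl n) (hκu : ∀ n, 1 < κu n)
    (hκl_lim : Tendsto κl atTop atTop) (hκu_lim : Tendsto κu atTop atTop)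
    (h_psi : (fun n => ∫ ω, psi (θ n) (msSet (p n) (κl n) (κu n) (mhat n ω)) ∂(μ n)) =o[atTop]
      (fun n => (mstar n : ℝ)))
    {c₁ c₂ : ℝ} (hc₁ : 0 < c₁) (hc₂ : 1 < c₂)
    (h_F : (fun n => (μ n).real
        {ω | ¬ (⌊c₁ * (mstar n : ℝ)⌋₊ ≤ mhat n ω ∧ mhat n ω ≤ ⌊c₂ * (mstar n : ℝ)⌋₊)}) =o[atTop]
      (fun n => (mstar n : ℝ) / n))
    {D : ℝ} (hD : 0 ≤ D) {F : ℕ → ℕ → ℝ}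
    (hF : ∀ n, 1 ≤ n → ∀ m ∈ Finset.Icc 1 (p n),
      ∀ w ∈ stdSimplex ℝ (msSet (p n) (κl n) (κu n) m), ∀ δ : ℝ, 0 < δ → δ ≤ 1 / 2 →
      F n m ≤ (1 + 7 * δ) * seqRisk (p n) (σ ^ 2 / n) (θ n) (cumWeight _ w)
        + 2 / δ * (D * (σ ^ 2 / n) * psi (θ n) (msSet (p n) (κl n) (κu n) m)
          + 16 * ((p n : ℝ) / (σ ^ 2 / n)) * (V n / n ^ 2))) :
    LeOnePlusLittleO (fun n => ∫ ω, F n (mhat n ω) ∂(μ n)) r := by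
  have hσ2 : 0 < σ ^ 2 := by positivity
  have hpsi1 : ∀ n, 1 ≤ n → ∀ m ∈ Finset.Icc 1 (p n),
      1 ≤ psi (θ n) (msSet (p n) (κl n) (κu n) m) := by
    intro n hn m hm
    obtain ⟨-, h2, h3⟩ := msSet_bounds (hκl n) (hκu n) hm
    exact one_le_psi (h_pos n) h2 h3
  -- the size of the best nested model diverges
  have hm_lim : ∀ A : ℝ, ∀ᶠ n in atTop, A ≤ mstar n := by
    -- `ψ ≥ 1` pointwise, so `𝔼 ψ = o(m*)` by itself forces `m* → ∞`.
    intro A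
    have hA : 0 < |A| + 1 := by positivity
    filter_upwards [h_psi.bound (inv_pos.2 hA), eventually_ge_atTop 1] with n hn hn1
    rw [Real.norm_of_nonneg (Nat.cast_nonneg (mstar n))] at hn
    have h1 : 1 ≤ ∫ ω, psi (θ n) (msSet (p n) (κl n) (κu n) (mhat n ω)) ∂(μ n) := by
      have h2 := integral_mono (μ := μ n) (integrable_const (1 : ℝ))
        (integrable_comp_nat (hmhat_meas n) (hmhat_mem n hn1)
          (fun m => psi (θ n) (msSet (p n) (κl n) (κu n) m)))
        (fun ω => hpsi1 n hn1 _ (hmhat_mem n hn1 ω))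
      simpa using h2
    have h2 := h1.trans ((le_abs_self _).trans hn)
    rw [inv_mul_eq_div, le_div_iff₀ hA] at h2
    linarith [le_abs_self A]
  -- lower bound for the optimal risk
  have hr_low : ∀ᶠ n in atTop, (mstar n : ℝ) * (σ ^ 2 / n) ≤ 2 * r n := by
    filter_upwards [hm_lim 2, eventually_ge_atTop 1] with n hm hn
    have hm2 : 2 ≤ mstar n := by exact_mod_cast hm
    have hmem := Finset.mem_Icc.1 (hm_mem n hn)
    have hn0 : (0 : ℝ) < n := by exact_mod_cast hn
    -- All coefficients up to `m*` have `θ² ≥ s`, and each such coordinate contributes at least `s /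
    -- 2` to the oracle risk.
    have := half_mul_le_linearOracle (p := p n) (θ := θ n) (show 0 < σ ^ 2 / (n : ℝ) by positivity)
      hmem.2 (fun l hl => by
        rw [Finset.mem_Ioc] at hl
        refine (hm_low n hn hm2).trans ?_
        rw [← sq_abs (θ n (mstar n)), ← sq_abs (θ n l)]
        exact pow_le_pow_left₀ (abs_nonneg _) (h_anti n l (Finset.mem_Icc.2 ⟨by omega, by omega⟩)
          _ (hm_mem n hn) hl.2) 2)
    linarith [hr n hn]
  have hr_pos : ∀ᶠ n in atTop, 0 < r n := by
    filter_upwards [hr_low, hm_lim 1, eventually_ge_atTop 1] with n h1 h2 hn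
    have hn0 : (0 : ℝ) < n := by exact_mod_cast hn
    have : 0 < (mstar n : ℝ) * (σ ^ 2 / n) := by positivity
    linarith
  refine leOnePlusLittleO_of_forall hr_pos fun η hη hη1 => ?_
  obtain ⟨C, hC⟩ := h_bdd
  set A : ℝ := 4 + 2 * c₂ + 2 * (|C| + σ ^ 2) / σ ^ 2 with hA
  set B : ℝ := 56 * (2 * D + 16 / σ ^ 2) with hB
  have hA0 : 0 < A := by positivity
  have hB0 : 0 < B := by positivity
  -- The square in `η²` compensates the division by `η` in the term `B ρ / η`.
  set ρ : ℝ := η ^ 2 / (4 * (A + B)) with hρdef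
  have hρ : 0 < ρ := by positivity
  have hρA : 2 * (A * ρ) ≤ η / 2 := by
    have h1 : A * ρ ≤ η ^ 2 / 4 := by
      rw [hρdef, mul_div_assoc', div_le_div_iff₀ (by positivity) (by norm_num)]
      nlinarith [mul_pos hB0 (pow_pos hη 2)]
    nlinarith
  have hρB : B * ρ / η ≤ η / 4 := by
    rw [div_le_iff₀ hη]
    have h1 : B * ρ ≤ η ^ 2 / 4 := by
      rw [hρdef, mul_div_assoc', div_le_div_iff₀ (by positivity) (by norm_num)]
      nlinarith [mul_pos hA0 (pow_pos hη 2)]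
    linarith [sq η]
  obtain ⟨κ₀, hκ₀, hκ₁⟩ := ((h_decay (Real.sqrt ρ) (Real.sqrt_pos.2 hρ)).and
    (eventually_ge_atTop 1)).exists
  filter_upwards [hr_low, hr_pos, hC, hm_lim (2 / c₁), hm_lim (1 / ρ), hm_lim 1,
    eventually_ge_atTop 1, hκl_lim.eventually_ge_atTop (1 / ρ),
    hκu_lim.eventually_ge_atTop (4 * κ₀ / c₁), h_psi.bound hρ, h_F.bound hρ, h_var.bound hρ]
    with n hlow hrn hCn hm1 hm2 hm3 hn hκln hκun hψ hbad hvar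
  have hn0 : (0 : ℝ) < n := by exact_mod_cast hn
  have hm0 : (0 : ℝ) < mstar n := by linarith
  set s : ℝ := σ ^ 2 / n with hs_def
  have hs : 0 < s := by positivity
  have hsn : s * n = σ ^ 2 := by rw [hs_def]; field_simp
  set Bad : Set ℕ := {m | ¬ (⌊c₁ * (mstar n : ℝ)⌋₊ ≤ m ∧ m ≤ ⌊c₂ * (mstar n : ℝ)⌋₊)} with hBad
  -- a good comparison weight for every selected size
  have hcomp : ∀ m ∈ Finset.Icc 1 (p n), ∃ w ∈ stdSimplex ℝ (msSet (p n) (κl n) (κu n) m),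
      seqRisk (p n) s (θ n) (cumWeight _ w)
        ≤ (1 + (4 + 2 * c₂) * ρ) * r n + (|C| + σ ^ 2) * Bad.indicator 1 m := by
    intro m hm
    exact exists_window_weight (hp_le n) hs hsn (hκl n) (hκu n) hc₁ hc₂ hρ hrn hm (hr n hn) hlow hCn
      (h_pos n) (h_anti n) (hκ₀ n) hκ₁ (hm_up n hn) hm1 hm2 hm3 hκln hκun
  -- integration over the selected size
  have hδ : 0 < η / 28 := by positivity
  have hδ' : η / 28 ≤ 1 / 2 := by linarith
  set P := (μ n).real {ω | ¬ (⌊c₁ * (mstar n : ℝ)⌋₊ ≤ mhat n ω ∧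
    mhat n ω ≤ ⌊c₂ * (mstar n : ℝ)⌋₊)} with hP
  set Ψ := ∫ ω, psi (θ n) (msSet (p n) (κl n) (κu n) (mhat n ω)) ∂(μ n) with hΨ
  set c₀ : ℝ := (1 + η / 4) * ((1 + (4 + 2 * c₂) * ρ) * r n)
    + 56 / η * (16 * ((p n : ℝ) / s) * (V n / n ^ 2)) with hc₀
  set G : ℕ → ℝ := fun m => c₀ + ((1 + η / 4) * (|C| + σ ^ 2)) * Bad.indicator 1 m
    + (56 / η * (D * s)) * psi (θ n) (msSet (p n) (κl n) (κu n) m) with hG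
  have hFG : ∀ m ∈ Finset.Icc 1 (p n), F n m ≤ G m := by
    intro m hm
    obtain ⟨w, hw, hwr⟩ := hcomp m hm
    have h1 := hF n hn m hm w hw (η / 28) hδ hδ'
    -- The value `δ = η / 28` turns the leading factor into `1 + η / 4`.
    have h2 : 1 + 7 * (η / 28) = 1 + η / 4 := by ring
    have h3 : 2 / (η / 28) = 56 / η := by field_simp; ring
    rw [h2, h3, ← hs_def] at h1
    have h4 := mul_le_mul_of_nonneg_left hwr (show 0 ≤ 1 + η / 4 by positivity)
    simp only [hG, hc₀]
    linarith
  have hI := fun H => integrable_comp_nat (μ := μ n) (hmhat_meas n) (hmhat_mem n hn) H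
  have hint : ∫ ω, F n (mhat n ω) ∂(μ n) ≤ ∫ ω, G (mhat n ω) ∂(μ n) :=
    integral_mono (hI _) (hI _) fun ω => hFG _ (hmhat_mem n hn ω)
  have hGint : ∫ ω, G (mhat n ω) ∂(μ n) = c₀ + ((1 + η / 4) * (|C| + σ ^ 2)) * P
      + (56 / η * (D * s)) * Ψ := by
    have hind : ∫ ω, Bad.indicator (1 : ℕ → ℝ) (mhat n ω) ∂(μ n) = P := by
      have e1 : (fun ω => Bad.indicator (1 : ℕ → ℝ) (mhat n ω))
          = (mhat n ⁻¹' Bad).indicator 1 := by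
        ext ω; simp [Set.indicator]
      rw [e1, integral_indicator_one (hmhat_meas n (MeasurableSet.of_discrete))]
      rfl
    simp only [hG]
    have i1 := (hI (Bad.indicator 1)).const_mul ((1 + η / 4) * (|C| + σ ^ 2))
    have i2 := (hI fun m => psi (θ n) (msSet (p n) (κl n) (κu n) m)).const_mul (56 / η * (D * s))
    have i3 : Integrable (fun ω => c₀ + ((1 + η / 4) * (|C| + σ ^ 2))
        * Bad.indicator 1 (mhat n ω)) (μ n) := (integrable_const _).add i1
    rw [integral_add i3 i2, integral_add (integrable_const _) i1, integral_const_mul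
      ((1 + η / 4) * (|C| + σ ^ 2)), integral_const_mul (56 / η * (D * s)), hind]
    simp only [integral_const, probReal_univ, smul_eq_mul, one_mul]
    rfl
  refine hint.trans (hGint.le.trans ?_)
  exact remainder_le hσ hη hη1 hρ hD hn0 hm0 hs_def hs hrn hlow hA hA0 hB hρA hρB hbad hψ hvar

end Asymptotics

/-! ### Translation back to the regression model. -/

section RegressionModel

variable {Ω : Type*} [MeasurableSpace Ω] {μ : Measure Ω} [IsProbabilityMeasure μ]
  {n p : ℕ} {X : Matrix (Fin n) (Fin p) ℝ} {φ : ℕ → Fin n → ℝ} {f : Fin n → ℝ} {β : Fin p → ℝ}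
  {ε : Fin n → Ω → ℝ} {σ B : ℝ}

lemma isNoise_of_subgaussian {η : ℝ≥0} (hε_meas : ∀ i, Measurable (ε i)) (hε_indep : iIndepFun ε μ)
    (hε_mean : ∀ i, ∫ ω, ε i ω ∂μ = 0) (hε_var : ∀ i, ∫ ω, ε i ω ^ 2 ∂μ = σ ^ 2)
    (hε_sub : ∀ i, HasSubgaussianMGF (ε i) (η ^ 2) μ) :
    IsNoise ε μ σ (48 * Real.exp (((η ^ 2 : ℝ≥0) : ℝ) / 2)) where
  meas := hε_meas
  indep := hε_indep
  memLp i := (fourth_moment_le (hε_sub i)).1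
  mean := hε_mean
  var := hε_var
  fourth i := (fourth_moment_le (hε_sub i)).2

lemma loss_response (hX : LinearIndependent ℝ (fun j : Fin p => Xᵀ j)) (hφ : IsNestedBasis X φ)
    (hf : f = X *ᵥ β) {K : Finset ℕ} (hK : K ⊆ Finset.Icc 1 p) (w : K → ℝ) (ω : Ω) :
    loss (avgProj X K w *ᵥ response f ε ω) f
      = seqLoss p (theta φ f) (fun l => theta φ (fun i => ε i ω) l) (cumWeight K w) :=
  loss_avgProj hX hφ hf hK w (fun i => ε i ω)

lemma plugRisk_eq_seqRisk (hX : LinearIndependent ℝ (fun j : Fin p => Xᵀ j))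
    (hφ : IsNestedBasis X φ) (hf : f = X *ᵥ β) {K : Finset ℕ} (hK : K ⊆ Finset.Icc 1 p)
    (w : K → ℝ) : plugRisk σ X f K w = seqRisk p (σ ^ 2 / n) (theta φ f) (cumWeight K w) :=
  plugRisk_eq hX hφ hf hK w σ

lemma linearOracle_le_optRisk (hp : 1 ≤ p) (hn : 1 ≤ n)
    (hX : LinearIndependent ℝ (fun j : Fin p => Xᵀ j))
    (hφ : IsNestedBasis X φ) (hf : f = X *ᵥ β) (hσ : 0 < σ) (h : IsNoise ε μ σ B) :
    linearOracle p (σ ^ 2 / n) (theta φ f) ≤ optRisk μ X f ε (Finset.Icc 1 p) := by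
  have hn0 : (0 : ℝ) < n := by exact_mod_cast hn
  have hne : Nonempty (stdSimplex ℝ (Finset.Icc 1 p)) :=
    ⟨⟨_, single_mem_stdSimplex ℝ (⟨1, Finset.mem_Icc.2 ⟨le_rfl, hp⟩⟩ : Finset.Icc 1 p)⟩⟩
  refine le_ciInf fun w => ?_
  unfold maRisk
  simp_rw [loss_response hX hφ hf subset_rfl]
  rw [(h.isSeqNoise hn hX hφ hσ).integral_seqLoss]
  exact linearOracle_le_seqRisk (by positivity) _

lemma msRisk_eq (hn : 1 ≤ n) (hX : LinearIndependent ℝ (fun j : Fin p => Xᵀ j))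
    (hφ : IsNestedBasis X φ) (hf : f = X *ᵥ β) (hσ : 0 < σ) (h : IsNoise ε μ σ B) {m : ℕ}
    (hm : m ≤ p) : msRisk μ X f ε m
      = ∑ l ∈ Finset.Ioc m p, theta φ f l ^ 2 + σ ^ 2 / n * m := by
  have e1 : ∀ ω, loss (nestedProj X m *ᵥ response f ε ω) f
      = seqLoss p (theta φ f) (fun l => theta φ (fun i => ε i ω) l)
        (fun l => if l ≤ m then 1 else 0) := by
    intro ω
    rw [nestedProj_eq_sum_indicator hφ hm]
    exact loss_sum_mulVec hX hφ hf _ (fun i => ε i ω)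
  unfold msRisk
  simp_rw [e1]
  rw [(h.isSeqNoise hn hX hφ hσ).integral_seqLoss, seqRisk,
    ← Finset.sum_Ioc_consecutive _ (Nat.zero_le m) hm,
    ← Finset.sum_Ioc_consecutive (fun l => (if l ≤ m then (1 : ℝ) else 0) ^ 2) (Nat.zero_le m) hm]
  have z1 : ∑ l ∈ Finset.Ioc 0 m, (1 - if l ≤ m then (1 : ℝ) else 0) ^ 2 * theta φ f l ^ 2 = 0 :=
    Finset.sum_eq_zero fun l hl => by simp [(Finset.mem_Ioc.1 hl).2]
  have z2 : ∑ l ∈ Finset.Ioc m p, (1 - if l ≤ m then (1 : ℝ) else 0) ^ 2 * theta φ f l ^ 2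
      = ∑ l ∈ Finset.Ioc m p, theta φ f l ^ 2 := by
    refine Finset.sum_congr rfl fun l hl => ?_
    rw [if_neg (not_le.2 (Finset.mem_Ioc.1 hl).1)]; ring
  have z3 : ∑ l ∈ Finset.Ioc 0 m, (if l ≤ m then (1 : ℝ) else 0) ^ 2 = m := by
    rw [Finset.sum_congr rfl fun l hl => by rw [if_pos (Finset.mem_Ioc.1 hl).2]]
    simp
  have z4 : ∑ l ∈ Finset.Ioc m p, (if l ≤ m then (1 : ℝ) else 0) ^ 2 = 0 :=
    Finset.sum_eq_zero fun l hl => by simp [(Finset.mem_Ioc.1 hl).1]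
  rw [z1, z2, z3, z4]; ring

/-- Passing from size `k` to `k + 1` changes the risk by `σ² / n - θ_{k+1}²`; comparing `m` with its
neighbours gives both bounds. The condition `2 ≤ m` keeps `m - 1` an admissible size. -/
lemma best_size_bounds (hn : 1 ≤ n) (hX : LinearIndependent ℝ (fun j : Fin p => Xᵀ j))
    (hφ : IsNestedBasis X φ) (hf : f = X *ᵥ β) (hσ : 0 < σ) (h : IsNoise ε μ σ B) {m : ℕ}
    (hm : m ∈ Finset.Icc 1 p)
    (hmin : ∀ k ∈ Finset.Icc 1 p, msRisk μ X f ε m ≤ msRisk μ X f ε k) :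
    (2 ≤ m → σ ^ 2 / n ≤ theta φ f m ^ 2) ∧ (m + 1 ≤ p → theta φ f (m + 1) ^ 2 ≤ σ ^ 2 / n) := by
  rw [Finset.mem_Icc] at hm
  have hsplit : ∀ k, k + 1 ≤ p → ∑ l ∈ Finset.Ioc k p, theta φ f l ^ 2
      = theta φ f (k + 1) ^ 2 + ∑ l ∈ Finset.Ioc (k + 1) p, theta φ f l ^ 2 := by
    intro k hk
    rw [← Finset.sum_Ioc_consecutive _ (Nat.le_succ k) hk, Nat.succ_eq_add_one,
      Nat.Ioc_succ_singleton, Finset.sum_singleton]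
  constructor
  · intro h2
    obtain ⟨k, rfl⟩ : ∃ k, m = k + 1 := ⟨m - 1, by omega⟩
    have := hmin k (Finset.mem_Icc.2 ⟨by omega, by omega⟩)
    rw [msRisk_eq hn hX hφ hf hσ h hm.2, msRisk_eq hn hX hφ hf hσ h (by omega),
      hsplit k hm.2] at this
    push_cast at this
    linarith
  · intro h2
    have := hmin (m + 1) (Finset.mem_Icc.2 ⟨by omega, h2⟩)
    rw [msRisk_eq hn hX hφ hf hσ h hm.2, msRisk_eq hn hX hφ hf hσ h h2, hsplit m h2] at this
    push_cast at this
    linarith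

/-- The sequence-model inequality with penalty error `τ = (v - σ²) / n`; the summand `‖y‖² / n` of
the criterion is common to all weights and cancels. -/
theorem nested_oracle_inequality (hn : 1 ≤ n) (hX : LinearIndependent ℝ (fun j : Fin p => Xᵀ j))
    (hφ : IsNestedBasis X φ) (hf : f = X *ᵥ β) (hσ : 0 < σ) (hB : 0 ≤ B) (h : IsNoise ε μ σ B)
    (h_pos : ∀ j ∈ Finset.Icc 1 p, 0 < |theta φ f j|) {v : Ω → ℝ}
    (hv : Integrable (fun ω => (v ω - σ ^ 2) ^ 2) μ) {a b : ℕ} (ha : 1 ≤ a) (hab : a ≤ b)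
    (hb : b ≤ p) {W : Ω → Finset.Icc a b → ℝ} (hW : Measurable W)
    (hmem : ∀ ω, W ω ∈ stdSimplex ℝ (Finset.Icc a b))
    (hmin : ∀ ω, IsMinOn (criterion X (Finset.Icc a b) (response f ε ω) (v ω))
      (stdSimplex ℝ (Finset.Icc a b)) (W ω))
    {w : Finset.Icc a b → ℝ} (hw : w ∈ stdSimplex ℝ (Finset.Icc a b))
    {δ : ℝ} (hδ : 0 < δ) (hδ' : δ ≤ 1 / 2) :
    expRisk μ σ X f (Finset.Icc a b) W
      ≤ (1 + 7 * δ) * seqRisk p (σ ^ 2 / n) (theta φ f) (cumWeight _ w)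
        + 2 / δ * ((256 + 320 * ((2 * B + 4 * σ ^ 4) / σ ^ 4)) * (σ ^ 2 / n)
            * psi (theta φ f) (Finset.Icc a b)
          + 16 * ((p : ℝ) / (σ ^ 2 / n)) * ((∫ ω, (v ω - σ ^ 2) ^ 2 ∂μ) / n ^ 2)) ∧
    expLoss μ X f ε (Finset.Icc a b) W
      ≤ (1 + 7 * δ) * seqRisk p (σ ^ 2 / n) (theta φ f) (cumWeight _ w)
        + 2 / δ * ((256 + 320 * ((2 * B + 4 * σ ^ 4) / σ ^ 4)) * (σ ^ 2 / n)
            * psi (theta φ f) (Finset.Icc a b)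
          + 16 * ((p : ℝ) / (σ ^ 2 / n)) * ((∫ ω, (v ω - σ ^ 2) ^ 2 ∂μ) / n ^ 2)) := by
  have hn0 : (0 : ℝ) < n := by exact_mod_cast hn
  have hK : Finset.Icc a b ⊆ Finset.Icc 1 p := Finset.Icc_subset_Icc ha hb
  have hτsq : ∀ ω, ((v ω - σ ^ 2) / n) ^ 2 = (v ω - σ ^ 2) ^ 2 / (n : ℝ) ^ 2 := fun ω =>
    div_pow _ _ _
  have hτ : Integrable (fun ω => ((v ω - σ ^ 2) / n) ^ 2) μ := by
    simp_rw [hτsq]; exact hv.div_const _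
  have hcrit : ∀ ω, seqCrit p (σ ^ 2 / n + (v ω - σ ^ 2) / n)
      (fun l => theta φ f l + theta φ (fun i => ε i ω) l) (cumWeight _ (W ω))
      ≤ seqCrit p (σ ^ 2 / n + (v ω - σ ^ 2) / n)
      (fun l => theta φ f l + theta φ (fun i => ε i ω) l) (cumWeight _ w) := by
    intro ω
    have h1 : criterion X (Finset.Icc a b) (response f ε ω) (v ω) (W ω)
        ≤ criterion X (Finset.Icc a b) (response f ε ω) (v ω) w := hmin ω hw
    rw [criterion_eq hX hφ hK, criterion_eq hX hφ hK] at h1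
    have h2 : ∀ l, theta φ (response f ε ω) l = theta φ f l + theta φ (fun i => ε i ω) l := by
      intro l
      have : response f ε ω = f + fun i => ε i ω := rfl
      rw [theta, this, dotProduct_add, add_div]; rfl
    simp_rw [h2] at h1
    have h3 : 2 * (σ ^ 2 / n + (v ω - σ ^ 2) / n) = 2 * v ω / n := by ring
    unfold seqCrit
    rw [h3]
    linarith
  have main := (h.isSeqNoise hn hX hφ hσ).expected_oracle_inequality
    (show 0 < σ ^ 2 / (n : ℝ) by positivity) (by positivity) h_pos ha hab hb hτ hW hmem hw hcrit
    hδ hδ'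
  simp_rw [hτsq] at main
  rw [integral_div] at main
  unfold expRisk expLoss
  simp_rw [plugRisk_eq_seqRisk hX hφ hf hK, loss_response hX hφ hf hK]
  exact main

end RegressionModel

end MMA

end

/-! ### The main theorem. -/

theorem theorem4
    -- sample spaces, one for each sample size `n`
    {Ω : ℕ → Type*} [∀ n, MeasurableSpace (Ω n)]
    (μ : ∀ n, Measure (Ω n)) [∀ n, IsProbabilityMeasure (μ n)]
    -- the regression model `y = f + ε`, `f = X β`, with `X` of full column rank
    (p : ℕ → ℕ) (hp_pos : ∀ n, 1 ≤ n → 1 ≤ p n) (hp_le : ∀ n, p n ≤ n)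
    (X : ∀ n, Matrix (Fin n) (Fin (p n)) ℝ)
    (hX : ∀ n, LinearIndependent ℝ (fun j : Fin (p n) => (X n)ᵀ j))
    (β : ∀ n, Fin (p n) → ℝ)
    (f : ∀ n, Fin n → ℝ) (hf : ∀ n, f n = X n *ᵥ β n)
    -- i.i.d. centred sub-Gaussian noise with variance `σ²`
    (σ : ℝ) (hσ : 0 < σ) (η : ℝ≥0)
    (ε : ∀ n, Fin n → Ω n → ℝ)
    (hε_meas : ∀ n i, Measurable (ε n i))
    (hε_indep : ∀ n, iIndepFun (ε n) (μ n))
    (hε_ident : ∀ n i j, IdentDistrib (ε n i) (ε n j) (μ n) (μ n))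
    (hε_mean : ∀ n i, ∫ ω, ε n i ω ∂(μ n) = 0)
    (hε_var : ∀ n i, ∫ ω, ε n i ω ^ 2 ∂(μ n) = σ ^ 2)
    (hε_sub : ∀ n i, HasSubgaussianMGF (ε n i) (η ^ 2) (μ n))
    -- the basis defining the transformed coefficients `θ`
    (φ : ∀ n, ℕ → Fin n → ℝ) (hφ : ∀ n, MMA.IsNestedBasis (X n) (φ n))
    -- `limsup ‖f‖² / n < ∞`
    (h_bdd : ∃ C : ℝ, ∀ᶠ n in atTop, MMA.sqNorm (f n) / n ≤ C)
    -- completely ordered coefficients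
    (h_pos : ∀ n, ∀ j ∈ Finset.Icc 1 (p n), 0 < |MMA.theta (φ n) (f n) j|)
    (h_anti : ∀ n, ∀ i ∈ Finset.Icc 1 (p n), ∀ j ∈ Finset.Icc 1 (p n), i ≤ j →
      |MMA.theta (φ n) (f n) j| ≤ |MMA.theta (φ n) (f n) i|)
    -- decay: `|θ_{⌊κ l⌋} / θ_l| → 0` as `κ → ∞`, uniformly in `l`
    (h_decay : ∀ e : ℝ, 0 < e → ∀ᶠ κ : ℝ in atTop, ∀ n l : ℕ, 1 ≤ l → ⌊κ * (l : ℝ)⌋₊ ≤ p n →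
      |MMA.theta (φ n) (f n) ⌊κ * (l : ℝ)⌋₊ / MMA.theta (φ n) (f n) l| ≤ e)
    -- the estimator of `σ²` and the variance condition for all nested models
    (σ2hat : ∀ n, Ω n → ℝ) (hσ2_meas : ∀ n, Measurable (σ2hat n))
    (hσ2_int : ∀ n, Integrable (fun ω => (σ2hat n ω - σ ^ 2) ^ 2) (μ n))
    (h_var : (fun n => (p n : ℝ) * ∫ ω, (σ2hat n ω - σ ^ 2) ^ 2 ∂(μ n)) =o[atTop]
      (fun n => (n : ℝ) * MMA.optRisk (μ n) (X n) (f n) (ε n) (Finset.Icc 1 (p n))))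
    -- for every nested candidate set, the weights minimize the MMA criterion on the simplex
    (what : ∀ n, ∀ K : Finset ℕ, Ω n → K → ℝ)
    (hw_meas : ∀ n K, Measurable (what n K))
    (hw_mem : ∀ n, ∀ K : Finset ℕ, K.Nonempty → K ⊆ Finset.Icc 1 (p n) → ∀ ω,
      what n K ω ∈ stdSimplex ℝ K)
    (hw_min : ∀ n, ∀ K : Finset ℕ, K.Nonempty → K ⊆ Finset.Icc 1 (p n) → ∀ ω,
      IsMinOn (MMA.criterion (X n) K (MMA.response (f n) (ε n) ω) (σ2hat n ω))
        (stdSimplex ℝ K) (what n K ω))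
    -- the optimal size of a single nested model
    (mstar : ℕ → ℕ) (hm_mem : ∀ n, 1 ≤ n → mstar n ∈ Finset.Icc 1 (p n))
    (hm_min : ∀ n, 1 ≤ n → ∀ m ∈ Finset.Icc 1 (p n),
      MMA.msRisk (μ n) (X n) (f n) (ε n) (mstar n) ≤ MMA.msRisk (μ n) (X n) (f n) (ε n) m)
    -- the selected size and the widening factors
    (mhat : ∀ n, Ω n → ℕ) (hmhat_meas : ∀ n, Measurable (mhat n))
    (hmhat_mem : ∀ n, 1 ≤ n → ∀ ω, mhat n ω ∈ Finset.Icc 1 (p n))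
    (κl κu : ℕ → ℝ) (hκl : ∀ n, 1 < κl n) (hκu : ∀ n, 1 < κu n)
    (hκl_lim : Tendsto κl atTop atTop) (hκu_lim : Tendsto κu atTop atTop)
    -- `𝔼 ψ = o(m*)` and `ℙ(F̄) = o(m* / n)`
    (h_psi : (fun n => ∫ ω, MMA.psi (MMA.theta (φ n) (f n))
        (MMA.msSet (p n) (κl n) (κu n) (mhat n ω)) ∂(μ n)) =o[atTop]
      (fun n => (mstar n : ℝ)))
    (c₁ c₂ : ℝ) (hc₁ : 0 < c₁) (hc₁' : c₁ < 1) (hc₂ : 1 < c₂)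
    (h_F : (fun n => (μ n).real
        {ω | ¬ (⌊c₁ * (mstar n : ℝ)⌋₊ ≤ mhat n ω ∧ mhat n ω ≤ ⌊c₂ * (mstar n : ℝ)⌋₊)}) =o[atTop]
      (fun n => (mstar n : ℝ) / n)) :
    -- the losses and risks of the MMA estimators are integrable
    (∀ n, ∀ K : Finset ℕ, K.Nonempty → K ⊆ Finset.Icc 1 (p n) →
      Integrable (fun ω => MMA.loss
        (MMA.avgProj (X n) K (what n K ω) *ᵥ MMA.response (f n) (ε n) ω) (f n)) (μ n) ∧
      Integrable (fun ω => MMA.plugRisk σ (X n) (f n) K (what n K ω)) (μ n)) ∧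
    -- full AOP in expectation, for both risk functions of the MMA estimator
    MMA.LeOnePlusLittleO
      (fun n => ∫ ω, (fun K => MMA.expLoss (μ n) (X n) (f n) (ε n) K (what n K))
        (MMA.msSet (p n) (κl n) (κu n) (mhat n ω)) ∂(μ n))
      (fun n => MMA.optRisk (μ n) (X n) (f n) (ε n) (Finset.Icc 1 (p n))) ∧
    MMA.LeOnePlusLittleO
      (fun n => ∫ ω, (fun K => MMA.expRisk (μ n) σ (X n) (f n) K (what n K))
        (MMA.msSet (p n) (κl n) (κu n) (mhat n ω)) ∂(μ n))
      (fun n => MMA.optRisk (μ n) (X n) (f n) (ε n) (Finset.Icc 1 (p n))) := by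
  set B : ℝ := 48 * Real.exp (((η ^ 2 : ℝ≥0) : ℝ) / 2)
  have hB : 0 ≤ B := by positivity
  have hnoise : ∀ n, MMA.IsNoise (ε n) (μ n) σ B := fun n =>
    MMA.isNoise_of_subgaussian (hε_meas n) (hε_indep n) (hε_mean n) (hε_var n) (hε_sub n)
  have hD : 0 ≤ 256 + 320 * ((2 * B + 4 * σ ^ 4) / σ ^ 4) := by positivity
  have hbest := fun n (hn : 1 ≤ n) => MMA.best_size_bounds hn (hX n) (hφ n) (hf n) hσ (hnoise n)
    (hm_mem n hn) (hm_min n hn)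
  have hbdd : ∃ C : ℝ, ∀ᶠ n in atTop,
      ∑ l ∈ Finset.Ioc 0 (p n), MMA.theta (φ n) (f n) l ^ 2 ≤ C := by
    obtain ⟨C, hC⟩ := h_bdd
    refine ⟨C, hC.mono fun n hn => ?_⟩
    rwa [MMA.sqNorm_div_eq (hX n) (hφ n) (hf n)] at hn
  -- The size `m` is deterministic here; the random size enters only when this bound is integrated.
  have hmain := fun n (hn : 1 ≤ n) m (hm : m ∈ Finset.Icc 1 (p n))
      (w : MMA.msSet (p n) (κl n) (κu n) m → ℝ)
      (hw : w ∈ stdSimplex ℝ (MMA.msSet (p n) (κl n) (κu n) m)) (δ : ℝ) (hδ : 0 < δ)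
      (hδ' : δ ≤ 1 / 2) => by
    obtain ⟨ha, hab, hb⟩ := MMA.msSet_bounds (hκl n) (hκu n) hm
    have hne : (MMA.msSet (p n) (κl n) (κu n) m).Nonempty := Finset.nonempty_Icc.2 hab
    have hsub : MMA.msSet (p n) (κl n) (κu n) m ⊆ Finset.Icc 1 (p n) :=
      Finset.Icc_subset_Icc ha hb
    exact MMA.nested_oracle_inequality hn (hX n) (hφ n) (hf n) hσ hB (hnoise n) (h_pos n)
      (hσ2_int n) ha hab hb (hw_meas n (MMA.msSet (p n) (κl n) (κu n) m)) (hw_mem n _ hne hsub)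
      (hw_min n _ hne hsub) hw hδ hδ'
  refine ⟨fun n K hne hK => ?_, ?_, ?_⟩
  -- A nonempty set of sizes inside `1, …, p n` rules out `n = 0`, because `p n ≤ n`.
  · have hn : 1 ≤ n := by
      obtain ⟨k, hk⟩ := hne
      have := Finset.mem_Icc.1 (hK hk)
      have := hp_le n
      omega
    simp_rw [MMA.plugRisk_eq_seqRisk (hX n) (hφ n) (hf n) hK,
      MMA.loss_response (hX n) (hφ n) (hf n) hK]
    exact ⟨((hnoise n).isSeqNoise hn (hX n) (hφ n) hσ).integrable_seqLoss _ (hw_meas n K)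
        (hw_mem n K hne hK),
      MMA.integrable_seqRisk _ _ _ (hw_meas n K) (hw_mem n K hne hK)⟩
  · exact MMA.asymptotic_optimality μ hp_le hσ hbdd h_pos h_anti h_decay
      (fun n hn => MMA.linearOracle_le_optRisk (hp_pos n hn) hn (hX n) (hφ n) (hf n) hσ (hnoise n))
      h_var hm_mem (fun n hn => (hbest n hn).1) (fun n hn => (hbest n hn).2) hmhat_meas hmhat_mem
      hκl hκu hκl_lim hκu_lim h_psi hc₁ hc₂ h_F hD
      (F := fun n m => MMA.expLoss (μ n) (X n) (f n) (ε n) (MMA.msSet (p n) (κl n) (κu n) m)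
        (what n (MMA.msSet (p n) (κl n) (κu n) m)))
      (fun n hn m hm w hw δ hδ hδ' => (hmain n hn m hm w hw δ hδ hδ').2)
  · exact MMA.asymptotic_optimality μ hp_le hσ hbdd h_pos h_anti h_decay
      (fun n hn => MMA.linearOracle_le_optRisk (hp_pos n hn) hn (hX n) (hφ n) (hf n) hσ (hnoise n))
      h_var hm_mem (fun n hn => (hbest n hn).1) (fun n hn => (hbest n hn).2) hmhat_meas hmhat_mem
      hκl hκu hκl_lim hκu_lim h_psi hc₁ hc₂ h_F hD
      (F := fun n m => MMA.expRisk (μ n) σ (X n) (f n) (MMA.msSet (p n) (κl n) (κu n) m)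
        (what n (MMA.msSet (p n) (κl n) (κu n) m)))
      (fun n hn m hm w hw δ hδ hδ' => (hmain n hn m hm w hw δ hδ hδ').1)
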